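/- **Setting.** Let $\mathcal S\subseteq\mathbb R^{d_1}$, $\mathcal A\subseteq\mathbb R^{d_2}$, $\mathcal X=\mathcal S\times\mathcal A\subseteq\mathbb R^{d}=\mathbb R^{d_1}\times\mathbb R^{d_2}$. Consider a Markov decision process with transition kernel $P$ from $\mathcal X$ to $\mathcal S$, reward kernel $R$ from $\mathcal X$ to $\mathbb R$, and discount factor $\gamma\in(0,1)$, together with a policy $\pi$ (a Markov kernel from $\mathcal S$ to $\mathcal A$). Let $\mathcal D$ be a stationary distribution on $\mathcal X$, i.e. a probability measure invariant under $(s,a)\mapsto(s',a')$, $s'\sim P(\cdot\mid s,a)$, $a'\sim\pi(\cdot\mid s')$. Let $\tilde{\mathcal D}$ be the law of $(x,r,x')$ with $x=(s,a)\sim\mathcal D$, $r\sim R(\cdot\mid s,a)$, $x'=(s',a')$, $s'\sim P(\cdot\mid s,a)$, $a'\sim\pi(\cdot\mid s')$, where $r$ and $x'$ are conditionally independent given $x$. Let $(\mathcal T^\pi Q)(s,a)=\mathbb E[r+\gamma Q(s',a')\mid s,a]$ be the Bellman operator. Let $\sigma:\mathbb R^d\times\mathbb R^D\to\mathbb R$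 be a measurable activation function, twice differentiable in its second argument for every $x\in\mathcal X$. Assume that $\|x\|\le 1$ for all $x\in\mathcal X$, that $$|\sigma(x;\theta)|\le B_0,\qquad \|\nabla_\theta\sigma(x;\theta)\|\le B_1\|x\|,\qquad \|\nabla^2_{\theta\theta}\sigma(x;\theta)\|_{\mathrm F}\le B_2\|x\|^2\qquad(x\in\mathcal X,\ \theta\in\mathbb R^D),$$ and that $|r|\le B_r$ almost surely under $R(\cdot\mid x)$ for every $x\in\mathcal X$. For $\alpha>0$ put $$\hat Q(x;\theta^{(m)})=\frac{\alpha}{m}\sum_{i=1}^m\sigma(x;\theta_i)\ \text{ for } \theta^{(m)}=(\theta_1,\dots,\theta_m),\qquad Q(x;\rho)=\alpha\int\sigma(x;\theta)\,d\rho(\theta).$$ Let $\mathcal F=\{\int\sigma(\cdot;\theta)\,d\rho(\theta):\rho\in\mathscr P_2(\mathbb R^D)\}$, where $\mathscr P_2$ denotes the probability measures with finite second moment, and let $Q^*\in\mathcal F$ be a solution of the projected Bellman equation $Q^*=\Pi_{\mathcal F}\mathcal T^\pi Q^*$, where $\Pi_{\mathcal F}$ is the projection onto $\mathcal F$ in $L^2(\mathcal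 D)$. *TD dynamics.* Let $\eta,\varepsilon>0$, let $\rho_0$ be a probability measure on $\mathbb R^D$, let $\theta_1(0),\dots,\theta_m(0)$ be i.i.d. with law $\rho_0$, and let $(x_k,r_k,x_k')_{k\in\mathbb N}$ be i.i.d. with law $\tilde{\mathcal D}$ and independent of the initialization. For $k\in\mathbb N$ and $i\in\{1,\dots,m\}$, $$\theta_i(k+1)=\theta_i(k)-\eta\varepsilon\alpha\Bigl(\hat Q(x_k;\theta^{(m)}(k))-r_k-\gamma\hat Q(x_k';\theta^{(m)}(k))\Bigr)\nabla_\theta\sigma(x_k;\theta_i(k)).$$ *PDE.* Let $T\ge 0$ and let $(\rho_t)_{t\in[0,T]}$ be a weakly continuous curve of probability measures on $\mathbb R^D$ starting at $\rho_0$ that solves, in the sense of distributions, $$\partial_t\rho_t=-\eta\,\mathrm{div}\bigl(\rho_t\,g(\cdot;\rho_t)\bigr),\qquad g(\theta;\rho)=-\alpha\,\mathbb E_{(x,r,x')\sim\tilde{\mathcal D}}\bigl[(Q(x;\rho)-r-\gamma Q(x';\rho))\nabla_\theta\sigma(x;\theta)\bigr].$$ **Lemma.** There is a constant $B>0$ depending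 only on $\alpha,\eta,\gamma,B_0,B_1,B_2,B_r$ such that, in the above setting, for all $T\ge0$, $\varepsilon>0$, $m\ge1$ and $\delta\in(0,1)$ with $m\ge 2$ or $\delta\le 1/2$, with probability at least $1-\delta$ the following holds simultaneously for all $k\in\mathbb N$ with $k\le T/\varepsilon$: $$\mathbb E_{x\sim\mathcal D}\Bigl[\bigl(\hat Q(x;\theta^{(m)}(k))-Q^*(x)\bigr)^2\Bigr]\le \mathbb E_{x\sim\mathcal D}\Bigl[\bigl(Q(x;\rho_{k\varepsilon})-Q^*(x)\bigr)^2\Bigr]+B e^{BT}\Bigl(\sqrt{m^{-1}\log(m/\delta)}+\sqrt{\varepsilon\,(D+\log(m/\delta))}\Bigr).$$ -/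

import Mathlib

open MeasureTheory ProbabilityTheory

/-- The parameter space `ℝ^D` with its Euclidean norm. -/
abbrev Param (D : ℕ) : Type := EuclideanSpace ℝ (Fin D)

/-- The space `ℝ^d = ℝ^{d₁} × ℝ^{d₂}` of state-action pairs, with its Euclidean norm
`‖(s, a)‖² = ‖s‖² + ‖a‖²`. -/
abbrev Ambient (d₁ d₂ : ℕ) : Type :=
  WithLp 2 (EuclideanSpace ℝ (Fin d₁) × EuclideanSpace ℝ (Fin d₂))

/-- A state-action pair `x = (s, a) ∈ 𝒳 = 𝒮 × 𝒜`, regarded as a point of `ℝ^d`. -/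
def pairPoint {d₁ d₂ : ℕ} {S : Set (EuclideanSpace ℝ (Fin d₁))}
    {A : Set (EuclideanSpace ℝ (Fin d₂))} (x : S × A) : Ambient d₁ d₂ :=
  WithLp.toLp 2 ((x.1 : EuclideanSpace ℝ (Fin d₁)), (x.2 : EuclideanSpace ℝ (Fin d₂)))

noncomputable section

section Markov

variable {𝒮 𝒜 : Type*} [MeasurableSpace 𝒮] [MeasurableSpace 𝒜]

/-- The law of `(s', a')` given `(s, a)`: `s' ∼ P(· | s, a)` and `a' ∼ π(· | s')`. -/
def pairKernel (P : Kernel (𝒮 × 𝒜) 𝒮) (π : Kernel 𝒮 𝒜) : Kernel (𝒮 × 𝒜) (𝒮 × 𝒜) :=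
  P ⊗ₖ Kernel.prodMkLeft (𝒮 × 𝒜) π

/-- The law of `(r, (s', a'))` given `(s, a)`: `r ∼ R(· | s, a)`, `s' ∼ P(· | s, a)` and
`a' ∼ π(· | s')`. -/
def sampleKernel (P : Kernel (𝒮 × 𝒜) 𝒮) (R : Kernel (𝒮 × 𝒜) ℝ) (π : Kernel 𝒮 𝒜) :
    Kernel (𝒮 × 𝒜) (ℝ × (𝒮 × 𝒜)) :=
  R ×ₖ pairKernel P π

/-- The law of the transition `(x, (r, x'))` with `x ∼ 𝒟`. -/
def sampleLaw (P : Kernel (𝒮 × 𝒜) 𝒮) (R : Kernel (𝒮 × 𝒜) ℝ) (π : Kernel 𝒮 𝒜)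
    (𝒟 : Measure (𝒮 × 𝒜)) : Measure ((𝒮 × 𝒜) × (ℝ × (𝒮 × 𝒜))) :=
  𝒟 ⊗ₘ sampleKernel P R π

/-- The Bellman operator `(𝒯^π Q)(s, a) = 𝔼[r + γ Q(s', a')]`. -/
def bellman (P : Kernel (𝒮 × 𝒜) 𝒮) (R : Kernel (𝒮 × 𝒜) ℝ) (π : Kernel 𝒮 𝒜) (γ : ℝ)
    (Q : 𝒮 × 𝒜 → ℝ) (x : 𝒮 × 𝒜) : ℝ :=
  ∫ y, (y.1 + γ * Q y.2) ∂(sampleKernel P R π x)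

end Markov

section Network

variable {X : Type*} [MeasurableSpace X] {D m : ℕ}

/-- The finite-width network `Q̂(x; θ) = (α / m) ∑ᵢ s(x; θᵢ)`. -/
def finiteQ (α : ℝ) (s : X → Param D → ℝ) (θ : Fin m → Param D) (x : X) : ℝ :=
  α / m * ∑ i, s x (θ i)

/-- The infinite-width network `Q(x; ρ) = α ∫ s(x; θ) dρ(θ)`. -/
def meanFieldQ (α : ℝ) (s : X → Param D → ℝ) (ρ : Measure (Param D)) (x : X) : ℝ :=
  α * ∫ θ, s x θ ∂ρ

/-- The function class `ℱ = {x ↦ ∫ s(x; θ) dρ(θ) | ρ ∈ 𝒫₂(ℝ^D)}`. -/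
def networkClass (s : X → Param D → ℝ) : Set (X → ℝ) :=
  {f | ∃ ρ : Measure (Param D), IsProbabilityMeasure ρ ∧ MemLp id 2 ρ ∧
    f = fun x => ∫ θ, s x θ ∂ρ}

/-- `f = Π_ℱ h`: `f` is a projection of `h` onto `ℱ` with respect to the `L²(𝒟)`-norm. -/
def IsProjection (𝒟 : Measure X) (ℱ : Set (X → ℝ)) (h f : X → ℝ) : Prop :=
  f ∈ ℱ ∧ ∀ f' ∈ ℱ, ∫ x, (f x - h x) ^ 2 ∂𝒟 ≤ ∫ x, (f' x - h x) ^ 2 ∂𝒟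

/-- The TD iterates `θ(k) = (θ₁(k), …, θₘ(k))` with initialization `θ(0) = θ₀` and with the
transitions `z k = (x_k, (r_k, x'_k))`. -/
def tdIterate (α η γ ε : ℝ) (s : X → Param D → ℝ) (θ₀ : Fin m → Param D)
    (z : ℕ → X × (ℝ × X)) : ℕ → Fin m → Param D
  | 0 => θ₀
  | k + 1 => fun i =>
      tdIterate α η γ ε s θ₀ z k i -
        (η * ε * α * (finiteQ α s (tdIterate α η γ ε s θ₀ z k) (z k).1 - (z k).2.1
          - γ * finiteQ α s (tdIterate α η γ ε s θ₀ z k) (z k).2.2)) •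
        gradient (s (z k).1) (tdIterate α η γ ε s θ₀ z k i)

/-- The vector field
`g(θ; ρ) = - α 𝔼[(Q(x; ρ) - r - γ Q(x'; ρ)) ∇_θ s(x; θ)]`, where `(x, (r, x')) ∼ μ`. -/
def tdField (α γ : ℝ) (s : X → Param D → ℝ) (μ : Measure (X × (ℝ × X)))
    (ρ : Measure (Param D)) (θ : Param D) : Param D :=
  -(α • ∫ z, (meanFieldQ α s ρ z.1 - z.2.1 - γ * meanFieldQ α s ρ z.2.2) •
      gradient (s z.1) θ ∂μ)

/-- The weakly continuous curve `ρ : [0, T] → 𝒫(ℝ^D)` solves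
`∂ₜ ρₜ = - η div(ρₜ g(·; ρₜ))` in the sense of distributions, with initial value `ρ₀`. -/
structure IsPDESolution (α η γ T : ℝ) (s : X → Param D → ℝ) (μ : Measure (X × (ℝ × X)))
    (ρ₀ : ProbabilityMeasure (Param D)) (ρ : ℝ → ProbabilityMeasure (Param D)) : Prop where
  continuousOn : ContinuousOn ρ (Set.Icc 0 T)
  initial : ρ 0 = ρ₀
  weak : ∀ φ : Param D → ℝ, ContDiff ℝ ((⊤ : ℕ∞) : WithTop ℕ∞) φ → HasCompactSupport φ → ∀ t ∈ Set.Icc 0 T,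
    ∫ θ, φ θ ∂(ρ t : Measure (Param D)) - ∫ θ, φ θ ∂(ρ₀ : Measure (Param D)) =
      η * ∫ τ in (0 : ℝ)..t,
        ∫ θ, inner ℝ (gradient φ θ) (tdField α γ s μ (ρ τ) θ) ∂(ρ τ : Measure (Param D))

end Network

/-- The Frobenius norm of the Hessian of `f` at `θ`. -/
def hessianFrobenius {D : ℕ} (f : Param D → ℝ) (θ : Param D) : ℝ :=
  √(∑ i : Fin D, ‖fderiv ℝ (gradient f) θ (EuclideanSpace.single i 1)‖ ^ 2)

/-- `σ(x; ·)` is twice differentiable for `x ∈ 𝒳`, and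
`|σ(x; θ)| ≤ B₀`, `‖∇_θ σ(x; θ)‖ ≤ B₁ ‖x‖`, `‖∇²_θθ σ(x; θ)‖_F ≤ B₂ ‖x‖²`. -/
structure ActivationBounds {d₁ d₂ D : ℕ} (S : Set (EuclideanSpace ℝ (Fin d₁)))
    (A : Set (EuclideanSpace ℝ (Fin d₂))) (σ : Ambient d₁ d₂ → Param D → ℝ)
    (B₀ B₁ B₂ : ℝ) : Prop where
  differentiable : ∀ x : S × A, Differentiable ℝ (σ (pairPoint x))
  differentiable_gradient : ∀ x : S × A, Differentiable ℝ (gradient (σ (pairPoint x)))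
  bound_value : ∀ (x : S × A) (θ : Param D), |σ (pairPoint x) θ| ≤ B₀
  bound_gradient : ∀ (x : S × A) (θ : Param D),
    ‖gradient (σ (pairPoint x)) θ‖ ≤ B₁ * ‖pairPoint x‖
  bound_hessian : ∀ (x : S × A) (θ : Param D),
    hessianFrobenius (σ (pairPoint x)) θ ≤ B₂ * ‖pairPoint x‖ ^ 2

end

/-!
The constants are uniform in the dimensions, the width `m` and the step size `ε`, so every estimate
below is free of the dimension of the parameter space. Write `v t = η g(· ; ρ t)` for the velocity
field of the PDE. The bounds on the activation and on the reward make `v` bounded by a constant `M`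
and Lipschitz in the parameter (`TDModel.isTransport`), and the PDE then makes it Lipschitz in time
(`TDModel.norm_field_sub_le`).

*Characteristics.* Let `Φ k` be the map that follows an Euler scheme for `v` up to time `k ε`, with
steps much smaller than `ε`. The push-forward of `ρ 0` by `Φ k` agrees with `ρ (k ε)` against
bounded Lipschitz functions, up to an error as small as desired (`IsTransport.exists_flow`). This is
proved without a uniqueness theorem for the PDE. A test function is pulled back along one Euler step
after another. The weak formulation is applied to its mollification, and the error committed by
commuting the mollifier with a step is proportional to the length of the step.

*Coupling.* The `i`-th particle is compared with the characteristic `Φ k (θ₀ i)` that starts at the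
same point. The error of the network in `L¹(𝒟)` is then at most the mean distance between particles
and characteristics, plus the deviation of an empirical average over the i.i.d. points `θ₀ i` from
its expectation, plus the error of the transport. Stationarity makes `𝒟` the law of both `x` and
`x'`, so this `L¹(𝒟)` error controls the difference between the mean drifts of the particles and of
the characteristics. A discrete Grönwall inequality closes the estimate, once two random quantities
are bounded uniformly in the number of steps:

* the accumulated noise of the stochastic steps, a martingale in the Euclidean space `(ℝ^D)^m`. For
  increments bounded by `C`, the quantity `exp (c ‖S‖²)` stays integrable along the sum `S` if the
  rate `c` is lowered slowly. Freezing the path at its first passage above a level `r` turns the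
  bound at the final time into a maximal inequality (`measure_exists_le_norm_sum_le`);
* the deviation of the empirical averages along the slowly varying functions `σ(x; Φ k ·)`. The
  initial function and the increments are averaged together over one enlarged probability space, so
  that Jensen's inequality and the scalar exponential bound give a bound uniform in `k`, without a
  union bound (`measure_exists_le_meanDeviation_le`).

*Conclusion.* `TDModel.exists_const_measure_le` collects these estimates for `ε ≤ 1`. Since all
value functions are bounded, an `L¹(𝒟)` error between two of them bounds the difference of their
mean squared distances to `Q*`. For `ε > 1` the claimed error term exceeds the trivial bound on the
left-hand side.
-/

/-! ### Lipschitz test functions and their mollification -/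

/-- A compactly supported function on the parameter space that is `ℓ`-Lipschitz. -/
structure LipTest {D : ℕ} (ℓ : ℝ) (f : Param D → ℝ) : Prop where
  lip : ∀ x y, |f x - f y| ≤ ℓ * ‖x - y‖
  cpt : HasCompactSupport f

theorem continuous_of_abs_sub_le {D : ℕ} {ℓ : ℝ} {f : Param D → ℝ}
    (h : ∀ x y, |f x - f y| ≤ ℓ * ‖x - y‖) : Continuous f :=
  (LipschitzWith.of_dist_le' (K := ℓ) fun x y => by
    rw [Real.dist_eq, dist_eq_norm]; exact h x y).continuous

theorem LipTest.continuous {D : ℕ} {ℓ : ℝ} {f : Param D → ℝ} (hf : LipTest ℓ f) :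
    Continuous f := continuous_of_abs_sub_le hf.lip

theorem norm_gradient_le_of_abs_sub_le {D : ℕ} {ℓ : ℝ} (hℓ : 0 ≤ ℓ) {f : Param D → ℝ}
    (h : ∀ x y, |f x - f y| ≤ ℓ * ‖x - y‖) (x : Param D) : ‖gradient f x‖ ≤ ℓ := by
  have hl : LipschitzWith ℓ.toNNReal f := LipschitzWith.of_dist_le' fun x y => by
    rw [Real.dist_eq, dist_eq_norm]; exact h x y
  have := norm_fderiv_le_of_lipschitz ℝ hl (x₀ := x)
  rw [gradient, LinearIsometryEquiv.norm_map]
  rwa [Real.coe_toNNReal _ hℓ] at this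

theorem abs_sub_le_of_norm_gradient_le {D : ℕ} {ℓ : ℝ} {f : Param D → ℝ}
    (hd : Differentiable ℝ f) (h : ∀ x, ‖gradient f x‖ ≤ ℓ) (x y : Param D) :
    |f x - f y| ≤ ℓ * ‖x - y‖ := by
  refine Convex.norm_image_sub_le_of_norm_fderiv_le (𝕜 := ℝ) (fun z _ => hd z) (fun z _ => ?_)
    convex_univ (Set.mem_univ y) (Set.mem_univ x)
  have := h z
  rwa [gradient, LinearIsometryEquiv.norm_map] at this

theorem inner_gradient_eq_fderiv {D : ℕ} (f : Param D → ℝ) (x u : Param D) :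
    inner ℝ (gradient f x) u = fderiv ℝ f x u := by
  rw [gradient, InnerProductSpace.toDual_symm_apply]

/-- The first order Taylor estimate for a function with Lipschitz gradient. -/
theorem abs_sub_sub_inner_gradient_le {D : ℕ} {H : ℝ} {f : Param D → ℝ} (hH : 0 ≤ H)
    (hd : Differentiable ℝ f)
    (hg : ∀ x y, ‖gradient f x - gradient f y‖ ≤ H * ‖x - y‖) (x u : Param D) :
    |f (x + u) - f x - inner ℝ (gradient f x) u| ≤ H * ‖u‖ ^ 2 := by
  have key := Convex.norm_image_sub_le_of_norm_hasFDerivWithin_le' (𝕜 := ℝ)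
    (f := f) (f' := fderiv ℝ f) (φ := fderiv ℝ f x) (C := H * ‖u‖)
    (s := Metric.closedBall x ‖u‖) (x := x) (y := x + u)
    (fun z _ => (hd z).hasFDerivAt.hasFDerivWithinAt)
    (fun z hz => ?_) (convex_closedBall _ _) (by simp) (by simp)
  · rw [inner_gradient_eq_fderiv]
    simpa [pow_two, mul_assoc] using key
  · have h1 := hg z x
    rw [gradient, gradient, ← map_sub, LinearIsometryEquiv.norm_map] at h1
    refine h1.trans ?_
    gcongr
    simpa [dist_eq_norm] using hz

section Mollify

variable {D : ℕ} (φ : ContDiffBump (0 : Param D))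

/-- The mollification of `f`, that is, its convolution with the normalized bump `φ`. -/
noncomputable def mollify (f : Param D → ℝ) (x : Param D) : ℝ :=
  ∫ y, φ.normed volume y * f (x - y)

theorem mollify_eq_convolution (f : Param D → ℝ) :
    mollify φ f =
      MeasureTheory.convolution (φ.normed volume) f (ContinuousLinearMap.lsmul ℝ ℝ) volume := by
  ext x; rfl

theorem abs_integral_normed_mul_le {c : ℝ} {F : Param D → ℝ}
    (hF : ∀ y, ‖y‖ ≤ φ.rOut → |F y| ≤ c) :
    |∫ y, φ.normed volume y * F y| ≤ c := by
  have h1 : ∫ y, φ.normed volume y * c = c := by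
    rw [integral_mul_const, φ.integral_normed, one_mul]
  rw [← Real.norm_eq_abs, ← h1]
  refine norm_integral_le_of_norm_le (φ.integrable_normed.mul_const c)
    (Filter.Eventually.of_forall fun y => ?_)
  rw [norm_mul, Real.norm_of_nonneg (φ.nonneg_normed y)]
  by_cases hy : ‖y‖ ≤ φ.rOut
  · exact mul_le_mul_of_nonneg_left (hF y hy) (φ.nonneg_normed y)
  · have : φ.normed volume y = 0 := by
      by_contra h
      have h2 : y ∈ Function.support (φ.normed (volume : Measure (Param D))) := h
      rw [φ.support_normed_eq] at h2
      exact hy (by simpa using (Metric.mem_ball.1 h2).le)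
    simp [this]

theorem integrable_normed_mul {F : Param D → ℝ} (hF : Continuous F) :
    Integrable (fun y => φ.normed volume y * F y) :=
  (φ.continuous_normed.mul hF).integrable_of_hasCompactSupport
    (φ.hasCompactSupport_normed.mul_right)

/-- Comparing two averages against the same bump. -/
theorem abs_integral_normed_sub_le {c : ℝ} {F G : Param D → ℝ} (hF : Continuous F)
    (hG : Continuous G) (h : ∀ y, ‖y‖ ≤ φ.rOut → |F y - G y| ≤ c) :
    |(∫ y, φ.normed volume y * F y) - ∫ y, φ.normed volume y * G y| ≤ c := by
  rw [← integral_sub (integrable_normed_mul φ hF) (integrable_normed_mul φ hG)]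
  simp_rw [← mul_sub]
  exact abs_integral_normed_mul_le φ h

variable {φ} {f : Param D → ℝ} {ℓ : ℝ}

theorem LipTest.contDiff_mollify (hf : LipTest ℓ f) :
    ContDiff ℝ ((⊤ : ℕ∞) : WithTop ℕ∞) (mollify φ f) := by
  rw [mollify_eq_convolution]
  exact φ.hasCompactSupport_normed.contDiff_convolution_left _ φ.contDiff_normed
    hf.continuous.locallyIntegrable

theorem LipTest.lipTest_mollify (hf : LipTest ℓ f) : LipTest ℓ (mollify φ f) where
  lip x y := by
    have hc := hf.continuous
    refine abs_integral_normed_sub_le φ (F := fun z => f (x - z)) (G := fun z => f (y - z))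
      (by fun_prop) (by fun_prop) fun z _ => ?_
    simpa using hf.lip (x - z) (y - z)
  cpt := by
    rw [mollify_eq_convolution]
    exact φ.hasCompactSupport_normed.convolution _ hf.cpt

theorem LipTest.abs_mollify_sub_le (hℓ : 0 ≤ ℓ) (hf : LipTest ℓ f) (x : Param D) :
    |mollify φ f x - f x| ≤ ℓ * φ.rOut := by
  have h1 : ∫ y, φ.normed volume y * f x = f x := by
    rw [integral_mul_const, φ.integral_normed, one_mul]
  have hc := hf.continuous
  have := abs_integral_normed_sub_le φ (c := ℓ * φ.rOut) (F := fun y => f (x - y))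
    (G := fun _ => f x) (by fun_prop) (by fun_prop) fun z hz => ?_
  · rwa [h1] at this
  · refine (hf.lip _ _).trans ?_
    have : ‖x - z - x‖ = ‖z‖ := by rw [sub_sub_cancel_left, norm_neg]
    rw [this]; gcongr

/-- Pulling back along `id + u` commutes with mollification up to the oscillation of `u` at the
scale of the bump. -/
theorem LipTest.abs_mollify_comp_sub_le (hℓ : 0 ≤ ℓ) (hf : LipTest ℓ f) {u : Param D → Param D}
    {L : ℝ} (hL : 0 ≤ L) (hu : ∀ x y, ‖u x - u y‖ ≤ L * ‖x - y‖) (x : Param D) :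
    |mollify φ f (x + u x) - mollify φ (fun y => f (y + u y)) x| ≤
      ℓ * (L * φ.rOut) := by
  have hc := hf.continuous
  have huc : Continuous u := (LipschitzWith.of_dist_le' (K := L) fun x y => by
    rw [dist_eq_norm, dist_eq_norm]; exact hu x y).continuous
  refine abs_integral_normed_sub_le φ (F := fun z => f (x + u x - z))
    (G := fun z => f (x - z + u (x - z))) (by fun_prop) (by fun_prop) fun z hz => ?_
  refine (hf.lip _ _).trans ?_
  have h1 : x + u x - z - (x - z + u (x - z)) = u x - u (x - z) := by abel
  rw [h1]
  gcongr
  refine (hu _ _).trans ?_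
  rw [sub_sub_cancel]; gcongr

/-- A Lipschitz constant for the gradient of the mollification of a `1`-Lipschitz function. -/
noncomputable def mollifyConst (φ : ContDiffBump (0 : Param D)) : ℝ :=
  ∫ y, ‖fderiv ℝ (φ.normed (volume : Measure (Param D))) y‖

theorem mollifyConst_nonneg : 0 ≤ mollifyConst φ := integral_nonneg fun _ => norm_nonneg _

theorem LipTest.norm_gradient_mollify_sub_le (hf : LipTest ℓ f) (x y : Param D) :
    ‖gradient (mollify φ f) x - gradient (mollify φ f) y‖ ≤
      mollifyConst φ * ℓ * ‖x - y‖ := by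
  have hc := hf.continuous
  have hd : Continuous (fderiv ℝ (φ.normed (volume : Measure (Param D)))) :=
    (φ.contDiff_normed (n := 1)).continuous_fderiv (by norm_num)
  have hcs : HasCompactSupport (fderiv ℝ (φ.normed (volume : Measure (Param D)))) :=
    φ.hasCompactSupport_normed.fderiv ℝ
  have hint : ∀ x, Integrable fun z =>
      (ContinuousLinearMap.precompL (Param D) (ContinuousLinearMap.lsmul ℝ ℝ : ℝ →L[ℝ] ℝ →L[ℝ] ℝ))
        (fderiv ℝ (φ.normed (volume : Measure (Param D))) z) (f (x - z)) := by
    intro x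
    refine Continuous.integrable_of_hasCompactSupport (by fun_prop) ?_
    refine hcs.mono' ?_
    intro z hz
    apply subset_tsupport
    intro h0
    exact hz (by simp [h0])
  have hF : ∀ x, fderiv ℝ (mollify φ f) x = ∫ z,
      (ContinuousLinearMap.precompL (Param D) (ContinuousLinearMap.lsmul ℝ ℝ : ℝ →L[ℝ] ℝ →L[ℝ] ℝ))
        (fderiv ℝ (φ.normed (volume : Measure (Param D))) z) (f (x - z)) := by
    intro x
    rw [mollify_eq_convolution]
    exact (φ.hasCompactSupport_normed.hasFDerivAt_convolution_left _ φ.contDiff_normed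
      hc.locallyIntegrable x).fderiv
  rw [gradient, gradient, ← map_sub, LinearIsometryEquiv.norm_map, hF, hF,
    ← integral_sub (hint x) (hint y)]
  rw [mollifyConst, mul_assoc, ← integral_mul_const]
  refine norm_integral_le_of_norm_le ((hd.norm.integrable_of_hasCompactSupport
    hcs.norm).mul_const _) (Filter.Eventually.of_forall fun z => ?_)
  rw [← map_sub]
  refine ContinuousLinearMap.opNorm_le_bound _ (mul_nonneg (norm_nonneg _) ?_) fun v => ?_
  · exact (abs_nonneg _).trans (hf.lip x y)
  · simp only [ContinuousLinearMap.precompL_apply, ContinuousLinearMap.lsmul_apply, smul_eq_mul,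
      norm_mul]
    have h1 := ContinuousLinearMap.le_opNorm (fderiv ℝ (φ.normed (volume : Measure (Param D))) z) v
    have h2 := hf.lip (x - z) (y - z)
    rw [sub_sub_sub_cancel_right] at h2
    calc _ ≤ (‖fderiv ℝ (φ.normed (volume : Measure (Param D))) z‖ * ‖v‖) * (ℓ * ‖x - y‖) := by
          gcongr; exact h2
      _ = _ := by ring

end Mollify

/-! ### Weak solutions of the continuity equation and the Euler scheme -/

theorem integrable_of_abs_le {α : Type*} [MeasurableSpace α] {μ : Measure α} [IsFiniteMeasure μ]
    {f : α → ℝ} (hf : AEStronglyMeasurable f μ) {c : ℝ} (h : ∀ x, |f x| ≤ c) : Integrable f μ :=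
  Integrable.of_bound hf c (Filter.Eventually.of_forall h)

theorem abs_integral_le_of_abs_le {α : Type*} [MeasurableSpace α] {μ : Measure α}
    [IsProbabilityMeasure μ] {f : α → ℝ} {c : ℝ} (h : ∀ᵐ x ∂μ, |f x| ≤ c) :
    |∫ x, f x ∂μ| ≤ c := by
  simpa using norm_integral_le_of_norm_le_const (μ := μ) (f := f) (C := c) h

theorem LipTest.integrable {D : ℕ} {ℓ : ℝ} {f : Param D → ℝ} (hf : LipTest ℓ f)
    (μ : Measure (Param D)) [IsFiniteMeasure μ] : Integrable f μ :=
  hf.continuous.integrable_of_hasCompactSupport hf.cpt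

theorem continuous_of_norm_sub_le {D : ℕ} {L : ℝ} {u : Param D → Param D}
    (hu : ∀ x y, ‖u x - u y‖ ≤ L * ‖x - y‖) : Continuous u :=
  (LipschitzWith.of_dist_le' (K := L) fun x y => by
    rw [dist_eq_norm, dist_eq_norm]; exact hu x y).continuous

theorem LipTest.comp_id_add {D : ℕ} {ℓ L M : ℝ} (hℓ : 0 ≤ ℓ) {f : Param D → ℝ} (hf : LipTest ℓ f)
    {u : Param D → Param D} (hL : ∀ x y, ‖u x - u y‖ ≤ L * ‖x - y‖) (hM : ∀ x, ‖u x‖ ≤ M) :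
    LipTest (ℓ * (1 + L)) fun x => f (x + u x) where
  lip x y := by
    refine (hf.lip _ _).trans ?_
    rw [mul_assoc]
    gcongr
    calc ‖x + u x - (y + u y)‖ = ‖(x - y) + (u x - u y)‖ := by congr 1; abel
      _ ≤ ‖x - y‖ + L * ‖x - y‖ := (norm_add_le _ _).trans (by gcongr; exact hL x y)
      _ = _ := by ring
  cpt := by
    obtain ⟨R, hR⟩ := hf.cpt.isCompact.isBounded.subset_closedBall (0 : Param D)
    refine HasCompactSupport.intro (isCompact_closedBall (0 : Param D) (R + M)) fun x hx => ?_
    by_contra h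
    have h1 : x + u x ∈ Metric.closedBall (0 : Param D) R := hR (subset_tsupport _ h)
    apply hx
    rw [mem_closedBall_zero_iff] at h1 ⊢
    calc ‖x‖ = ‖(x + u x) - u x‖ := by rw [add_sub_cancel_right]
      _ ≤ R + M := (norm_sub_le _ _).trans (add_le_add h1 (hM x))

/-- A curve `ρ` of probability measures on `[0, T]` that solves `∂ₜ ρₜ + div(ρₜ vₜ) = 0` in the
sense of distributions, for a field `v` with `‖v‖ ≤ M` that is `L`-Lipschitz in space. -/
structure IsTransport {D : ℕ} (v : ℝ → Param D → Param D) (ρ : ℝ → ProbabilityMeasure (Param D))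
    (T M L : ℝ) : Prop where
  weak : ∀ f : Param D → ℝ, ContDiff ℝ ((⊤ : ℕ∞) : WithTop ℕ∞) f → HasCompactSupport f →
    ∀ t ∈ Set.Icc 0 T, ∫ θ, f θ ∂(ρ t : Measure (Param D)) - ∫ θ, f θ ∂(ρ 0 : Measure (Param D)) =
      ∫ τ in (0 : ℝ)..t, ∫ θ, inner ℝ (gradient f θ) (v τ θ) ∂(ρ τ : Measure (Param D))
  cont : ∀ f : Param D → ℝ, ContDiff ℝ ((⊤ : ℕ∞) : WithTop ℕ∞) f → HasCompactSupport f →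
    ContinuousOn (fun τ => ∫ θ, inner ℝ (gradient f θ) (v τ θ) ∂(ρ τ : Measure (Param D)))
      (Set.Icc 0 T)
  bound : ∀ t x, ‖v t x‖ ≤ M
  lip : ∀ t x y, ‖v t x - v t y‖ ≤ L * ‖x - y‖

namespace IsTransport

variable {D : ℕ} {v : ℝ → Param D → Param D} {ρ : ℝ → ProbabilityMeasure (Param D)} {T M L : ℝ}

theorem bound_nonneg (h : IsTransport v ρ T M L) : 0 ≤ M :=
  (norm_nonneg _).trans (h.bound 0 0)

theorem continuous (h : IsTransport v ρ T M L) (t : ℝ) : Continuous (v t) :=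
  continuous_of_norm_sub_le (h.lip t)

theorem weak_sub (h : IsTransport v ρ T M L) {f : Param D → ℝ}
    (hf : ContDiff ℝ ((⊤ : ℕ∞) : WithTop ℕ∞) f) (hc : HasCompactSupport f) {s t : ℝ}
    (hs : 0 ≤ s) (hst : s ≤ t) (ht : t ≤ T) :
    IntervalIntegrable (fun τ => ∫ θ, inner ℝ (gradient f θ) (v τ θ) ∂(ρ τ : Measure (Param D)))
      volume s t ∧
    ∫ θ, f θ ∂(ρ t : Measure (Param D)) - ∫ θ, f θ ∂(ρ s : Measure (Param D)) =
      ∫ τ in s..t, ∫ θ, inner ℝ (gradient f θ) (v τ θ) ∂(ρ τ : Measure (Param D)) := by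
  have hi : ∀ a b, 0 ≤ a → a ≤ b → b ≤ T → IntervalIntegrable
      (fun τ => ∫ θ, inner ℝ (gradient f θ) (v τ θ) ∂(ρ τ : Measure (Param D))) volume a b :=
    fun a b ha hab hb => ((h.cont f hf hc).mono
      (by rw [Set.uIcc_of_le hab]; exact Set.Icc_subset_Icc ha hb)).intervalIntegrable
  refine ⟨hi s t hs hst ht, ?_⟩
  have h1 := h.weak f hf hc t ⟨hs.trans hst, ht⟩
  have h2 := h.weak f hf hc s ⟨hs, hst.trans ht⟩
  rw [← intervalIntegral.integral_interval_sub_left (hi 0 t le_rfl (hs.trans hst) ht)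
    (hi 0 s le_rfl hs (hst.trans ht)), ← h1, ← h2]
  ring

theorem abs_sub_le_of_contDiff (h : IsTransport v ρ T M L) {ℓ : ℝ} (hℓ : 0 ≤ ℓ) {f : Param D → ℝ}
    (hf : ContDiff ℝ ((⊤ : ℕ∞) : WithTop ℕ∞) f) (hl : LipTest ℓ f) {s t : ℝ}
    (hs : 0 ≤ s) (hst : s ≤ t) (ht : t ≤ T) :
    |∫ θ, f θ ∂(ρ t : Measure (Param D)) - ∫ θ, f θ ∂(ρ s : Measure (Param D))| ≤
      ℓ * M * (t - s) := by
  rw [(h.weak_sub hf hl.cpt hs hst ht).2, ← abs_of_nonneg (sub_nonneg.2 hst)]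
  refine intervalIntegral.norm_integral_le_of_norm_le_const (E := ℝ) fun τ _ => ?_
  refine abs_integral_le_of_abs_le (Filter.Eventually.of_forall fun θ => ?_)
  refine (abs_real_inner_le_norm _ _).trans ?_
  gcongr
  · exact norm_gradient_le_of_abs_sub_le hℓ hl.lip θ
  · exact h.bound τ θ

/-- Integrals of Lipschitz functions vary at speed at most `ℓ M`. -/
theorem abs_sub_le (h : IsTransport v ρ T M L) {ℓ : ℝ} (hℓ : 0 ≤ ℓ) {f : Param D → ℝ}
    (hl : LipTest ℓ f) {s t : ℝ} (hs : 0 ≤ s) (hst : s ≤ t) (ht : t ≤ T) :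
    |∫ θ, f θ ∂(ρ t : Measure (Param D)) - ∫ θ, f θ ∂(ρ s : Measure (Param D))| ≤
      ℓ * M * (t - s) := by
  refine le_of_forall_pos_le_add fun e he => ?_
  obtain ⟨r, hr, hre⟩ : ∃ r > 0, 2 * (ℓ * r) ≤ e := by
    refine ⟨e / (2 * (ℓ + 1)), by positivity, ?_⟩
    rw [← mul_div_assoc, ← mul_div_assoc, div_le_iff₀ (by positivity)]
    nlinarith
  let φ : ContDiffBump (0 : Param D) := ⟨r / 2, r, by positivity, by linarith⟩
  have h1 := h.abs_sub_le_of_contDiff hℓ (hl.contDiff_mollify (φ := φ)) hl.lipTest_mollify hs hst ht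
  have h2 : ∀ τ, |∫ θ, mollify φ f θ ∂(ρ τ : Measure (Param D)) -
      ∫ θ, f θ ∂(ρ τ : Measure (Param D))| ≤ ℓ * r := fun τ => by
    rw [← integral_sub (hl.lipTest_mollify.integrable _) (hl.integrable _)]
    exact abs_integral_le_of_abs_le
      (Filter.Eventually.of_forall fun θ => hl.abs_mollify_sub_le hℓ θ)
  have h3 := h2 t
  have h4 := h2 s
  rw [abs_le] at *
  constructor <;> linarith

/-- The local error of one Euler step of length `k`, tested against a smooth function. -/
theorem abs_euler_step_le (h : IsTransport v ρ T M L) (hL : 0 ≤ L) {L' : ℝ}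
    (htime : ∀ s ∈ Set.Icc 0 T, ∀ t ∈ Set.Icc 0 T, ∀ x, ‖v t x - v s x‖ ≤ L' * |t - s|)
    (hL' : 0 ≤ L')
    {ℓ H : ℝ} (hℓ : 0 ≤ ℓ) (hH : 0 ≤ H) {f : Param D → ℝ}
    (hf : ContDiff ℝ ((⊤ : ℕ∞) : WithTop ℕ∞) f) (hl : LipTest ℓ f)
    (hg : ∀ x y, ‖gradient f x - gradient f y‖ ≤ H * ‖x - y‖) {t k : ℝ}
    (ht : 0 ≤ t) (hk : 0 ≤ k) (htk : t + k ≤ T) :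
    |∫ θ, f θ ∂(ρ (t + k) : Measure (Param D)) -
        ∫ θ, f (θ + k • v t θ) ∂(ρ t : Measure (Param D))| ≤
      k ^ 2 * (ℓ * L' + (H * M + ℓ * L) * M + H * M ^ 2) := by
  have hM := h.bound_nonneg
  set G : ℝ → ℝ := fun τ => ∫ θ, inner ℝ (gradient f θ) (v τ θ) ∂(ρ τ : Measure (Param D)) with hG
  have hgn : ∀ x, ‖gradient f x‖ ≤ ℓ := norm_gradient_le_of_abs_sub_le hℓ hl.lip
  have hgc : Continuous (gradient f) := continuous_of_norm_sub_le hg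
  have hdiff : Differentiable ℝ f := hf.differentiable (by simp)
  obtain ⟨hint, hw⟩ := h.weak_sub hf hl.cpt ht (le_add_of_nonneg_right hk) htk
  have hinn : ∀ τ, Continuous fun θ => inner ℝ (gradient f θ) (v τ θ) := fun τ =>
    hgc.inner (h.continuous τ)
  have hinb : ∀ τ θ, |inner ℝ (gradient f θ) (v τ θ)| ≤ ℓ * M := fun τ θ =>
    (abs_real_inner_le_norm _ _).trans
      (mul_le_mul (hgn θ) (h.bound τ θ) (norm_nonneg _) hℓ)
  -- the function `⟨∇f, vₜ⟩` is again an admissible test function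
  have htest : LipTest (H * M + ℓ * L) fun θ => inner ℝ (gradient f θ) (v t θ) := by
    refine ⟨fun x y => ?_, ?_⟩
    · have e : inner ℝ (gradient f x) (v t x) - inner ℝ (gradient f y) (v t y) =
          inner ℝ (gradient f x - gradient f y) (v t x) +
            inner ℝ (gradient f y) (v t x - v t y) := by
        rw [inner_sub_left, inner_sub_right]; ring
      rw [e]
      refine (abs_add_le _ _).trans ?_
      have e1 := (abs_real_inner_le_norm (gradient f x - gradient f y) (v t x)).trans
        (mul_le_mul (hg x y) (h.bound t x) (norm_nonneg _) (by positivity))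
      have e2 := (abs_real_inner_le_norm (gradient f y) (v t x - v t y)).trans
        (mul_le_mul (hgn y) (h.lip t x y) (norm_nonneg _) hℓ)
      linarith
    · refine hl.cpt.mono' fun x hx => ?_
      by_contra hn
      apply hx
      have : gradient f x = 0 := by
        rw [gradient, fderiv_of_notMem_tsupport ℝ hn, map_zero]
      simp [this]
  have hGt : ∀ τ ∈ Set.uIoc t (t + k), ‖G τ - G t‖ ≤ (ℓ * L' + (H * M + ℓ * L) * M) * k := by
    intro τ hτ
    rw [Set.uIoc_of_le (by linarith)] at hτ
    have e : G τ - G t = (∫ θ, (inner ℝ (gradient f θ) (v τ θ) - inner ℝ (gradient f θ) (v t θ))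
        ∂(ρ τ : Measure (Param D))) + (∫ θ, inner ℝ (gradient f θ) (v t θ)
          ∂(ρ τ : Measure (Param D)) - G t) := by
      rw [integral_sub (integrable_of_abs_le (hinn τ).aestronglyMeasurable (hinb τ))
        (integrable_of_abs_le (hinn t).aestronglyMeasurable (hinb t))]
      ring
    rw [e]
    refine (norm_add_le _ _).trans ?_
    have e1 := abs_integral_le_of_abs_le (μ := (ρ τ : Measure (Param D))) (c := ℓ * (L' * k))
      (f := fun θ => inner ℝ (gradient f θ) (v τ θ) - inner ℝ (gradient f θ) (v t θ))
      (Filter.Eventually.of_forall fun θ => by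
        rw [← inner_sub_right]
        refine (abs_real_inner_le_norm _ _).trans (mul_le_mul (hgn θ) ?_ (norm_nonneg _) hℓ)
        refine (htime t ⟨ht, by linarith⟩ τ ⟨by linarith [hτ.1], by linarith [hτ.2]⟩ θ).trans ?_
        gcongr
        rw [abs_of_nonneg (by linarith [hτ.1])]; linarith [hτ.2])
    have e2 := h.abs_sub_le (by positivity) htest ht hτ.1.le (hτ.2.trans htk)
    have e3 : (H * M + ℓ * L) * M * (τ - t) ≤ (H * M + ℓ * L) * M * k := by
      gcongr; linarith [hτ.2]
    rw [Real.norm_eq_abs, Real.norm_eq_abs]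
    calc _ ≤ ℓ * (L' * k) + (H * M + ℓ * L) * M * k := add_le_add e1 (e2.trans e3)
      _ = _ := by ring
  have hI : |∫ τ in t..(t + k), (G τ - G t)| ≤ (ℓ * L' + (H * M + ℓ * L) * M) * k * k := by
    have := intervalIntegral.norm_integral_le_of_norm_le_const hGt
    rwa [add_sub_cancel_left, abs_of_nonneg hk] at this
  rw [intervalIntegral.integral_sub hint intervalIntegrable_const, ← hw,
    intervalIntegral.integral_const, add_sub_cancel_left, smul_eq_mul] at hI
  have hcomp : Continuous fun θ => f (θ + k • v t θ) :=
    hl.continuous.comp (continuous_id.add ((h.continuous t).const_smul k))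
  have hcs : HasCompactSupport fun θ => f (θ + k • v t θ) :=
    (hl.comp_id_add hℓ (u := fun θ => k • v t θ) (L := k * L) (M := k * M)
      (fun x y => by
        rw [← smul_sub, norm_smul, Real.norm_of_nonneg hk, mul_assoc]; gcongr; exact h.lip t x y)
      (fun x => by rw [norm_smul, Real.norm_of_nonneg hk]; gcongr; exact h.bound t x)).cpt
  have hT : |∫ θ, (f (θ + k • v t θ) - f θ - k * inner ℝ (gradient f θ) (v t θ))
      ∂(ρ t : Measure (Param D))| ≤ k ^ 2 * (H * M ^ 2) := by
    refine abs_integral_le_of_abs_le (Filter.Eventually.of_forall fun θ => ?_)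
    have := abs_sub_sub_inner_gradient_le hH hdiff hg θ (k • v t θ)
    rw [real_inner_smul_right, norm_smul, Real.norm_of_nonneg hk] at this
    refine this.trans ?_
    calc H * (k * ‖v t θ‖) ^ 2 ≤ H * (k * M) ^ 2 := by gcongr; exact h.bound t θ
      _ = _ := by ring
  have hci := hcomp.integrable_of_hasCompactSupport (μ := (ρ t : Measure (Param D))) hcs
  have hdi : Integrable (fun θ => f (θ + k • v t θ) - f θ) (ρ t : Measure (Param D)) :=
    hci.sub (hl.integrable _)
  rw [integral_sub hdi ((htest.integrable _).const_mul k), integral_sub hci (hl.integrable _),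
    integral_const_mul] at hT
  have hGe : G t = ∫ θ, inner ℝ (gradient f θ) (v t θ) ∂(ρ t : Measure (Param D)) := rfl
  rw [← hGe] at hT
  rw [abs_le] at *
  constructor <;> nlinarith

end IsTransport

/-- The explicit Euler scheme of step `h` for the field `v`, started at time `0`. -/
noncomputable def eulerFlow {D : ℕ} (v : ℝ → Param D → Param D) (h : ℝ) : ℕ → Param D → Param D
  | 0 => id
  | n + 1 => fun x => eulerFlow v h n x + h • v (n * h) (eulerFlow v h n x)

namespace IsTransport

variable {D : ℕ} {v : ℝ → Param D → Param D} {ρ : ℝ → ProbabilityMeasure (Param D)} {T M L : ℝ}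

theorem continuous_eulerFlow (hv : IsTransport v ρ T M L) (h : ℝ) (n : ℕ) :
    Continuous (eulerFlow v h n) := by
  induction n with
  | zero => exact continuous_id
  | succ n ih => exact ih.add (((hv.continuous _).comp ih).const_smul h)

theorem lipTest_step (hv : IsTransport v ρ T M L) {ℓ : ℝ} (hℓ : 0 ≤ ℓ) {f : Param D → ℝ}
    (hl : LipTest ℓ f) {h : ℝ} (hh : 0 ≤ h) (t : ℝ) :
    LipTest (ℓ * (1 + h * L)) fun x => f (x + h • v t x) :=
  hl.comp_id_add hℓ (u := fun θ => h • v t θ) (M := h * M)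
    (fun x y => by
      rw [← smul_sub, norm_smul, Real.norm_of_nonneg hh, mul_assoc]; gcongr; exact hv.lip t x y)
    (fun x => by rw [norm_smul, Real.norm_of_nonneg hh]; gcongr; exact hv.bound t x)

theorem lipTest_comp_eulerFlow (hv : IsTransport v ρ T M L) (hL : 0 ≤ L) {h : ℝ} (hh : 0 ≤ h)
    (n : ℕ) : ∀ {ℓ : ℝ}, 0 ≤ ℓ → ∀ {f : Param D → ℝ}, LipTest ℓ f →
      LipTest (ℓ * (1 + h * L) ^ n) fun x => f (eulerFlow v h n x) := by
  induction n with
  | zero => intro ℓ _ f hl; simpa [eulerFlow] using hl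
  | succ n ih =>
    intro ℓ hℓ f hl
    have := ih (by positivity) (hv.lipTest_step hℓ hl hh (n * h))
    rw [mul_assoc, ← pow_succ'] at this
    exact this

/-- The global error of the Euler scheme against mollified test functions. The error committed by
commuting the mollifier with one step is proportional to the step, so that the errors of the
steps add up to a quantity that vanishes with the step and the scale of the mollifier. -/
theorem abs_mollify_sub_le (hv : IsTransport v ρ T M L) (hL : 0 ≤ L) {L' : ℝ} (hL' : 0 ≤ L')
    (htime : ∀ s ∈ Set.Icc 0 T, ∀ t ∈ Set.Icc 0 T, ∀ x, ‖v t x - v s x‖ ≤ L' * |t - s|)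
    (φ : ContDiffBump (0 : Param D)) {h : ℝ} (hh : 0 ≤ h) (n : ℕ) (hn : n * h ≤ T) :
    ∀ {ℓ : ℝ}, 0 ≤ ℓ → ∀ {f : Param D → ℝ}, LipTest ℓ f →
    |∫ θ, mollify φ f θ ∂(ρ (n * h) : Measure (Param D)) -
        ∫ θ, mollify φ (fun x => f (eulerFlow v h n x)) θ ∂(ρ 0 : Measure (Param D))| ≤
      ℓ * (1 + h * L) ^ n * (n * h) *
        (h * (L' + (mollifyConst φ * M + L) * M + mollifyConst φ * M ^ 2) + L * φ.rOut) := by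
  have hM := hv.bound_nonneg
  have hC := mollifyConst_nonneg (φ := φ)
  have hr := φ.rOut_pos.le
  induction n with
  | zero => intro ℓ _ f _; simp [eulerFlow]
  | succ n ih =>
    intro ℓ hℓ f hl
    push_cast at hn
    have hn' : n * h ≤ T := by nlinarith
    have hst := hv.lipTest_step hℓ hl hh (n * h)
    have e1 := ih hn' (by positivity) hst
    have e2 := hv.abs_euler_step_le hL htime hL' hℓ (mul_nonneg hC hℓ)
      (hl.contDiff_mollify (φ := φ)) hl.lipTest_mollify
      (fun x y => hl.norm_gradient_mollify_sub_le x y) (t := n * h) (k := h) (by positivity) hh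
      (by linarith)
    have e3 : |∫ θ, mollify φ f (θ + h • v (n * h) θ) ∂(ρ (n * h) : Measure (Param D)) -
        ∫ θ, mollify φ (fun x => f (x + h • v (n * h) x)) θ ∂(ρ (n * h) : Measure (Param D))| ≤
        ℓ * ((h * L) * φ.rOut) := by
      rw [← integral_sub ((hv.lipTest_step hℓ hl.lipTest_mollify hh _).integrable _)
        (hst.lipTest_mollify.integrable _)]
      refine abs_integral_le_of_abs_le (Filter.Eventually.of_forall fun θ => ?_)
      refine hl.abs_mollify_comp_sub_le hℓ (u := fun θ => h • v (n * h) θ) (by positivity)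
        (fun x y => ?_) θ
      rw [← smul_sub, norm_smul, Real.norm_of_nonneg hh, mul_assoc]; gcongr; exact hv.lip _ x y
    have hnh : ((n + 1 : ℕ) : ℝ) * h = n * h + h := by push_cast; ring
    rw [hnh]
    set K := h * (L' + (mollifyConst φ * M + L) * M + mollifyConst φ * M ^ 2) + L * φ.rOut with hK
    have hK0 : 0 ≤ K := by positivity
    have hp : ℓ * (h * K) ≤ ℓ * (1 + h * L) ^ (n + 1) * (h * K) := by
      have : 1 ≤ (1 + h * L) ^ (n + 1) := one_le_pow₀ (by nlinarith [mul_nonneg hh hL])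
      nlinarith [mul_nonneg hℓ (mul_nonneg hh hK0)]
    have e4 : h ^ 2 * (ℓ * L' + (mollifyConst φ * ℓ * M + ℓ * L) * M + mollifyConst φ * ℓ * M ^ 2)
        + ℓ * ((h * L) * φ.rOut) = ℓ * (h * K) := by rw [hK]; ring
    have e5 : ℓ * (1 + h * L) * (1 + h * L) ^ n * (n * h) * K =
        ℓ * (1 + h * L) ^ (n + 1) * (n * h) * K := by ring
    have e6 : ℓ * (1 + h * L) ^ (n + 1) * (n * h + h) * K =
      ℓ * (1 + h * L) ^ (n + 1) * (n * h) * K + ℓ * (1 + h * L) ^ (n + 1) * (h * K) := by ring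
    rw [e5] at e1
    rw [e6]
    have e7 := abs_add_le
      ((∫ θ, mollify φ f θ ∂(ρ (n * h + h) : Measure (Param D))) -
        ∫ θ, mollify φ f (θ + h • v (n * h) θ) ∂(ρ (n * h) : Measure (Param D)))
      ((∫ θ, mollify φ f (θ + h • v (n * h) θ) ∂(ρ (n * h) : Measure (Param D))) -
        ∫ θ, mollify φ (fun x => f (x + h • v (n * h) x)) θ ∂(ρ (n * h) : Measure (Param D)))
    have e8 := abs_add_le
      ((∫ θ, mollify φ f θ ∂(ρ (n * h + h) : Measure (Param D))) -
        ∫ θ, mollify φ (fun x => f (x + h • v (n * h) x)) θ ∂(ρ (n * h) : Measure (Param D)))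
      ((∫ θ, mollify φ (fun x => f (x + h • v (n * h) x)) θ ∂(ρ (n * h) : Measure (Param D))) -
        ∫ θ, mollify φ (fun x => f (eulerFlow v h n x + h • v (n * h) (eulerFlow v h n x))) θ
          ∂(ρ 0 : Measure (Param D)))
    rw [sub_add_sub_cancel] at e7 e8
    refine (e8.trans ?_)
    linarith

end IsTransport

/-! ### Transport by approximate characteristics -/

/-- A comparison of two probability measures against compactly supported Lipschitz functions
extends to bounded Lipschitz functions, by cutting off at large radii. -/
theorem abs_integral_sub_le_of_lipTest {D : ℕ} {μ ν : Measure (Param D)} [IsProbabilityMeasure μ]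
    [IsProbabilityMeasure ν] {c : ℝ}
    (h : ∀ ℓ, 0 ≤ ℓ → ∀ g : Param D → ℝ, LipTest ℓ g → |∫ θ, g θ ∂μ - ∫ θ, g θ ∂ν| ≤ ℓ * c)
    {ℓ b : ℝ} (hℓ : 0 ≤ ℓ) {f : Param D → ℝ} (hf : ∀ x y, |f x - f y| ≤ ℓ * ‖x - y‖)
    (hb : ∀ x, |f x| ≤ b) :
    |∫ θ, f θ ∂μ - ∫ θ, f θ ∂ν| ≤ ℓ * c := by
  have hb0 : 0 ≤ b := (abs_nonneg _).trans (hb 0)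
  have hfc := continuous_of_abs_sub_le hf
  let χ : ℕ → Param D → ℝ := fun n x => max 0 (min 1 (2 - ‖x‖ / (n + 1)))
  have hχc : ∀ n, Continuous (χ n) := fun n => by fun_prop
  have hχ0 : ∀ n x, 0 ≤ χ n x := fun n x => le_max_left _ _
  have hχ1 : ∀ n x, χ n x ≤ 1 := fun n x => max_le zero_le_one (min_le_left _ _)
  have hχl : ∀ n x y, |χ n x - χ n y| ≤ (1 / (n + 1)) * ‖x - y‖ := fun n x y => by
    have hn : (0 : ℝ) < n + 1 := by positivity
    have e1 : |χ n x - χ n y| ≤ |(2 - ‖x‖ / (n + 1)) - (2 - ‖y‖ / (n + 1))| := by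
      refine (abs_max_sub_max_le_max 0 _ 0 _).trans ?_
      rw [sub_self, abs_zero, max_eq_right (abs_nonneg _)]
      refine (abs_min_sub_min_le_max 1 _ 1 _).trans ?_
      rw [sub_self, abs_zero, max_eq_right (abs_nonneg _)]
    refine e1.trans ?_
    have e2 : (2 - ‖x‖ / ((n : ℝ) + 1)) - (2 - ‖y‖ / (n + 1)) = (1 / (n + 1)) * (‖y‖ - ‖x‖) := by
      ring
    rw [e2, abs_mul, abs_of_pos (by positivity : (0 : ℝ) < 1 / (n + 1))]
    gcongr
    rw [abs_sub_comm]
    exact abs_norm_sub_norm_le _ _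
  have htest : ∀ n : ℕ, LipTest (ℓ + b * (1 / (n + 1))) fun x => f x * χ n x := fun n => by
    refine ⟨fun x y => ?_, ?_⟩
    · have e : f x * χ n x - f y * χ n y = (f x - f y) * χ n x + f y * (χ n x - χ n y) := by ring
      rw [e, add_mul]
      refine (abs_add_le _ _).trans (add_le_add ?_ ?_)
      · rw [abs_mul, abs_of_nonneg (hχ0 n x)]
        exact (mul_le_of_le_one_right (abs_nonneg _) (hχ1 n x)).trans (hf x y)
      · rw [abs_mul, mul_assoc]
        exact mul_le_mul (hb y) (hχl n x y) (abs_nonneg _) hb0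
    · refine HasCompactSupport.intro (isCompact_closedBall (0 : Param D) (2 * (n + 1)))
        fun x hx => ?_
      rw [mem_closedBall_zero_iff, not_le] at hx
      have : 2 < ‖x‖ / ((n : ℝ) + 1) := by rwa [lt_div_iff₀ (by positivity)]
      have h0 : χ n x = 0 := max_eq_left ((min_le_right _ _).trans (by linarith))
      rw [h0, mul_zero]
  have hlim : ∀ (m : Measure (Param D)) [IsProbabilityMeasure m],
      Filter.Tendsto (fun n => ∫ θ, f θ * χ n θ ∂m) Filter.atTop (nhds (∫ θ, f θ ∂m)) := by
    intro m _
    refine tendsto_integral_of_dominated_convergence (fun _ => b)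
      (fun n => (hfc.mul (hχc n)).aestronglyMeasurable) (integrable_const _)
      (fun n => Filter.Eventually.of_forall fun θ => ?_)
      (Filter.Eventually.of_forall fun θ => ?_)
    · rw [norm_mul, Real.norm_of_nonneg (hχ0 n θ)]
      exact (mul_le_of_le_one_right (norm_nonneg _) (hχ1 n θ)).trans (hb θ)
    · refine tendsto_const_nhds.congr' ?_
      obtain ⟨N, hN⟩ := exists_nat_ge ‖θ‖
      filter_upwards [Filter.eventually_ge_atTop N] with n hn
      have : ‖θ‖ / ((n : ℝ) + 1) ≤ 1 := by
        rw [div_le_one (by positivity)]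
        have : (N : ℝ) ≤ n := by exact_mod_cast hn
        linarith
      have h1 : χ n θ = 1 := by
        simp only [χ]
        rw [min_eq_left (by linarith), max_eq_right zero_le_one]
      rw [h1, mul_one]
  have hc : Filter.Tendsto (fun n : ℕ => (ℓ + b * (1 / ((n : ℝ) + 1))) * c) Filter.atTop
      (nhds ((ℓ + b * 0) * c)) :=
    ((tendsto_one_div_add_atTop_nhds_zero_nat.const_mul b).const_add ℓ).mul_const c
  rw [mul_zero, add_zero] at hc
  exact le_of_tendsto_of_tendsto' ((hlim μ).sub (hlim ν)).abs hc
    fun n => h _ (by positivity) _ (htest n)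

namespace IsTransport

variable {D : ℕ} {v : ℝ → Param D → Param D} {ρ : ℝ → ProbabilityMeasure (Param D)} {T M L : ℝ}

theorem abs_integral_sub_le (h : IsTransport v ρ T M L) {ℓ b : ℝ} (hℓ : 0 ≤ ℓ) {f : Param D → ℝ}
    (hf : ∀ x y, |f x - f y| ≤ ℓ * ‖x - y‖) (hb : ∀ x, |f x| ≤ b) {s t : ℝ}
    (hs : s ∈ Set.Icc 0 T) (ht : t ∈ Set.Icc 0 T) :
    |∫ θ, f θ ∂(ρ t : Measure (Param D)) - ∫ θ, f θ ∂(ρ s : Measure (Param D))| ≤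
      ℓ * (M * |t - s|) := by
  refine abs_integral_sub_le_of_lipTest (fun ℓ' hℓ' g hg => ?_) hℓ hf hb
  rcases le_total s t with hst | hst
  · have := h.abs_sub_le hℓ' hg hs.1 hst ht.2
    rwa [abs_of_nonneg (sub_nonneg.2 hst), ← mul_assoc]
  · have := h.abs_sub_le hℓ' hg ht.1 hst hs.2
    rwa [abs_sub_comm, abs_sub_comm t s, abs_of_nonneg (sub_nonneg.2 hst), ← mul_assoc]

theorem norm_eulerFlow_succ_sub_le (h : IsTransport v ρ T M L) {k : ℝ} (hk : 0 ≤ k) (n j : ℕ)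
    (x : Param D) : ‖eulerFlow v k (n + j) x - eulerFlow v k n x‖ ≤ j * k * M := by
  induction j with
  | zero => simp
  | succ j ih =>
    have e : eulerFlow v k (n + (j + 1)) x - eulerFlow v k n x =
        (eulerFlow v k (n + j) x - eulerFlow v k n x) +
          k • v ((n + j : ℕ) * k) (eulerFlow v k (n + j) x) := by
      rw [← add_assoc, eulerFlow]; module
    rw [e]
    refine (norm_add_le _ _).trans ?_
    have : ‖k • v ((n + j : ℕ) * k) (eulerFlow v k (n + j) x)‖ ≤ k * M := by
      rw [norm_smul, Real.norm_of_nonneg hk]; gcongr; exact h.bound _ _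
    push_cast at *
    linarith

/-- Several small Euler steps agree to second order with a single large one. -/
theorem norm_eulerFlow_sub_smul_le (h : IsTransport v ρ T M L) (hL : 0 ≤ L) {L' : ℝ}
    (hL' : 0 ≤ L')
    (htime : ∀ s ∈ Set.Icc 0 T, ∀ t ∈ Set.Icc 0 T, ∀ x, ‖v t x - v s x‖ ≤ L' * |t - s|)
    {k : ℝ} (hk : 0 ≤ k) (n j : ℕ) (hT : (n + j) * k ≤ T) (x : Param D) :
    ‖eulerFlow v k (n + j) x - eulerFlow v k n x - (j * k) • v (n * k) (eulerFlow v k n x)‖ ≤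
      (j * k) ^ 2 * (L * M + L') := by
  have hM := h.bound_nonneg
  induction j with
  | zero => simp
  | succ j ih =>
    push_cast at hT
    have hT' : (n + j) * k ≤ T := by nlinarith
    have e : eulerFlow v k (n + (j + 1)) x - eulerFlow v k n x -
          (((j + 1 : ℕ) : ℝ) * k) • v (n * k) (eulerFlow v k n x) =
        (eulerFlow v k (n + j) x - eulerFlow v k n x
          - ((j : ℝ) * k) • v (n * k) (eulerFlow v k n x)) +
        k • ((v ((n + j : ℕ) * k) (eulerFlow v k (n + j) x)
            - v ((n + j : ℕ) * k) (eulerFlow v k n x)) +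
          (v ((n + j : ℕ) * k) (eulerFlow v k n x) - v (n * k) (eulerFlow v k n x))) := by
      rw [← add_assoc, eulerFlow]; push_cast; module
    rw [e]
    have e1 : ‖v ((n + j : ℕ) * k) (eulerFlow v k (n + j) x)
        - v ((n + j : ℕ) * k) (eulerFlow v k n x)‖ ≤ L * (j * k * M) :=
      (h.lip _ _ _).trans (by gcongr; exact h.norm_eulerFlow_succ_sub_le hk n j x)
    have e2 : ‖v ((n + j : ℕ) * k) (eulerFlow v k n x) - v (n * k) (eulerFlow v k n x)‖ ≤
        L' * (j * k) := by
      refine (htime (n * k) ⟨by positivity, ?_⟩ ((n + j : ℕ) * k) ⟨by positivity, ?_⟩ _).trans ?_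
      · nlinarith [mul_nonneg (Nat.cast_nonneg (α := ℝ) j) hk]
      · push_cast; linarith
      · gcongr
        push_cast
        rw [add_mul, add_sub_cancel_left, abs_of_nonneg (by positivity)]
    have e3 := norm_smul_le k ((v ((n + j : ℕ) * k) (eulerFlow v k (n + j) x)
            - v ((n + j : ℕ) * k) (eulerFlow v k n x)) +
          (v ((n + j : ℕ) * k) (eulerFlow v k n x) - v (n * k) (eulerFlow v k n x)))
    rw [Real.norm_of_nonneg hk] at e3
    have e4 := e3.trans (mul_le_mul_of_nonneg_left ((norm_add_le _ _).trans (add_le_add e1 e2)) hk)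
    have e5 := ih hT'
    refine (norm_add_le _ _).trans ((add_le_add e5 e4).trans ?_)
    push_cast
    have e6 : 0 ≤ (j * k ^ 2 + k ^ 2) * (L * M + L') := by positivity
    nlinarith

/-- A weak solution of the continuity equation is carried by the characteristics of the field:
there are maps `Φ k`, each close to an Euler step of length `ε` after the previous one, that
transport `ρ 0` to `ρ (k ε)` up to an arbitrarily small error. -/
theorem exists_flow (h : IsTransport v ρ T M L) (hL : 0 ≤ L) {L' : ℝ} (hL' : 0 ≤ L')
    (htime : ∀ s ∈ Set.Icc 0 T, ∀ t ∈ Set.Icc 0 T, ∀ x, ‖v t x - v s x‖ ≤ L' * |t - s|)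
    (hT : 0 ≤ T) {ε κ : ℝ} (hε : 0 < ε) (hκ : 0 < κ) :
    ∃ Φ : ℕ → Param D → Param D, Φ 0 = id ∧ (∀ k, Continuous (Φ k)) ∧
      (∀ k x, ‖Φ (k + 1) x - Φ k x‖ ≤ ε * M) ∧
      (∀ k : ℕ, (k + 1) * ε ≤ T → ∀ x,
        ‖Φ (k + 1) x - Φ k x - ε • v (k * ε) (Φ k x)‖ ≤ ε ^ 2 * (L * M + L')) ∧
      ∀ k : ℕ, k * ε ≤ T → ∀ ℓ, 0 ≤ ℓ → ∀ f : Param D → ℝ, (∀ x y, |f x - f y| ≤ ℓ * ‖x - y‖) →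
        (∃ b, ∀ x, |f x| ≤ b) →
        |∫ θ, f θ ∂(ρ (k * ε) : Measure (Param D)) - ∫ θ, f (Φ k θ) ∂(ρ 0 : Measure (Param D))| ≤
          ℓ * κ := by
  have hM := h.bound_nonneg
  set W := Real.exp (T * L) with hW
  have hW0 : 0 < W := Real.exp_pos _
  obtain ⟨r, hr, hrκ⟩ : ∃ r > 0, r * (1 + W + W * T * L) ≤ κ / 2 := by
    have hp : 0 < 1 + W + W * T * L := by positivity
    exact ⟨κ / 2 / (1 + W + W * T * L), by positivity, by rw [div_mul_cancel₀ _ hp.ne']⟩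
  let φ : ContDiffBump (0 : Param D) := ⟨r / 2, r, by positivity, by linarith⟩
  have hC := mollifyConst_nonneg (φ := φ)
  set K := L' + (mollifyConst φ * M + L) * M + mollifyConst φ * M ^ 2 with hK
  have hK0 : 0 ≤ K := by positivity
  obtain ⟨N, hN⟩ := exists_nat_gt (ε * (W * T * K) / (κ / 2))
  have hN0 : (0 : ℝ) < N := lt_of_le_of_lt (by positivity) hN
  set p := ε / N with hp
  have hp0 : 0 < p := by positivity
  have hpK : p * (W * T * K) ≤ κ / 2 := by
    rw [div_lt_iff₀ (by positivity)] at hN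
    rw [hp, div_mul_eq_mul_div, div_le_iff₀ hN0]
    linarith
  have hNp : (N : ℝ) * p = ε := by rw [hp]; field_simp
  have hmul : ∀ k : ℕ, ((k * N : ℕ) : ℝ) * p = k * ε := fun k => by
    push_cast; rw [mul_assoc, hNp]
  refine ⟨fun k => eulerFlow v p (k * N), ?_, fun k => h.continuous_eulerFlow _ _, fun k x => ?_,
    fun k hk x => ?_, fun k hk ℓ hℓ f hf hb => ?_⟩
  · simp [eulerFlow]
  · have := h.norm_eulerFlow_succ_sub_le hp0.le (k * N) N x
    rw [hNp] at this
    simpa [add_mul] using this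
  · have := h.norm_eulerFlow_sub_smul_le hL hL' htime hp0.le (k * N) N
      (by rw [add_mul, hmul, hNp]; linarith) x
    rw [hNp, hmul] at this
    simpa [add_mul] using this
  · obtain ⟨b, hb⟩ := hb
    have hm := (h.continuous_eulerFlow p (k * N)).measurable
    have : IsProbabilityMeasure (Measure.map (eulerFlow v p (k * N))
      (ρ 0 : Measure (Param D))) := Measure.isProbabilityMeasure_map hm.aemeasurable
    have key := abs_integral_sub_le_of_lipTest (μ := (ρ (k * ε) : Measure (Param D)))
      (ν := Measure.map (eulerFlow v p (k * N)) (ρ 0 : Measure (Param D))) (c := κ)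
      (fun ℓ hℓ g hg => ?_) hℓ hf hb
    · rwa [integral_map hm.aemeasurable
        (continuous_of_abs_sub_le hf).aestronglyMeasurable] at key
    · rw [integral_map hm.aemeasurable hg.continuous.aestronglyMeasurable]
      have e1 := h.abs_mollify_sub_le hL hL' htime φ hp0.le (k * N) (by rw [hmul]; exact hk) hℓ hg
      rw [hmul] at e1
      have hg' := h.lipTest_comp_eulerFlow hL hp0.le (k * N) hℓ hg
      have hWp : (1 + p * L) ^ (k * N) ≤ W := by
        calc (1 + p * L) ^ (k * N) ≤ (Real.exp (p * L)) ^ (k * N) := by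
              gcongr; linarith [Real.add_one_le_exp (p * L)]
          _ = Real.exp (((k * N : ℕ) * p) * L) := by rw [← Real.exp_nat_mul]; ring_nf
          _ ≤ W := by rw [hmul, hW]; gcongr
      have e2 : |∫ θ, mollify φ g θ ∂(ρ (k * ε) : Measure (Param D)) -
          ∫ θ, g θ ∂(ρ (k * ε) : Measure (Param D))| ≤ ℓ * r := by
        rw [← integral_sub (hg.lipTest_mollify.integrable _) (hg.integrable _)]
        exact abs_integral_le_of_abs_le
          (Filter.Eventually.of_forall fun θ => hg.abs_mollify_sub_le hℓ θ)
      have e3 : |∫ θ, mollify φ (fun x => g (eulerFlow v p (k * N) x)) θ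
            ∂(ρ 0 : Measure (Param D)) -
          ∫ θ, g (eulerFlow v p (k * N) θ) ∂(ρ 0 : Measure (Param D))| ≤ ℓ * W * r := by
        rw [← integral_sub (hg'.lipTest_mollify.integrable _) (hg'.integrable _)]
        refine abs_integral_le_of_abs_le
          (Filter.Eventually.of_forall fun θ => (hg'.abs_mollify_sub_le (by positivity) θ).trans ?_)
        gcongr
      have e4 : ℓ * (1 + p * L) ^ (k * N) * (k * ε) * (p * K + L * φ.rOut) ≤
          ℓ * W * T * (p * K + L * r) := by
        gcongr
      have e5 : ℓ * r + ℓ * W * r + ℓ * W * T * (p * K + L * r) ≤ ℓ * κ := by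
        have : ℓ * r + ℓ * W * r + ℓ * W * T * (p * K + L * r) =
            ℓ * (r * (1 + W + W * T * L) + p * (W * T * K)) := by ring
        rw [this]; gcongr; linarith
      have e6 := e1.trans e4
      rw [abs_le] at *
      constructor <;> linarith

end IsTransport

/-! ### Exponential moments of squared norms of martingales -/

section ExpSq

variable {H : Type*} [NormedAddCommGroup H] [InnerProductSpace ℝ H] [MeasurableSpace H]
  [BorelSpace H] [SecondCountableTopology H] [CompleteSpace H]

/-- Adding a centred bounded vector to `a` costs little in `exp(c ‖a‖²)`, provided that the rate
is lowered from `c` to `c'`. -/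
theorem lintegral_exp_sq_add_le {Z : Type*} [MeasurableSpace Z] {ν : Measure Z}
    [IsProbabilityMeasure ν] {ξ : Z → H} (hξ : Measurable ξ) {C : ℝ} (hC : 0 ≤ C)
    (hb : ∀ᵐ z ∂ν, ‖ξ z‖ ≤ C) (h0 : ∫ z, ξ z ∂ν = 0) {c c' : ℝ} (hc' : 0 ≤ c')
    (hcc : c' * (1 + 2 * c' * C ^ 2) ≤ c) (a : H) :
    ∫⁻ z, ENNReal.ofReal (Real.exp (c' * ‖a + ξ z‖ ^ 2)) ∂ν ≤
      ENNReal.ofReal (Real.exp (c' * C ^ 2)) * ENNReal.ofReal (Real.exp (c * ‖a‖ ^ 2)) := by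
  have hX : Measurable fun z => inner ℝ a (ξ z) := measurable_const.inner hξ
  have hXb : ∀ᵐ z ∂ν, inner ℝ a (ξ z) ∈ Set.Icc (-(‖a‖ * C)) (‖a‖ * C) := by
    filter_upwards [hb] with z hz
    have := (abs_real_inner_le_norm a (ξ z)).trans
      (mul_le_mul_of_nonneg_left hz (norm_nonneg a))
    exact abs_le.1 this
  have hint : Integrable ξ ν := Integrable.of_bound hξ.aestronglyMeasurable C hb
  have hX0 : ∫ z, inner ℝ a (ξ z) ∂ν = 0 := by
    rw [integral_inner hint, h0, inner_zero_right]
  have hsub := hasSubgaussianMGF_of_mem_Icc_of_integral_eq_zero hX.aemeasurable hXb hX0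
  have hm := hsub.mgf_le (2 * c')
  have hcoef : (((‖‖a‖ * C - -(‖a‖ * C)‖₊ / 2) ^ 2 : NNReal) : ℝ) = (‖a‖ * C) ^ 2 := by
    push_cast
    rw [sub_neg_eq_add, ← two_mul, Real.norm_of_nonneg (by positivity)]
    ring
  rw [hcoef, mgf] at hm
  have hle : ∀ᵐ z ∂ν, ENNReal.ofReal (Real.exp (c' * ‖a + ξ z‖ ^ 2)) ≤
      ENNReal.ofReal (Real.exp (c' * (‖a‖ ^ 2 + C ^ 2))) *
        ENNReal.ofReal (Real.exp (2 * c' * inner ℝ a (ξ z))) := by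
    filter_upwards [hb] with z hz
    rw [← ENNReal.ofReal_mul (Real.exp_pos _).le, ← Real.exp_add]
    refine ENNReal.ofReal_le_ofReal (Real.exp_le_exp.2 ?_)
    rw [norm_add_sq_real]
    have : ‖ξ z‖ ^ 2 ≤ C ^ 2 := by gcongr
    nlinarith
  refine (lintegral_mono_ae hle).trans ?_
  rw [lintegral_const_mul _ (by fun_prop), ← ofReal_integral_eq_lintegral_ofReal
    (hsub.integrable_exp_mul _) (Filter.Eventually.of_forall fun _ => (Real.exp_pos _).le),
    ← ENNReal.ofReal_mul (Real.exp_pos _).le, ← ENNReal.ofReal_mul (Real.exp_pos _).le]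
  refine ENNReal.ofReal_le_ofReal
    ((mul_le_mul_of_nonneg_left hm (Real.exp_pos _).le).trans ?_)
  rw [← Real.exp_add, ← Real.exp_add]
  refine Real.exp_le_exp.2 ?_
  have : c' * (1 + 2 * c' * C ^ 2) * ‖a‖ ^ 2 ≤ c * ‖a‖ ^ 2 := by gcongr
  nlinarith

/-- The same estimate when the increment depends on the past `Y` and on an independent `z`. -/
theorem lintegral_exp_sq_step_le {Ω 𝕐 Z : Type*} [MeasurableSpace Ω] [MeasurableSpace 𝕐]
    [MeasurableSpace Z] {P : Measure Ω} [IsProbabilityMeasure P] {Y : Ω → 𝕐} {z : Ω → Z}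
    (hY : Measurable Y) (hz : Measurable z) (hind : IndepFun Y z P) {s : 𝕐 → H}
    (hs : Measurable s) {Ξ : 𝕐 → Z → H} (hΞ : Measurable (Function.uncurry Ξ)) {C : ℝ}
    (hC : 0 ≤ C) (hb : ∀ y, ∀ᵐ w ∂(P.map z), ‖Ξ y w‖ ≤ C) (h0 : ∀ y, ∫ w, Ξ y w ∂(P.map z) = 0)
    {c c' : ℝ} (hc' : 0 ≤ c') (hcc : c' * (1 + 2 * c' * C ^ 2) ≤ c) :
    ∫⁻ ω, ENNReal.ofReal (Real.exp (c' * ‖s (Y ω) + Ξ (Y ω) (z ω)‖ ^ 2)) ∂P ≤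
      ENNReal.ofReal (Real.exp (c' * C ^ 2)) *
        ∫⁻ ω, ENNReal.ofReal (Real.exp (c * ‖s (Y ω)‖ ^ 2)) ∂P := by
  have : IsProbabilityMeasure (P.map z) := Measure.isProbabilityMeasure_map hz.aemeasurable
  have : IsProbabilityMeasure (P.map Y) := Measure.isProbabilityMeasure_map hY.aemeasurable
  have hlaw := (indepFun_iff_map_prod_eq_prod_map_map hY.aemeasurable hz.aemeasurable).1 hind
  have hF : Measurable fun p : 𝕐 × Z =>
      ENNReal.ofReal (Real.exp (c' * ‖s p.1 + Ξ p.1 p.2‖ ^ 2)) :=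
    (Real.measurable_exp.comp ((((hs.comp measurable_fst).add hΞ).norm.pow_const 2).const_mul
      c')).ennreal_ofReal
  have hG : Measurable fun y : 𝕐 => ENNReal.ofReal (Real.exp (c * ‖s y‖ ^ 2)) :=
    (Real.measurable_exp.comp ((hs.norm.pow_const 2).const_mul c)).ennreal_ofReal
  have e1 := lintegral_map (μ := P) hF (hY.prodMk hz)
  have e2 := lintegral_map (μ := P) hG hY
  rw [← e2]
  refine e1.symm.le.trans ?_
  rw [hlaw, lintegral_prod _ hF.aemeasurable, ← lintegral_const_mul _ hG]
  exact lintegral_mono fun y => lintegral_exp_sq_add_le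
    (hΞ.comp measurable_prodMk_left) hC (hb y) (h0 y) hc' hcc (s y)

/-- The rates `1 / (2 C² (N + n))`, along which the step estimate telescopes. -/
theorem rate_mul_le {C N n : ℝ} (hC : 0 < C) (hN : 0 < N) (hn : 0 ≤ n) :
    1 / (2 * C ^ 2 * (N + (n + 1))) * (1 + 2 * (1 / (2 * C ^ 2 * (N + (n + 1)))) * C ^ 2) ≤
      1 / (2 * C ^ 2 * (N + n)) := by
  have h1 : 0 < N + n := by positivity
  have h2 : 0 < N + (n + 1) := by positivity
  have e : 1 / (2 * C ^ 2 * (N + (n + 1))) *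
      (1 + 2 * (1 / (2 * C ^ 2 * (N + (n + 1)))) * C ^ 2) =
      (1 / (2 * C ^ 2)) * ((N + n + 2) / (N + (n + 1)) ^ 2) := by
    field_simp; ring
  have e' : 1 / (2 * C ^ 2 * (N + n)) = (1 / (2 * C ^ 2)) * (1 / (N + n)) := by
    field_simp
  rw [e, e']
  refine mul_le_mul_of_nonneg_left ?_ (by positivity)
  rw [div_le_div_iff₀ (by positivity) h1]
  nlinarith

/-- The exponential moment bound for a martingale `s (Y n)` whose increments are bounded by `C`. -/
theorem lintegral_exp_sq_martingale_le {Ω 𝕐 Z : Type*} [MeasurableSpace Ω] [MeasurableSpace 𝕐]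
    [MeasurableSpace Z] {P : Measure Ω} [IsProbabilityMeasure P] {Y : ℕ → Ω → 𝕐} {z : ℕ → Ω → Z}
    {ν : Measure Z} (hY : ∀ n, Measurable (Y n)) (hz : ∀ n, Measurable (z n))
    (hν : ∀ n, P.map (z n) = ν) (hind : ∀ n, IndepFun (Y n) (z n) P) {s : 𝕐 → H}
    (hs : Measurable s) {Ξ : 𝕐 → Z → H} (hΞ : Measurable (Function.uncurry Ξ)) {C : ℝ}
    (hC : 0 < C) (hb : ∀ y, ∀ᵐ w ∂ν, ‖Ξ y w‖ ≤ C) (h0 : ∀ y, ∫ w, Ξ y w ∂ν = 0)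
    (hs0 : ∀ ω, s (Y 0 ω) = 0)
    (hsucc : ∀ n ω, s (Y (n + 1) ω) = s (Y n ω) + Ξ (Y n ω) (z n ω)) {N : ℕ} (hN : 0 < N) (n : ℕ) :
    ∫⁻ ω, ENNReal.ofReal (Real.exp (1 / (2 * C ^ 2 * (N + n)) * ‖s (Y n ω)‖ ^ 2)) ∂P ≤
      ENNReal.ofReal (Real.exp (n / (2 * N))) := by
  have hN' : (0 : ℝ) < N := by exact_mod_cast hN
  induction n with
  | zero => simp [hs0]
  | succ n ih =>
    simp_rw [hsucc]
    have := lintegral_exp_sq_step_le (hY n) (hz n) (hind n) hs hΞ hC.le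
      (by rw [hν]; exact hb) (by rw [hν]; exact h0)
      (c := 1 / (2 * C ^ 2 * (N + n))) (c' := 1 / (2 * C ^ 2 * (N + (n + 1))))
      (by positivity) (rate_mul_le hC hN' (Nat.cast_nonneg n))
    push_cast
    refine this.trans ((mul_le_mul_right ih _).trans ?_)
    rw [← ENNReal.ofReal_mul (Real.exp_pos _).le, ← Real.exp_add]
    refine ENNReal.ofReal_le_ofReal (Real.exp_le_exp.2 ?_)
    have e : 1 / (2 * C ^ 2 * (N + (n + 1))) * C ^ 2 = 1 / (2 * ((N : ℝ) + (n + 1))) := by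
      field_simp
    have e2 : 1 / (2 * ((N : ℝ) + (n + 1))) ≤ 1 / (2 * N) := by gcongr; linarith
    rw [e, add_div]
    linarith

end ExpSq

/-- Markov's inequality in the form used for exponential moments of squares. -/
theorem measure_le_of_lintegral_exp_sq_le {Ω : Type*} [MeasurableSpace Ω] {P : Measure Ω}
    {F : Ω → ENNReal} (hF : Measurable F) {a b : ℝ} {A : Set Ω}
    (hle : ∫⁻ ω, F ω ∂P ≤ ENNReal.ofReal (Real.exp b))
    (hA : ∀ ω ∈ A, ENNReal.ofReal (Real.exp a) ≤ F ω) :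
    P A ≤ ENNReal.ofReal (Real.exp (b - a)) := by
  have h1 := mul_meas_ge_le_lintegral (μ := P) hF (ENNReal.ofReal (Real.exp a))
  have h2 : ENNReal.ofReal (Real.exp a) * P A ≤ ENNReal.ofReal (Real.exp b) :=
    (mul_le_mul_right (measure_mono hA) _).trans (h1.trans hle)
  have h3 : ENNReal.ofReal (Real.exp (b - a)) =
      ENNReal.ofReal (Real.exp (-a)) * ENNReal.ofReal (Real.exp b) := by
    rw [← ENNReal.ofReal_mul (Real.exp_pos _).le, ← Real.exp_add]; ring_nf
  have h4 : ENNReal.ofReal (Real.exp (-a)) * ENNReal.ofReal (Real.exp a) = 1 := by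
    rw [← ENNReal.ofReal_mul (Real.exp_pos _).le, ← Real.exp_add]; simp
  calc P A = ENNReal.ofReal (Real.exp (-a)) * (ENNReal.ofReal (Real.exp a) * P A) := by
        rw [← mul_assoc, h4, one_mul]
    _ ≤ ENNReal.ofReal (Real.exp (-a)) * ENNReal.ofReal (Real.exp b) := by gcongr
    _ = _ := h3.symm

/-! ### Random dynamical systems driven by independent inputs -/

theorem IndepFun.prodMk_left_of_prodMk_right {Ω α β γ : Type*} [MeasurableSpace Ω]
    [MeasurableSpace α] [MeasurableSpace β] [MeasurableSpace γ] {P : Measure Ω}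
    [IsProbabilityMeasure P] {X : Ω → α} {Y : Ω → β} {W : Ω → γ} (hX : Measurable X)
    (hY : Measurable Y) (hW : Measurable W) (h1 : IndepFun X (fun ω => (Y ω, W ω)) P)
    (h2 : IndepFun Y W P) : IndepFun (fun ω => (X ω, Y ω)) W P := by
  have e1 := (indepFun_iff_map_prod_eq_prod_map_map hX.aemeasurable
    (hY.prodMk hW).aemeasurable).1 h1
  have e2 := (indepFun_iff_map_prod_eq_prod_map_map hY.aemeasurable hW.aemeasurable).1 h2
  have h3 : IndepFun X Y P := h1.comp measurable_id measurable_fst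
  have e3 := (indepFun_iff_map_prod_eq_prod_map_map hX.aemeasurable hY.aemeasurable).1 h3
  rw [indepFun_iff_map_prod_eq_prod_map_map (hX.prodMk hY).aemeasurable hW.aemeasurable, e3]
  have := Measure.isProbabilityMeasure_map (μ := P) hX.aemeasurable
  have := Measure.isProbabilityMeasure_map (μ := P) hY.aemeasurable
  have := Measure.isProbabilityMeasure_map (μ := P) hW.aemeasurable
  apply (MeasurableEquiv.prodAssoc (α := α) (β := β) (γ := γ)).map_measurableEquiv_injective
  rw [Measure.prodAssoc_prod, ← e2, ← e1, Measure.map_map (MeasurableEquiv.measurable _)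
    ((hX.prodMk hY).prodMk hW)]
  rfl

section RandomDynamics

variable {Ω 𝕐 Z : Type*} [MeasurableSpace Ω] [MeasurableSpace 𝕐] [MeasurableSpace Z]
  {P : Measure Ω} [IsProbabilityMeasure P] {Y : ℕ → Ω → 𝕐} {z : ℕ → Ω → Z} {F : 𝕐 → Z → 𝕐}

theorem measurable_of_recursion (hz : ∀ n, Measurable (z n)) (hY0 : Measurable (Y 0))
    (hF : Measurable (Function.uncurry F)) (hsucc : ∀ n ω, Y (n + 1) ω = F (Y n ω) (z n ω)) (n : ℕ) :
    Measurable (Y n) := by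
  induction n with
  | zero => exact hY0
  | succ n ih =>
    have : Y (n + 1) = fun ω => Function.uncurry F (Y n ω, z n ω) := funext fun ω => hsucc n ω
    rw [this]
    exact hF.comp (ih.prodMk (hz n))

/-- In a random dynamical system driven by independent inputs, the present state is independent
of the next input. -/
theorem indepFun_of_recursion (hz : ∀ n, Measurable (z n)) (hi : iIndepFun z P)
    (hY0 : Measurable (Y 0)) (h0 : IndepFun (Y 0) (fun ω k => z k ω) P)
    (hF : Measurable (Function.uncurry F)) (hsucc : ∀ n ω, Y (n + 1) ω = F (Y n ω) (z n ω)) (n : ℕ) :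
    IndepFun (Y n) (z n) P := by
  have hY := measurable_of_recursion hz hY0 hF hsucc
  -- more generally, it is independent of all the later inputs up to any horizon `N`
  have key : ∀ N k, IndepFun (Y k) (fun ω (i : Finset.Ico k N) => z i ω) P := by
    intro N k
    induction k with
    | zero =>
      exact h0.comp (φ := id) (ψ := fun (w : ℕ → Z) (i : Finset.Ico 0 N) => w i) measurable_id
        (by fun_prop)
    | succ k ih =>
      have ht : Measurable fun ω (i : Finset.Ico (k + 1) N) => z i ω :=
        measurable_pi_lambda _ fun i => hz i
      rcases lt_or_ge k N with hk | hk
      · have h1 : IndepFun (Y k) (fun ω => (z k ω, fun (i : Finset.Ico (k + 1) N) => z i ω)) P := by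
          have hmem : ∀ i : Finset.Ico (k + 1) N, (i : ℕ) ∈ Finset.Ico k N := fun i => by
            have := Finset.mem_Ico.1 i.2
            exact Finset.mem_Ico.2 ⟨by omega, this.2⟩
          exact ih.comp (φ := id) (ψ := fun (w : Finset.Ico k N → Z) =>
            (w ⟨k, Finset.mem_Ico.2 ⟨le_rfl, hk⟩⟩,
              fun (i : Finset.Ico (k + 1) N) => w ⟨i, hmem i⟩)) measurable_id (by fun_prop)
        have h2 : IndepFun (z k) (fun ω (i : Finset.Ico (k + 1) N) => z i ω) P :=
          (hi.indepFun_finset {k} (Finset.Ico (k + 1) N) (by simp) hz).comp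
            (φ := fun (w : ({k} : Finset ℕ) → Z) => w ⟨k, by simp⟩) (ψ := id)
            (by fun_prop) measurable_id
        have h3 := IndepFun.prodMk_left_of_prodMk_right (hY k) (hz k) ht h1 h2
        have h4 := h3.comp hF measurable_id
        have e : Y (k + 1) = Function.uncurry F ∘ fun ω => (Y k ω, z k ω) :=
          funext fun ω => hsucc k ω
        rw [e]
        exact h4
      · have hem : IsEmpty (Finset.Ico (k + 1) N) := by
          rw [Finset.Ico_eq_empty (by omega)]; infer_instance
        have e : (fun ω (i : Finset.Ico (k + 1) N) => z i ω) =
            fun _ => fun i => (hem.false i).elim := by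
          funext ω i; exact (hem.false i).elim
        rw [e]
        exact indepFun_const_right _ _
  exact (key (n + 1) n).comp (φ := id)
    (ψ := fun (w : Finset.Ico n (n + 1) → Z) => w ⟨n, by simp⟩) measurable_id (by fun_prop)

end RandomDynamics

/-- If a path is frozen as soon as its norm reaches `r`, its final norm is at least `r` whenever
the original path has reached `r` before. -/
theorem le_norm_of_frozen {H : Type*} [NormedAddCommGroup H] {S S' ξ : ℕ → H} {r : ℝ}
    (h0 : S' 0 = S 0) (hS : ∀ n, S (n + 1) = S n + ξ n)
    (hS' : ∀ n, S' (n + 1) = S' n + if ‖S' n‖ < r then ξ n else 0) {n N : ℕ} (hn : n ≤ N)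
    (hr : r ≤ ‖S n‖) : r ≤ ‖S' N‖ := by
  have h1 : ∀ k, S' k = S k ∨ r ≤ ‖S' k‖ := by
    intro k
    induction k with
    | zero => exact Or.inl h0
    | succ k ih =>
      rcases lt_or_ge ‖S' k‖ r with h | h
      · left; rw [hS', hS, if_pos h, ih.resolve_right (not_le.2 h)]
      · right; rw [hS', if_neg (not_lt.2 h), add_zero]; exact h
  induction N, hn using Nat.le_induction with
  | base => rcases h1 n with h | h
            · rwa [h]
            · exact h
  | succ k _ ih => rw [hS', if_neg (not_lt.2 ih), add_zero]; exact ih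

/-- A dimension-free maximal inequality for the partial sums of bounded martingale differences
generated by a random dynamical system. -/
theorem measure_exists_le_norm_sum_le {H : Type*} [NormedAddCommGroup H] [InnerProductSpace ℝ H]
    [MeasurableSpace H] [BorelSpace H] [SecondCountableTopology H] [CompleteSpace H]
    {Ω 𝕐 Z : Type*} [MeasurableSpace Ω] [MeasurableSpace 𝕐] [MeasurableSpace Z]
    {P : Measure Ω} [IsProbabilityMeasure P] {Y : ℕ → Ω → 𝕐} {z : ℕ → Ω → Z} {F : 𝕐 → Z → 𝕐}
    {ν : Measure Z} (hz : ∀ n, Measurable (z n)) (hi : iIndepFun z P) (hν : ∀ n, P.map (z n) = ν)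
    (hY0 : Measurable (Y 0)) (h0 : IndepFun (Y 0) (fun ω k => z k ω) P)
    (hF : Measurable (Function.uncurry F)) (hsucc : ∀ n ω, Y (n + 1) ω = F (Y n ω) (z n ω))
    {Ξ : 𝕐 → Z → H} (hΞ : Measurable (Function.uncurry Ξ)) {C : ℝ} (hC : 0 < C)
    (hb : ∀ y, ∀ᵐ w ∂ν, ‖Ξ y w‖ ≤ C) (hmean : ∀ y, ∫ w, Ξ y w ∂ν = 0) {N : ℕ} (hN : 0 < N)
    {r : ℝ} (hr : 0 ≤ r) :
    P {ω | ∃ n ≤ N, r ≤ ‖∑ k ∈ Finset.range n, Ξ (Y k ω) (z k ω)‖} ≤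
      ENNReal.ofReal (Real.exp (1 / 2 - r ^ 2 / (4 * C ^ 2 * N))) := by
  have hN' : (0 : ℝ) < N := by exact_mod_cast hN
  -- the state is enlarged by the frozen partial sum
  let S : ℕ → Ω → H := fun n ω => Nat.rec (motive := fun _ => H) 0
    (fun k s => s + if ‖s‖ < r then Ξ (Y k ω) (z k ω) else 0) n
  have hS0 : ∀ ω, S 0 ω = 0 := fun ω => rfl
  have hSs : ∀ n ω, S (n + 1) ω = S n ω + if ‖S n ω‖ < r then Ξ (Y n ω) (z n ω) else 0 :=
    fun n ω => rfl
  let Ξ' : 𝕐 × H → Z → H := fun p w => if ‖p.2‖ < r then Ξ p.1 w else 0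
  have hset : MeasurableSet {q : (𝕐 × H) × Z | ‖q.1.2‖ < r} :=
    measurableSet_lt (by fun_prop) measurable_const
  have hΞ1 : Measurable fun q : (𝕐 × H) × Z => Ξ q.1.1 q.2 :=
    hΞ.comp (by fun_prop : Measurable fun q : (𝕐 × H) × Z => (q.1.1, q.2))
  have hΞ' : Measurable (Function.uncurry Ξ') := Measurable.ite hset hΞ1 measurable_const
  let F' : 𝕐 × H → Z → 𝕐 × H := fun p w => (F p.1 w, p.2 + Ξ' p w)
  have hF1 : Measurable fun q : (𝕐 × H) × Z => F q.1.1 q.2 :=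
    hF.comp (by fun_prop : Measurable fun q : (𝕐 × H) × Z => (q.1.1, q.2))
  have hF' : Measurable (Function.uncurry F') :=
    hF1.prodMk ((measurable_snd.comp measurable_fst).add hΞ')
  let Y' : ℕ → Ω → 𝕐 × H := fun n ω => (Y n ω, S n ω)
  have hY's : ∀ n ω, Y' (n + 1) ω = F' (Y' n ω) (z n ω) := fun n ω => by
    simp only [Y', F', Ξ', hsucc, hSs]
  have hY'0 : Measurable (Y' 0) := hY0.prodMk measurable_const
  have hY'i : IndepFun (Y' 0) (fun ω k => z k ω) P :=
    h0.comp (φ := fun y => (y, (0 : H))) (ψ := id) (by fun_prop) measurable_id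
  have hY'm := measurable_of_recursion hz hY'0 hF' hY's
  have hb' : ∀ y, ∀ᵐ w ∂ν, ‖Ξ' y w‖ ≤ C := fun y => by
    filter_upwards [hb y.1] with w hw
    simp only [Ξ']
    split_ifs
    · exact hw
    · simpa using hC.le
  have hm' : ∀ y, ∫ w, Ξ' y w ∂ν = 0 := fun y => by
    simp only [Ξ']
    split_ifs
    · exact hmean y.1
    · simp
  have main := lintegral_exp_sq_martingale_le hY'm hz hν
    (indepFun_of_recursion hz hi hY'0 hY'i hF' hY's) measurable_snd hΞ' hC hb' hm'
    (fun ω => rfl) (fun n ω => by rw [hY's]) hN N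
  have e1 : (N : ℝ) / (2 * N) = 1 / 2 := by field_simp
  rw [e1] at main
  refine measure_le_of_lintegral_exp_sq_le ?_ main fun ω hω => ?_
  · exact (Real.measurable_exp.comp (((measurable_snd.comp (hY'm N)).norm.pow_const
      2).const_mul _)).ennreal_ofReal
  · obtain ⟨n, hn, hrn⟩ := hω
    have h1 : r ≤ ‖S N ω‖ := le_norm_of_frozen (S := fun n => ∑ k ∈ Finset.range n,
      Ξ (Y k ω) (z k ω)) (S' := fun n => S n ω) (ξ := fun n => Ξ (Y n ω) (z n ω))
      (by simp [hS0]) (fun n => Finset.sum_range_succ _ _) (fun n => hSs n ω) hn hrn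
    refine ENNReal.ofReal_le_ofReal (Real.exp_le_exp.2 ?_)
    have e2 : 1 / (2 * C ^ 2 * ((N : ℝ) + N)) * ‖S N ω‖ ^ 2 = ‖S N ω‖ ^ 2 / (4 * C ^ 2 * N) := by
      field_simp; ring
    change _ ≤ 1 / (2 * C ^ 2 * ((N : ℝ) + N)) * ‖S N ω‖ ^ 2
    rw [e2]
    gcongr

/-! ### Uniform fluctuations of empirical averages -/

theorem lintegral_exp_sq_sum_le {Ω : Type*} [MeasurableSpace Ω] {P : Measure Ω}
    [IsProbabilityMeasure P] {m : ℕ} (hm : 0 < m) {X : Fin m → Ω → ℝ}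
    (hX : ∀ i, Measurable (X i)) (hi : iIndepFun X P) {C : ℝ} (hC : 0 < C)
    (hb : ∀ i ω, |X i ω| ≤ C) (h0 : ∀ i, ∫ ω, X i ω ∂P = 0) :
    ∫⁻ ω, ENNReal.ofReal (Real.exp (1 / (4 * C ^ 2 * m) * (∑ i, X i ω) ^ 2)) ∂P ≤
      ENNReal.ofReal (Real.exp (1 / 2)) := by
  have hm' : (0 : ℝ) < m := by exact_mod_cast hm
  have key : ∀ s : Finset (Fin m), ∫⁻ ω, ENNReal.ofReal (Real.exp
      (1 / (2 * C ^ 2 * (m + s.card)) * ‖∑ i ∈ s, X i ω‖ ^ 2)) ∂P ≤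
      ENNReal.ofReal (Real.exp (s.card / (2 * m))) := by
    intro s
    induction s using Finset.induction_on with
    | empty => simp
    | insert i s his ih =>
      have hind : IndepFun (fun ω => ∑ j ∈ s, X j ω) (X i) P := by
        have := hi.indepFun_finsetSum_of_notMem hX his
        convert this using 1
        ext ω; simp
      have := lintegral_exp_sq_step_le (P := P) (H := ℝ) (Y := fun ω => ∑ j ∈ s, X j ω) (z := X i)
        (Finset.measurable_sum s fun j _ => hX j) (hX i) hind (s := id) measurable_id
        (Ξ := fun _ w => w) measurable_snd hC.le
        (fun _ => (ae_map_iff (hX i).aemeasurable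
          (measurableSet_le measurable_norm measurable_const)).2
          (Filter.Eventually.of_forall (hb i)))
        (fun _ => (integral_map (hX i).aemeasurable (f := fun w : ℝ => w)
          measurable_id.aestronglyMeasurable).trans (h0 i))
        (c := 1 / (2 * C ^ 2 * (m + s.card))) (c' := 1 / (2 * C ^ 2 * (m + (s.card + 1))))
        (by positivity) (rate_mul_le hC hm' (Nat.cast_nonneg _))
      rw [Finset.card_insert_of_notMem his]
      simp_rw [Finset.sum_insert his, add_comm (X i _)]
      push_cast
      refine this.trans ((mul_le_mul_right ih _).trans ?_)
      rw [← ENNReal.ofReal_mul (Real.exp_pos _).le, ← Real.exp_add]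
      refine ENNReal.ofReal_le_ofReal (Real.exp_le_exp.2 ?_)
      have e : 1 / (2 * C ^ 2 * (m + (s.card + 1))) * C ^ 2 =
          1 / (2 * ((m : ℝ) + (s.card + 1))) := by
        field_simp
      have e2 : 1 / (2 * ((m : ℝ) + (s.card + 1))) ≤ 1 / (2 * m) := by gcongr; linarith
      rw [e, add_div]
      linarith
  have := key Finset.univ
  have e1 : (Finset.univ : Finset (Fin m)).card / (2 * (m : ℝ)) = 1 / 2 := by
    rw [Finset.card_univ, Fintype.card_fin]; field_simp
  have e2 : 1 / (2 * C ^ 2 * ((m : ℝ) + (Finset.univ : Finset (Fin m)).card)) =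
      1 / (4 * C ^ 2 * m) := by
    rw [Finset.card_univ, Fintype.card_fin]; field_simp; ring
  rw [e1, e2] at this
  simpa using this

/-- The mean deviation over `x ∼ Q` of the empirical averages of `q x` from their expectations
has sub-Gaussian tails, by Jensen's inequality and the scalar bound at each `x`. -/
theorem measure_le_integral_abs_empirical_le {Ω E X : Type*} [MeasurableSpace Ω]
    [MeasurableSpace E] [MeasurableSpace X] {P : Measure Ω} [IsProbabilityMeasure P]
    {Q : Measure X} [IsProbabilityMeasure Q] {ρ : Measure E} [IsProbabilityMeasure ρ] {m : ℕ}
    (hm : 0 < m) {θ : Fin m → Ω → E} (hθ : ∀ i, Measurable (θ i)) (hlaw : ∀ i, P.map (θ i) = ρ)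
    (hi : iIndepFun θ P) {q : X → E → ℝ} (hq : Measurable (Function.uncurry q)) {b : ℝ}
    (hb0 : 0 < b) (hb : ∀ x e, |q x e| ≤ b) {r : ℝ} (hr : 0 ≤ r) :
    P {ω | r ≤ ∫ x, |(1 / m : ℝ) * ∑ i, q x (θ i ω) - ∫ e, q x e ∂ρ| ∂Q} ≤
      ENNReal.ofReal (Real.exp (1 / 2 - m * r ^ 2 / (16 * b ^ 2))) := by
  have hm' : (0 : ℝ) < m := by exact_mod_cast hm
  have hmean : Measurable fun x => ∫ e, q x e ∂ρ :=
    (StronglyMeasurable.integral_prod_right (f := q) hq.stronglyMeasurable).measurable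
  have hmb : ∀ x, |∫ e, q x e ∂ρ| ≤ b := fun x =>
    abs_integral_le_of_abs_le (Filter.Eventually.of_forall (hb x))
  let y : X → Ω → ℝ := fun x ω => ∑ i, (q x (θ i ω) - ∫ e, q x e ∂ρ)
  have hy : Measurable fun p : Ω × X => y p.2 p.1 := by
    refine Finset.measurable_sum _ fun i _ => Measurable.sub ?_ (hmean.comp measurable_snd)
    exact hq.comp (measurable_snd.prodMk ((hθ i).comp measurable_fst))
  have hyb : ∀ x ω, |y x ω| ≤ m * (2 * b) := fun x ω => by
    refine (Finset.abs_sum_le_sum_abs _ _).trans ?_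
    refine (Finset.sum_le_card_nsmul _ _ (2 * b) fun i _ => ?_).trans (by simp)
    have h1 := abs_le.1 (hb x (θ i ω))
    have h2 := abs_le.1 (hmb x)
    rw [abs_le]
    constructor <;> linarith
  have hyeq : ∀ x ω, (1 / m : ℝ) * ∑ i, q x (θ i ω) - ∫ e, q x e ∂ρ = (1 / m : ℝ) * y x ω := by
    intro x ω
    simp only [y, Finset.sum_sub_distrib, Finset.sum_const, Finset.card_univ, Fintype.card_fin,
      nsmul_eq_mul]
    field_simp
  set c : ℝ := 1 / (4 * (2 * b) ^ 2 * m) with hc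
  have hc0 : 0 < c := by positivity
  have hG : Measurable fun p : Ω × X => ENNReal.ofReal (Real.exp (c * (y p.2 p.1) ^ 2)) :=
    (Real.measurable_exp.comp ((hy.pow_const 2).const_mul c)).ennreal_ofReal
  have hpt : ∀ x, ∫⁻ ω, ENNReal.ofReal (Real.exp (c * (y x ω) ^ 2)) ∂P ≤
      ENNReal.ofReal (Real.exp (1 / 2)) := by
    intro x
    have hqx : Measurable fun e => q x e - ∫ e, q x e ∂ρ :=
      (hq.comp measurable_prodMk_left).sub_const _
    refine lintegral_exp_sq_sum_le hm (X := fun i ω => q x (θ i ω) - ∫ e, q x e ∂ρ)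
      (fun i => hqx.comp (hθ i)) (hi.comp (fun _ e => q x e - ∫ e, q x e ∂ρ) fun _ => hqx)
      (by positivity) (fun i ω => ?_) (fun i => ?_)
    · have h1 := abs_le.1 (hb x (θ i ω))
      have h2 := abs_le.1 (hmb x)
      rw [abs_le]
      constructor <;> linarith
    · have hqx' : Measurable fun e => q x e := hq.comp measurable_prodMk_left
      rw [← integral_map (φ := θ i) (f := fun e => q x e - ∫ e, q x e ∂ρ) (hθ i).aemeasurable
        hqx.aestronglyMeasurable, hlaw,
        integral_sub (integrable_of_abs_le hqx'.aestronglyMeasurable (hb x))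
          (integrable_const _)]
      simp
  have htot : ∫⁻ ω, ∫⁻ x, ENNReal.ofReal (Real.exp (c * (y x ω) ^ 2)) ∂Q ∂P ≤
      ENNReal.ofReal (Real.exp (1 / 2)) := by
    rw [lintegral_lintegral_swap hG.aemeasurable]
    refine (lintegral_mono hpt).trans ?_
    simp
  have hexp : m * r ^ 2 / (16 * b ^ 2) = c * (m * r) ^ 2 := by
    rw [hc]; field_simp; ring
  rw [hexp]
  refine measure_le_of_lintegral_exp_sq_le (hG.lintegral_prod_right') htot fun ω hω => ?_
  have hyω : Measurable fun x => y x ω := hy.comp measurable_prodMk_left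
  have hi1 : Integrable (fun x => |y x ω|) Q :=
    integrable_of_abs_le hyω.abs.aestronglyMeasurable fun x => by
      rw [abs_abs]; exact hyb x ω
  have hi2 : Integrable (fun x => c * |y x ω| ^ 2) Q :=
    integrable_of_abs_le ((hyω.abs.pow_const 2).const_mul c).aestronglyMeasurable
      (c := c * (m * (2 * b)) ^ 2) fun x => by
        rw [abs_mul, abs_of_pos hc0, abs_pow, abs_abs]
        gcongr
        exact hyb x ω
  have hi3 : Integrable (fun x => Real.exp (c * |y x ω| ^ 2)) Q :=
    integrable_of_abs_le (Real.measurable_exp.comp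
      ((hyω.abs.pow_const 2).const_mul c)).aestronglyMeasurable
      (c := Real.exp (c * (m * (2 * b)) ^ 2)) fun x => by
        rw [Real.abs_exp]
        gcongr
        exact hyb x ω
  have h1 : m * r ≤ ∫ x, |y x ω| ∂Q := by
    have : r ≤ ∫ x, |(1 / m : ℝ) * ∑ i, q x (θ i ω) - ∫ e, q x e ∂ρ| ∂Q := hω
    simp_rw [hyeq, abs_mul, integral_const_mul] at this
    rw [abs_of_pos (by positivity), div_mul_eq_mul_div, one_mul, le_div_iff₀ hm'] at this
    linarith
  have h2 : c * (∫ x, |y x ω| ∂Q) ^ 2 ≤ ∫ x, c * |y x ω| ^ 2 ∂Q := by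
    have hconv : ConvexOn ℝ Set.univ fun t : ℝ => c * t ^ 2 :=
      ((even_two.convexOn_pow (𝕜 := ℝ)).smul hc0.le)
    exact hconv.map_integral_le (by fun_prop) isClosed_univ
      (Filter.Eventually.of_forall fun _ => Set.mem_univ _) hi1 hi2
  have h3 : Real.exp (∫ x, c * |y x ω| ^ 2 ∂Q) ≤ ∫ x, Real.exp (c * |y x ω| ^ 2) ∂Q :=
    convexOn_exp.map_integral_le Real.continuous_exp.continuousOn isClosed_univ
      (Filter.Eventually.of_forall fun _ => Set.mem_univ _) hi2 hi3
  have h4 : Real.exp (c * (m * r) ^ 2) ≤ ∫ x, Real.exp (c * |y x ω| ^ 2) ∂Q := by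
    refine le_trans (Real.exp_le_exp.2 (le_trans ?_ h2)) h3
    gcongr
  refine (ENNReal.ofReal_le_ofReal h4).trans ?_
  rw [ofReal_integral_eq_lintegral_ofReal hi3
    (Filter.Eventually.of_forall fun _ => (Real.exp_pos _).le)]
  simp_rw [sq_abs]
  exact le_rfl

/-- The mean deviation over `x ∼ 𝒟` of the empirical average of `f x` over the points `θ` from
its expectation under `ρ`. -/
noncomputable def meanDeviation {E X : Type*} [MeasurableSpace E] [MeasurableSpace X] {m : ℕ}
    (𝒟 : Measure X) (ρ : Measure E) (f : X → E → ℝ) (θ : Fin m → E) : ℝ :=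
  ∫ x, |(1 / m : ℝ) * ∑ i, f x (θ i) - ∫ e, f x e ∂ρ| ∂𝒟

section MeanDeviation

variable {E X : Type*} [MeasurableSpace E] [MeasurableSpace X] {m : ℕ} {𝒟 : Measure X}
  {ρ : Measure E} [IsProbabilityMeasure 𝒟] [IsProbabilityMeasure ρ]

theorem integrable_deviation {f : X → E → ℝ} (hf : Measurable (Function.uncurry f)) {b : ℝ}
    (hb : ∀ x e, |f x e| ≤ b) (θ : Fin m → E) :
    Integrable (fun x => (1 / m : ℝ) * ∑ i, f x (θ i) - ∫ e, f x e ∂ρ) 𝒟 := by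
  have hmean : Measurable fun x => ∫ e, f x e ∂ρ :=
    (StronglyMeasurable.integral_prod_right (f := f) hf.stronglyMeasurable).measurable
  have h1 : ∀ i, Measurable fun x => f x (θ i) := fun i => hf.comp measurable_prodMk_right
  refine Integrable.sub (Integrable.const_mul (integrable_finsetSum _ fun i _ =>
    integrable_of_abs_le (h1 i).aestronglyMeasurable fun x => hb x _) _)
    (integrable_of_abs_le hmean.aestronglyMeasurable fun x =>
      abs_integral_le_of_abs_le (Filter.Eventually.of_forall (hb x)))

theorem meanDeviation_add_le {f g : X → E → ℝ} (hf : Measurable (Function.uncurry f))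
    (hg : Measurable (Function.uncurry g)) {b c : ℝ} (hb : ∀ x e, |f x e| ≤ b)
    (hc : ∀ x e, |g x e| ≤ c) (θ : Fin m → E) :
    meanDeviation 𝒟 ρ (fun x e => f x e + g x e) θ ≤
      meanDeviation 𝒟 ρ f θ + meanDeviation 𝒟 ρ g θ := by
  have h1 := integrable_deviation (𝒟 := 𝒟) (ρ := ρ) hf hb θ
  have h2 := integrable_deviation (𝒟 := 𝒟) (ρ := ρ) hg hc θ
  rw [meanDeviation, meanDeviation, meanDeviation, ← integral_add h1.abs h2.abs]
  have hfx : ∀ x, Measurable fun e => f x e := fun x => hf.comp measurable_prodMk_left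
  have hgx : ∀ x, Measurable fun e => g x e := fun x => hg.comp measurable_prodMk_left
  have e : ∀ x, (1 / m : ℝ) * ∑ i, (f x (θ i) + g x (θ i)) - ∫ e, (f x e + g x e) ∂ρ =
      ((1 / m : ℝ) * ∑ i, f x (θ i) - ∫ e, f x e ∂ρ) +
        ((1 / m : ℝ) * ∑ i, g x (θ i) - ∫ e, g x e ∂ρ) := fun x => by
    rw [integral_add (integrable_of_abs_le (hfx x).aestronglyMeasurable (hb x))
      (integrable_of_abs_le (hgx x).aestronglyMeasurable (hc x)), Finset.sum_add_distrib]
    ring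
  simp_rw [e]
  exact integral_mono (h1.add h2).abs (h1.abs.add h2.abs) fun x => abs_add_le _ _

omit [IsProbabilityMeasure 𝒟] [IsProbabilityMeasure ρ] in
theorem meanDeviation_smul (c : ℝ) (f : X → E → ℝ) (θ : Fin m → E) :
    meanDeviation 𝒟 ρ (fun x e => c * f x e) θ = |c| * meanDeviation 𝒟 ρ f θ := by
  rw [meanDeviation, meanDeviation, ← integral_const_mul]
  congr 1
  ext x
  rw [← abs_mul, integral_const_mul, ← Finset.mul_sum]
  congr 1
  ring

/-- A deviation bound that is uniform along a slowly varying sequence `f 0, f 1, …` of bounded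
functions. The increments are averaged together with the initial function in one enlarged
probability space, so that no union bound over the times is needed. -/
theorem measure_exists_le_meanDeviation_le {Ω : Type*} [MeasurableSpace Ω] {P : Measure Ω}
    [IsProbabilityMeasure P] (hm : 0 < m) {θ : Fin m → Ω → E} (hθ : ∀ i, Measurable (θ i))
    (hlaw : ∀ i, P.map (θ i) = ρ) (hi : iIndepFun θ P) {f : ℕ → X → E → ℝ}
    (hf : ∀ k, Measurable (Function.uncurry (f k))) {b ε : ℝ} (hb : 0 < b) (hε : 0 < ε)
    (hf0 : ∀ x e, |f 0 x e| ≤ b) (hfs : ∀ k x e, |f (k + 1) x e - f k x e| ≤ ε * b) (N : ℕ) {r : ℝ}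
    (hr : 0 ≤ r) :
    P {ω | ∃ k ≤ N, (1 + N * ε) * r ≤ meanDeviation 𝒟 ρ (f k) fun i => θ i ω} ≤
      ENNReal.ofReal (Real.exp (1 / 2 - m * r ^ 2 / (16 * b ^ 2))) := by
  have hW : 0 < 1 + N * ε := by positivity
  -- `f 0` and the rescaled increments are all bounded by `b`; with the probability weights `w` the
  -- sum of their deviations over `j ≤ N`, times `1 + N ε`, dominates the deviation of each `f k`
  let d : ℕ → X → E → ℝ := fun j => Nat.casesOn j (f 0) fun j x e => ε⁻¹ * (f (j + 1) x e - f j x e)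
  let w : ℕ → ℝ := fun j => Nat.casesOn j (1 / (1 + N * ε)) fun _ => ε / (1 + N * ε)
  have hwz : w 0 = 1 / (1 + N * ε) := rfl
  have hws : ∀ j, w (j + 1) = ε / (1 + N * ε) := fun _ => rfl
  have hw0 : ∀ j, 0 ≤ w j := fun j => by
    cases j with
    | zero => rw [hwz]; positivity
    | succ j => rw [hws j]; positivity
  have hd : ∀ j, Measurable (Function.uncurry (d j)) := fun j => by
    cases j with
    | zero => exact hf 0
    | succ j => exact ((hf (j + 1)).sub (hf j)).const_mul _
  have hdb : ∀ j x e, |d j x e| ≤ b := fun j x e => by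
    cases j with
    | zero => exact hf0 x e
    | succ j =>
      simp only [d]
      rw [abs_mul, abs_of_pos (inv_pos.2 hε), inv_mul_le_iff₀ hε]
      exact hfs j x e
  let q : ℕ × X → E → ℝ := fun p => d p.1 p.2
  have hq : Measurable (Function.uncurry q) := by
    have h1 : Measurable fun p : ℕ × (X × E) => d p.1 p.2.1 p.2.2 :=
      measurable_from_prod_countable_right fun j => hd j
    exact h1.comp (by fun_prop : Measurable fun p : (ℕ × X) × E => (p.1.1, (p.1.2, p.2)))
  let Q : Measure (ℕ × X) :=
    ∑ j ∈ Finset.range (N + 1), ENNReal.ofReal (w j) • 𝒟.map (fun x => (j, x))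
  have hwsum : ∑ j ∈ Finset.range (N + 1), w j = 1 := by
    rw [Finset.sum_range_succ']
    simp only [hwz, hws, Finset.sum_const, Finset.card_range, nsmul_eq_mul]
    field_simp
    ring
  have hmap : ∀ j : ℕ, Measurable fun x : X => (j, x) := fun j => measurable_prodMk_left
  have hQ : IsProbabilityMeasure Q := ⟨by
    simp only [Q, Measure.finsetSum_apply, Measure.smul_apply, smul_eq_mul]
    have : ∀ j : ℕ, 𝒟.map (fun x => (j, x)) Set.univ = 1 := fun j => by
      rw [Measure.map_apply (hmap j) MeasurableSet.univ]; simp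
    simp_rw [this, mul_one]
    rw [← ENNReal.ofReal_sum_of_nonneg fun j _ => hw0 j, hwsum, ENNReal.ofReal_one]⟩
  have main := measure_le_integral_abs_empirical_le (Q := Q) hm hθ hlaw hi hq hb
    (fun p e => hdb p.1 p.2 e) hr
  refine (measure_mono fun ω hω => ?_).trans main
  obtain ⟨k, hk, hkr⟩ := hω
  -- the deviation over the enlarged space is the weighted sum of the deviations
  have hval : meanDeviation Q ρ q (fun i => θ i ω) =
      ∑ j ∈ Finset.range (N + 1), w j * meanDeviation 𝒟 ρ (d j) fun i => θ i ω := by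
    have hint : ∀ j, Integrable (fun x : ℕ × X => |(1 / m : ℝ) * ∑ i, q x (θ i ω) -
        ∫ e, q x e ∂ρ|) (𝒟.map (fun x => (j, x))) := fun j => by
      have := Measure.isProbabilityMeasure_map (μ := 𝒟) (hmap j).aemeasurable
      exact (integrable_deviation hq (fun p e => hdb p.1 p.2 e) _).abs
    rw [meanDeviation, integral_finsetSum_measure fun j _ =>
      (hint j).smul_measure ENNReal.ofReal_ne_top]
    refine Finset.sum_congr rfl fun j _ => ?_
    rw [integral_smul_measure, ENNReal.toReal_ofReal (hw0 j), smul_eq_mul,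
      integral_map (hmap j).aemeasurable (hint j).aestronglyMeasurable]
    rfl
  have hnn : ∀ g : X → E → ℝ, 0 ≤ meanDeviation 𝒟 ρ g fun i => θ i ω :=
    fun g => integral_nonneg fun _ => abs_nonneg _
  have hfb : ∀ k x e, |f k x e| ≤ b + k * (ε * b) := by
    intro k x e
    induction k with
    | zero => simpa using hf0 x e
    | succ k ih =>
      have h1 := hfs k x e
      have h2 := abs_add_le (f (k + 1) x e - f k x e) (f k x e)
      rw [sub_add_cancel] at h2
      push_cast
      linarith
  have htri : ∀ k, meanDeviation 𝒟 ρ (f k) (fun i => θ i ω) ≤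
      meanDeviation 𝒟 ρ (d 0) (fun i => θ i ω) +
        ∑ j ∈ Finset.range k, ε * meanDeviation 𝒟 ρ (d (j + 1)) fun i => θ i ω := by
    intro k
    induction k with
    | zero => simp [d]
    | succ k ih =>
      have h1 := meanDeviation_add_le (𝒟 := 𝒟) (ρ := ρ) (hf k)
        (g := fun x e => ε * d (k + 1) x e) ((hd (k + 1)).const_mul ε) (c := ε * b) (hfb k) (fun x e => by
          rw [abs_mul, abs_of_pos hε]; gcongr; exact hdb (k + 1) x e) fun i => θ i ω
      have h2 : (fun x e => f k x e + ε * d (k + 1) x e) = f (k + 1) := by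
        ext x e; simp only [d]; field_simp; ring
      have h3 := meanDeviation_smul (𝒟 := 𝒟) (ρ := ρ) ε (d (k + 1)) fun i => θ i ω
      rw [abs_of_pos hε] at h3
      rw [h2, h3] at h1
      rw [Finset.sum_range_succ]
      linarith
  have hmono : ∑ j ∈ Finset.range k, ε * meanDeviation 𝒟 ρ (d (j + 1)) (fun i => θ i ω) ≤
      ∑ j ∈ Finset.range N, ε * meanDeviation 𝒟 ρ (d (j + 1)) fun i => θ i ω :=
    Finset.sum_le_sum_of_subset_of_nonneg (Finset.range_subset_range.2 hk)
      fun j _ _ => mul_nonneg hε.le (hnn _)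
  have hfin : (1 + N * ε) * meanDeviation Q ρ q (fun i => θ i ω) =
      meanDeviation 𝒟 ρ (d 0) (fun i => θ i ω) +
        ∑ j ∈ Finset.range N, ε * meanDeviation 𝒟 ρ (d (j + 1)) fun i => θ i ω := by
    rw [hval, Finset.sum_range_succ', mul_add, Finset.mul_sum, add_comm]
    congr 1
    · rw [hwz]; field_simp
    · refine Finset.sum_congr rfl fun j _ => ?_
      rw [hws j]; field_simp
  have := (hkr.trans (htri k)).trans (add_le_add_right hmono _)
  rw [← hfin] at this
  exact le_of_mul_le_mul_left this hW

end MeanDeviation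

/-! ### The temporal-difference field and its regularity -/

/-- The standing assumptions in abstract form: a bounded activation `s` with bounded and Lipschitz
gradient, and a law `μ` of transitions `(x, (r, x'))` with bounded reward, both of whose state
marginals are `𝒟`. -/
structure TDModel {X : Type*} [MeasurableSpace X] {D : ℕ} (s : X → Param D → ℝ)
    (μ : Measure (X × (ℝ × X))) (𝒟 : Measure X) (b₀ b₁ b₂ br : ℝ) : Prop where
  measurable : Measurable (Function.uncurry s)
  differentiable : ∀ x, Differentiable ℝ (s x)
  bound : ∀ x θ, |s x θ| ≤ b₀
  bound_gradient : ∀ x θ, ‖gradient (s x) θ‖ ≤ b₁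
  lip_gradient : ∀ x θ θ', ‖gradient (s x) θ - gradient (s x) θ'‖ ≤ b₂ * ‖θ - θ'‖
  bound_reward : ∀ᵐ z ∂μ, |z.2.1| ≤ br
  map_fst : μ.map Prod.fst = 𝒟
  map_next : μ.map (fun z => z.2.2) = 𝒟
  pos₀ : 0 < b₀
  pos₁ : 0 < b₁
  pos₂ : 0 < b₂
  posr : 0 < br

section Defs

variable {X : Type*} {D : ℕ}

/-- The direction `-α (Q(x) - r - γ Q(x')) ∇_θ s(x; θ)` of a temporal-difference step at the
transition `z = (x, (r, x'))`, when the current value function is `Q`. -/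
noncomputable def tdDir (α γ : ℝ) (s : X → Param D → ℝ) (Q : X → ℝ) (z : X × (ℝ × X))
    (θ : Param D) : Param D :=
  -((α * (Q z.1 - z.2.1 - γ * Q z.2.2)) • gradient (s z.1) θ)

/-- The expected temporal-difference direction for the value function `Q`. -/
noncomputable def tdMean [MeasurableSpace X] (α γ : ℝ) (s : X → Param D → ℝ)
    (μ : Measure (X × (ℝ × X))) (Q : X → ℝ) (θ : Param D) : Param D :=
  ∫ z, tdDir α γ s Q z θ ∂μ

theorem tdField_eq_tdMean [MeasurableSpace X] (α γ : ℝ) (s : X → Param D → ℝ)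
    (μ : Measure (X × (ℝ × X))) (ρ : Measure (Param D)) (θ : Param D) :
    tdField α γ s μ ρ θ = tdMean α γ s μ (meanFieldQ α s ρ) θ := by
  simp only [tdField, tdMean, tdDir, mul_smul]
  rw [integral_neg, integral_smul]

theorem tdIterate_succ_eq (α η γ ε : ℝ) {m : ℕ} (s : X → Param D → ℝ)
    (θ₀ : Fin m → Param D) (z : ℕ → X × (ℝ × X)) (k : ℕ) (i : Fin m) :
    tdIterate α η γ ε s θ₀ z (k + 1) i = tdIterate α η γ ε s θ₀ z k i +
      (η * ε) • tdDir α γ s (finiteQ α s (tdIterate α η γ ε s θ₀ z k)) (z k)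
        (tdIterate α η γ ε s θ₀ z k i) := by
  rw [tdDir, smul_neg, smul_smul, ← mul_assoc, ← sub_eq_add_neg]
  rfl

end Defs

/-- The gradient in the parameter of a jointly measurable function is jointly measurable, being
a limit of difference quotients. -/
theorem measurable_gradient_uncurry {X : Type*} [MeasurableSpace X] {D : ℕ} {s : X → Param D → ℝ}
    (hs : Measurable (Function.uncurry s)) (hd : ∀ x, Differentiable ℝ (s x)) :
    Measurable fun p : X × Param D => gradient (s p.1) p.2 := by
  have h1 : ∀ i : Fin D, Measurable fun p : X × Param D => (gradient (s p.1) p.2) i := by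
    intro i
    have e : ∀ p : X × Param D, (gradient (s p.1) p.2) i =
        fderiv ℝ (s p.1) p.2 (EuclideanSpace.single i 1) := fun p => by
      rw [← inner_gradient_eq_fderiv, EuclideanSpace.inner_single_right]
      simp
    simp_rw [e]
    refine measurable_of_tendsto_metrizable (f := fun (n : ℕ) (p : X × Param D) =>
      (n : ℝ) * (s p.1 (p.2 + (n : ℝ)⁻¹ • EuclideanSpace.single i 1) - s p.1 p.2)) (fun n => ?_) ?_
    · refine Measurable.const_mul (Measurable.sub ?_ hs) _
      exact hs.comp (by fun_prop : Measurable fun p : X × Param D =>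
        (p.1, p.2 + (n : ℝ)⁻¹ • EuclideanSpace.single i (1 : ℝ)))
    · rw [tendsto_pi_nhds]
      intro p
      exact ((hd p.1 p.2).hasFDerivAt.lim_real (EuclideanSpace.single i 1)).comp
        tendsto_natCast_atTop_atTop
  have h2 : Measurable fun p : X × Param D => (fun i => (gradient (s p.1) p.2) i) :=
    measurable_pi_lambda _ h1
  exact (MeasurableEquiv.toLp 2 (Fin D → ℝ)).measurable.comp h2

namespace TDModel

variable {X : Type*} [MeasurableSpace X] {D : ℕ} {s : X → Param D → ℝ}
  {μ : Measure (X × (ℝ × X))} {𝒟 : Measure X} {b₀ b₁ b₂ br : ℝ}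

theorem measurable_gradient (h : TDModel s μ 𝒟 b₀ b₁ b₂ br) :
    Measurable fun p : X × Param D => gradient (s p.1) p.2 :=
  measurable_gradient_uncurry h.measurable h.differentiable

theorem lip (h : TDModel s μ 𝒟 b₀ b₁ b₂ br) (x : X) (θ θ' : Param D) :
    |s x θ - s x θ'| ≤ b₁ * ‖θ - θ'‖ :=
  abs_sub_le_of_norm_gradient_le (h.differentiable x) (h.bound_gradient x) θ θ'

theorem continuous (h : TDModel s μ 𝒟 b₀ b₁ b₂ br) (x : X) : Continuous (s x) :=
  (h.differentiable x).continuous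

theorem measurable_meanFieldQ (h : TDModel s μ 𝒟 b₀ b₁ b₂ br) (α : ℝ) (ρ : Measure (Param D))
    [IsProbabilityMeasure ρ] : Measurable (meanFieldQ α s ρ) :=
  ((StronglyMeasurable.integral_prod_right (f := s)
    h.measurable.stronglyMeasurable).measurable).const_mul α

theorem abs_meanFieldQ_le (h : TDModel s μ 𝒟 b₀ b₁ b₂ br) {α : ℝ} (hα : 0 < α)
    (ρ : Measure (Param D)) [IsProbabilityMeasure ρ] (x : X) : |meanFieldQ α s ρ x| ≤ α * b₀ := by
  rw [meanFieldQ, abs_mul, abs_of_pos hα]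
  gcongr
  exact abs_integral_le_of_abs_le (Filter.Eventually.of_forall (h.bound x))

theorem measurable_finiteQ_uncurry (h : TDModel s μ 𝒟 b₀ b₁ b₂ br) (α : ℝ) (m : ℕ) :
    Measurable fun p : (Fin m → Param D) × X => finiteQ α s p.1 p.2 := by
  refine (Finset.measurable_sum _ fun i _ => ?_).const_mul _
  exact h.measurable.comp (by fun_prop : Measurable fun p : (Fin m → Param D) × X => (p.2, p.1 i))

theorem measurable_finiteQ (h : TDModel s μ 𝒟 b₀ b₁ b₂ br) (α : ℝ) {m : ℕ} (θ : Fin m → Param D) :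
    Measurable (finiteQ α s θ) :=
  (h.measurable_finiteQ_uncurry α m).comp measurable_prodMk_left

theorem abs_finiteQ_le (h : TDModel s μ 𝒟 b₀ b₁ b₂ br) {α : ℝ} (hα : 0 < α) {m : ℕ} (hm : 0 < m)
    (θ : Fin m → Param D) (x : X) : |finiteQ α s θ x| ≤ α * b₀ := by
  have hm' : (0 : ℝ) < m := by exact_mod_cast hm
  rw [finiteQ, abs_mul, abs_of_pos (by positivity)]
  have : |∑ i, s x (θ i)| ≤ m * b₀ := by
    refine (Finset.abs_sum_le_sum_abs _ _).trans ?_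
    exact (Finset.sum_le_card_nsmul _ _ b₀ fun i _ => h.bound x _).trans (by simp)
  calc α / m * |∑ i, s x (θ i)| ≤ α / m * (m * b₀) := by gcongr
    _ = α * b₀ := by field_simp

section Field

variable {α γ : ℝ} {Q Q' : X → ℝ}

theorem measurable_tdDir (h : TDModel s μ 𝒟 b₀ b₁ b₂ br) (hQ : Measurable Q) (θ : Param D) :
    Measurable fun z => tdDir α γ s Q z θ := by
  have h1 : Measurable fun z : X × (ℝ × X) => α * (Q z.1 - z.2.1 - γ * Q z.2.2) := by fun_prop
  have h2 : Measurable fun z : X × (ℝ × X) => gradient (s z.1) θ :=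
    h.measurable_gradient.comp (by fun_prop : Measurable fun z : X × (ℝ × X) => (z.1, θ))
  exact (h1.smul h2).neg

theorem abs_tdError_le (h : TDModel s μ 𝒟 b₀ b₁ b₂ br) (hα : 0 < α) (hγ₀ : 0 < γ) (hγ₁ : γ < 1)
    (hb : ∀ x, |Q x| ≤ α * b₀) :
    ∀ᵐ z ∂μ, |α * (Q z.1 - z.2.1 - γ * Q z.2.2)| ≤ α * (2 * α * b₀ + br) := by
  filter_upwards [h.bound_reward] with z hz
  rw [abs_mul, abs_of_pos hα]
  gcongr
  have h1 := abs_le.1 (hb z.1)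
  have h2 := hb z.2.2
  have h3 : |γ * Q z.2.2| ≤ α * b₀ := by
    rw [abs_mul, abs_of_pos hγ₀]
    exact (mul_le_of_le_one_left (abs_nonneg _) hγ₁.le).trans h2
  rw [abs_le] at *
  constructor <;> linarith

theorem norm_tdDir_le (h : TDModel s μ 𝒟 b₀ b₁ b₂ br) (hα : 0 < α) (hγ₀ : 0 < γ) (hγ₁ : γ < 1)
    (hb : ∀ x, |Q x| ≤ α * b₀) :
    ∀ᵐ z ∂μ, ∀ θ, ‖tdDir α γ s Q z θ‖ ≤ α * (2 * α * b₀ + br) * b₁ := by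
  filter_upwards [h.abs_tdError_le hα hγ₀ hγ₁ hb] with z hz θ
  rw [tdDir, norm_neg, norm_smul, Real.norm_eq_abs]
  exact mul_le_mul hz (h.bound_gradient _ _) (norm_nonneg _) ((abs_nonneg _).trans hz)

variable [IsProbabilityMeasure μ]

theorem integrable_tdDir (h : TDModel s μ 𝒟 b₀ b₁ b₂ br) (hα : 0 < α) (hγ₀ : 0 < γ) (hγ₁ : γ < 1)
    (hQ : Measurable Q) (hb : ∀ x, |Q x| ≤ α * b₀) (θ : Param D) :
    Integrable (fun z => tdDir α γ s Q z θ) μ := by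
  refine Integrable.of_bound (h.measurable_tdDir hQ θ).aestronglyMeasurable
    (α * (2 * α * b₀ + br) * b₁) ?_
  filter_upwards [h.norm_tdDir_le hα hγ₀ hγ₁ hb] with z hz using hz θ

theorem norm_tdMean_le (h : TDModel s μ 𝒟 b₀ b₁ b₂ br) (hα : 0 < α) (hγ₀ : 0 < γ) (hγ₁ : γ < 1)
    (hb : ∀ x, |Q x| ≤ α * b₀) (θ : Param D) :
    ‖tdMean α γ s μ Q θ‖ ≤ α * (2 * α * b₀ + br) * b₁ := by
  have := norm_integral_le_of_norm_le_const (μ := μ) (f := fun z => tdDir α γ s Q z θ)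
    (C := α * (2 * α * b₀ + br) * b₁)
    (by filter_upwards [h.norm_tdDir_le hα hγ₀ hγ₁ hb] with z hz using hz θ)
  simpa [tdMean] using this

theorem norm_tdMean_sub_le (h : TDModel s μ 𝒟 b₀ b₁ b₂ br) (hα : 0 < α) (hγ₀ : 0 < γ)
    (hγ₁ : γ < 1) (hQ : Measurable Q) (hb : ∀ x, |Q x| ≤ α * b₀) (θ θ' : Param D) :
    ‖tdMean α γ s μ Q θ - tdMean α γ s μ Q θ'‖ ≤
      α * (2 * α * b₀ + br) * b₂ * ‖θ - θ'‖ := by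
  rw [tdMean, tdMean, ← integral_sub (h.integrable_tdDir hα hγ₀ hγ₁ hQ hb θ)
    (h.integrable_tdDir hα hγ₀ hγ₁ hQ hb θ')]
  have := norm_integral_le_of_norm_le_const (μ := μ)
    (f := fun z => tdDir α γ s Q z θ - tdDir α γ s Q z θ')
    (C := α * (2 * α * b₀ + br) * b₂ * ‖θ - θ'‖) (by
      filter_upwards [h.abs_tdError_le hα hγ₀ hγ₁ hb] with z hz
      rw [tdDir, tdDir, neg_sub_neg, ← smul_sub, norm_smul, Real.norm_eq_abs, norm_sub_rev,
        mul_assoc _ b₂]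
      exact mul_le_mul hz (h.lip_gradient _ _ _) (norm_nonneg _) ((abs_nonneg _).trans hz))
  simpa using this

/-- The dependence of the field on the value function is controlled in `L¹(𝒟)`. Since both the
state and the next state have law `𝒟`, the bootstrapped term `γ Q(x')` is controlled by the same
norm. -/
theorem norm_tdMean_sub_le_integral (h : TDModel s μ 𝒟 b₀ b₁ b₂ br) (hα : 0 < α) (hγ₀ : 0 < γ)
    (hγ₁ : γ < 1) (hQ : Measurable Q) (hb : ∀ x, |Q x| ≤ α * b₀) (hQ' : Measurable Q')
    (hb' : ∀ x, |Q' x| ≤ α * b₀) (θ : Param D) :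
    ‖tdMean α γ s μ Q θ - tdMean α γ s μ Q' θ‖ ≤ 2 * α * b₁ * ∫ x, |Q x - Q' x| ∂𝒟 := by
  rw [tdMean, tdMean, ← integral_sub (h.integrable_tdDir hα hγ₀ hγ₁ hQ hb θ)
    (h.integrable_tdDir hα hγ₀ hγ₁ hQ' hb' θ)]
  have hm : Measurable fun x => |Q x - Q' x| := (hQ.sub hQ').abs
  have hbd : ∀ x, |(|Q x - Q' x|)| ≤ 2 * (α * b₀) := fun x => by
    have h1 := abs_le.1 (hb x)
    have h2 := abs_le.1 (hb' x)
    rw [abs_abs, abs_le]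
    constructor <;> linarith
  have hn : Measurable fun z : X × (ℝ × X) => z.2.2 := by fun_prop
  have e1 : ∫ z, |Q z.1 - Q' z.1| ∂μ = ∫ x, |Q x - Q' x| ∂𝒟 := by
    rw [← h.map_fst, integral_map measurable_fst.aemeasurable hm.aestronglyMeasurable]
  have e2 : ∫ z, |Q z.2.2 - Q' z.2.2| ∂μ = ∫ x, |Q x - Q' x| ∂𝒟 := by
    rw [← h.map_next, integral_map hn.aemeasurable hm.aestronglyMeasurable]
  have i1 : Integrable (fun z : X × (ℝ × X) => |Q z.1 - Q' z.1|) μ :=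
    integrable_of_abs_le (hm.comp measurable_fst).aestronglyMeasurable fun z => hbd z.1
  have i2 : Integrable (fun z : X × (ℝ × X) => |Q z.2.2 - Q' z.2.2|) μ :=
    integrable_of_abs_le (hm.comp hn).aestronglyMeasurable fun z => hbd z.2.2
  have := norm_integral_le_of_norm_le (μ := μ)
    (f := fun z => tdDir α γ s Q z θ - tdDir α γ s Q' z θ)
    (g := fun z => α * b₁ * (|Q z.1 - Q' z.1| + |Q z.2.2 - Q' z.2.2|)) ((i1.add i2).const_mul _)
    (Filter.Eventually.of_forall fun z => by
      rw [tdDir, tdDir, neg_sub_neg, ← sub_smul, norm_smul, Real.norm_eq_abs, mul_right_comm]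
      refine mul_le_mul ?_ (h.bound_gradient _ _) (norm_nonneg _) (by positivity)
      rw [← mul_sub, abs_mul, abs_of_pos hα]
      gcongr
      have e : Q' z.1 - z.2.1 - γ * Q' z.2.2 - (Q z.1 - z.2.1 - γ * Q z.2.2) =
          -(Q z.1 - Q' z.1) + γ * (Q z.2.2 - Q' z.2.2) := by ring
      rw [e]
      refine (abs_add_le _ _).trans ?_
      rw [abs_neg, abs_mul, abs_of_pos hγ₀]
      gcongr
      exact mul_le_of_le_one_left (abs_nonneg _) hγ₁.le)
  refine this.trans (le_of_eq ?_)
  rw [integral_const_mul, integral_add i1 i2, e1, e2]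
  ring

end Field

section Transport

variable {α η γ T : ℝ} [IsProbabilityMeasure μ] [IsProbabilityMeasure 𝒟]
  {ρ₀ : ProbabilityMeasure (Param D)} {ρ : ℝ → ProbabilityMeasure (Param D)}

omit [IsProbabilityMeasure μ] [IsProbabilityMeasure 𝒟] in
theorem tendsto_meanFieldQ (h : TDModel s μ 𝒟 b₀ b₁ b₂ br) {t : ℝ} {S : Set ℝ}
    (hρ : ContinuousWithinAt ρ S t) (x : X) :
    Filter.Tendsto (fun τ => meanFieldQ α s (ρ τ) x) (nhdsWithin t S)
      (nhds (meanFieldQ α s (ρ t) x)) :=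
  ((ProbabilityMeasure.tendsto_iff_forall_integral_tendsto.1 hρ)
    (BoundedContinuousFunction.ofNormedAddCommGroup (s x) (h.continuous x) b₀
      (h.bound x))).const_mul α

/-- A solution of the mean-field equation solves the continuity equation of its own field. -/
theorem isTransport (h : TDModel s μ 𝒟 b₀ b₁ b₂ br) (hα : 0 < α) (hη : 0 < η) (hγ₀ : 0 < γ)
    (hγ₁ : γ < 1) (hρ : IsPDESolution α η γ T s μ ρ₀ ρ) :
    IsTransport (fun t θ => η • tdMean α γ s μ (meanFieldQ α s (ρ t)) θ) ρ T
      (η * (α * (2 * α * b₀ + br) * b₁)) (η * (α * (2 * α * b₀ + br) * b₂)) where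
  weak f hf hc t ht := by
    rw [hρ.initial, hρ.weak f hf hc t ht, ← intervalIntegral.integral_const_mul]
    simp_rw [tdField_eq_tdMean, real_inner_smul_right, integral_const_mul]
  cont f hf hc := by
    have hgc : Continuous (gradient f) := by
      have := hf.continuous_fderiv (by simp)
      exact (InnerProductSpace.toDual ℝ (Param D)).symm.continuous.comp this
    obtain ⟨ℓ, hℓ⟩ : ∃ ℓ, ∀ θ, ‖gradient f θ‖ ≤ ℓ := by
      refine hgc.bounded_above_of_compact_support (hc.mono' fun x hx => ?_)
      by_contra hn
      apply hx
      rw [gradient, fderiv_of_notMem_tsupport ℝ hn, map_zero]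
    have hℓ0 : 0 ≤ ℓ := (norm_nonneg _).trans (hℓ 0)
    intro t ht
    have hvc : ∀ τ, Continuous fun θ => η • tdMean α γ s μ (meanFieldQ α s (ρ τ)) θ := fun τ =>
      (continuous_of_norm_sub_le (h.norm_tdMean_sub_le hα hγ₀ hγ₁ (h.measurable_meanFieldQ α _)
        (h.abs_meanFieldQ_le hα _))).const_smul η
    set B := ℓ * (η * (α * (2 * α * b₀ + br) * b₁)) with hB
    have hbd : ∀ τ θ, |inner ℝ (gradient f θ) (η • tdMean α γ s μ (meanFieldQ α s (ρ τ)) θ)| ≤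
        B := fun τ θ => by
      refine (abs_real_inner_le_norm _ _).trans (mul_le_mul (hℓ θ) ?_ (norm_nonneg _) hℓ0)
      rw [norm_smul, Real.norm_of_nonneg hη.le]
      gcongr
      exact h.norm_tdMean_le hα hγ₀ hγ₁ (h.abs_meanFieldQ_le hα _) θ
    have hic : ∀ τ, Continuous fun θ =>
        inner ℝ (gradient f θ) (η • tdMean α γ s μ (meanFieldQ α s (ρ τ)) θ) := fun τ =>
      hgc.inner (hvc τ)
    have hρt : ContinuousWithinAt ρ (Set.Icc 0 T) t := hρ.continuousOn t ht
    have h1 : Filter.Tendsto (fun τ => ∫ θ, inner ℝ (gradient f θ)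
        (η • tdMean α γ s μ (meanFieldQ α s (ρ t)) θ) ∂(ρ τ : Measure (Param D)))
        (nhdsWithin t (Set.Icc 0 T)) (nhds (∫ θ, inner ℝ (gradient f θ)
        (η • tdMean α γ s μ (meanFieldQ α s (ρ t)) θ) ∂(ρ t : Measure (Param D)))) :=
      (ProbabilityMeasure.tendsto_iff_forall_integral_tendsto.1 hρt)
        (BoundedContinuousFunction.ofNormedAddCommGroup _ (hic t) B (hbd t))
    have h2 : Filter.Tendsto (fun τ => ∫ x, |meanFieldQ α s (ρ τ) x - meanFieldQ α s (ρ t) x| ∂𝒟)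
        (nhdsWithin t (Set.Icc 0 T)) (nhds (∫ _, (0 : ℝ) ∂𝒟)) := by
      refine tendsto_integral_filter_of_dominated_convergence (fun _ => 2 * (α * b₀))
        (Filter.Eventually.of_forall fun τ => ((h.measurable_meanFieldQ α _).sub
          (h.measurable_meanFieldQ α _)).abs.aestronglyMeasurable)
        (Filter.Eventually.of_forall fun τ => Filter.Eventually.of_forall fun x => ?_)
        (integrable_const _) (Filter.Eventually.of_forall fun x => ?_)
      · have e1 := abs_le.1 (h.abs_meanFieldQ_le hα (ρ τ : Measure (Param D)) x)
        have e2 := abs_le.1 (h.abs_meanFieldQ_le hα (ρ t : Measure (Param D)) x)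
        rw [Real.norm_eq_abs, abs_abs, abs_le]
        constructor <;> linarith
      · have := ((h.tendsto_meanFieldQ (α := α) hρt x).sub_const (meanFieldQ α s (ρ t) x)).abs
        simpa using this
    rw [integral_zero] at h2
    have h3 : Filter.Tendsto (fun τ => ∫ θ, (inner ℝ (gradient f θ)
          (η • tdMean α γ s μ (meanFieldQ α s (ρ τ)) θ) - inner ℝ (gradient f θ)
          (η • tdMean α γ s μ (meanFieldQ α s (ρ t)) θ)) ∂(ρ τ : Measure (Param D)))
        (nhdsWithin t (Set.Icc 0 T)) (nhds 0) := by
      refine squeeze_zero_norm (fun τ => ?_) (by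
        simpa using h2.const_mul (ℓ * (η * (2 * α * b₁))))
      refine abs_integral_le_of_abs_le (Filter.Eventually.of_forall fun θ => ?_)
      rw [← inner_sub_right, ← smul_sub]
      refine (abs_real_inner_le_norm _ _).trans ?_
      rw [norm_smul, Real.norm_of_nonneg hη.le, mul_assoc, mul_assoc η]
      refine mul_le_mul (hℓ θ) (mul_le_mul_of_nonneg_left ?_ hη.le) (by positivity) hℓ0
      exact h.norm_tdMean_sub_le_integral hα hγ₀ hγ₁ (h.measurable_meanFieldQ α _)
        (h.abs_meanFieldQ_le hα _) (h.measurable_meanFieldQ α _) (h.abs_meanFieldQ_le hα _) θ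
    have h4 := h3.add h1
    rw [zero_add] at h4
    refine h4.congr fun τ => ?_
    rw [integral_sub (integrable_of_abs_le (hic τ).aestronglyMeasurable (hbd τ))
      (integrable_of_abs_le (hic t).aestronglyMeasurable (hbd t)), sub_add_cancel]
  bound t θ := by
    rw [norm_smul, Real.norm_of_nonneg hη.le]
    gcongr
    exact h.norm_tdMean_le hα hγ₀ hγ₁ (h.abs_meanFieldQ_le hα _) θ
  lip t θ θ' := by
    rw [← smul_sub, norm_smul, Real.norm_of_nonneg hη.le, mul_assoc]
    gcongr
    exact h.norm_tdMean_sub_le hα hγ₀ hγ₁ (h.measurable_meanFieldQ α _)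
      (h.abs_meanFieldQ_le hα _) θ θ'

theorem norm_field_sub_le (h : TDModel s μ 𝒟 b₀ b₁ b₂ br) (hα : 0 < α) (hη : 0 < η) (hγ₀ : 0 < γ)
    (hγ₁ : γ < 1) (hρ : IsPDESolution α η γ T s μ ρ₀ ρ) (r : ℝ) (hr : r ∈ Set.Icc 0 T) (t : ℝ)
    (ht : t ∈ Set.Icc 0 T) (θ : Param D) :
    ‖η • tdMean α γ s μ (meanFieldQ α s (ρ t)) θ - η • tdMean α γ s μ (meanFieldQ α s (ρ r)) θ‖ ≤
      (η * (2 * α * b₁) * (α * b₁ * (η * (α * (2 * α * b₀ + br) * b₁)))) * |t - r| := by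
  have hT := h.isTransport hα hη hγ₀ hγ₁ hρ
  rw [← smul_sub, norm_smul, Real.norm_of_nonneg hη.le, mul_assoc, mul_assoc]
  have hb₁ := h.pos₁
  refine mul_le_mul_of_nonneg_left ((h.norm_tdMean_sub_le_integral hα hγ₀ hγ₁
    (h.measurable_meanFieldQ α _) (h.abs_meanFieldQ_le hα _) (h.measurable_meanFieldQ α _)
    (h.abs_meanFieldQ_le hα _) θ).trans ?_) hη.le
  gcongr
  have := abs_integral_le_of_abs_le (μ := 𝒟)
    (f := fun x => |meanFieldQ α s (ρ t) x - meanFieldQ α s (ρ r) x|)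
    (c := α * b₁ * (η * (α * (2 * α * b₀ + br) * b₁)) * |t - r|)
    (Filter.Eventually.of_forall fun x => by
      have e := hT.abs_integral_sub_le h.pos₁.le (h.lip x) (h.bound x) hr ht
      rw [abs_abs, meanFieldQ, meanFieldQ, ← mul_sub, abs_mul, abs_of_pos hα]
      calc _ ≤ α * _ := mul_le_mul_of_nonneg_left e hα.le
        _ = _ := by ring)
  exact (le_abs_self _).trans this

end Transport

end TDModel

/-! ### The noise of the temporal-difference iterates -/

section Noise

variable {X : Type*} [MeasurableSpace X] {D m : ℕ} {s : X → Param D → ℝ}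
  {μ : Measure (X × (ℝ × X))} {𝒟 : Measure X} {b₀ b₁ b₂ br α η γ : ℝ}

/-- `η` times the deviation of the temporal-difference directions of all particles from their
conditional means, as a vector of the Euclidean space `(ℝ^D)^m`. -/
noncomputable def tdNoise (α η γ : ℝ) (s : X → Param D → ℝ) (μ : Measure (X × (ℝ × X)))
    (θ : Fin m → Param D) (z : X × (ℝ × X)) : PiLp 2 fun _ : Fin m => Param D :=
  WithLp.toLp 2 fun i =>
    η • (tdDir α γ s (finiteQ α s θ) z (θ i) - tdMean α γ s μ (finiteQ α s θ) (θ i))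

/-- One step of the temporal-difference dynamics. -/
noncomputable def tdStep (α η γ ε : ℝ) (s : X → Param D → ℝ) (θ : Fin m → Param D)
    (z : X × (ℝ × X)) : Fin m → Param D :=
  fun i => θ i + (η * ε) • tdDir α γ s (finiteQ α s θ) z (θ i)

namespace TDModel

theorem measurable_tdDir_uncurry (h : TDModel s μ 𝒟 b₀ b₁ b₂ br) (i : Fin m) :
    Measurable fun p : (Fin m → Param D) × (X × (ℝ × X)) =>
      tdDir α γ s (finiteQ α s p.1) p.2 (p.1 i) := by
  have hQ := h.measurable_finiteQ_uncurry α m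
  have h1 : Measurable fun p : (Fin m → Param D) × (X × (ℝ × X)) => finiteQ α s p.1 p.2.1 :=
    hQ.comp (by fun_prop : Measurable fun p : (Fin m → Param D) × (X × (ℝ × X)) => (p.1, p.2.1))
  have h2 : Measurable fun p : (Fin m → Param D) × (X × (ℝ × X)) => finiteQ α s p.1 p.2.2.2 :=
    hQ.comp (by fun_prop : Measurable fun p : (Fin m → Param D) × (X × (ℝ × X)) => (p.1, p.2.2.2))
  have h3 : Measurable fun p : (Fin m → Param D) × (X × (ℝ × X)) => gradient (s p.2.1) (p.1 i) :=
    h.measurable_gradient.comp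
      (by fun_prop : Measurable fun p : (Fin m → Param D) × (X × (ℝ × X)) => (p.2.1, p.1 i))
  have h4 : Measurable fun p : (Fin m → Param D) × (X × (ℝ × X)) =>
      α * (finiteQ α s p.1 p.2.1 - p.2.2.1 - γ * finiteQ α s p.1 p.2.2.2) := by fun_prop
  exact (h4.smul h3).neg

theorem measurable_tdStep (h : TDModel s μ 𝒟 b₀ b₁ b₂ br) (ε : ℝ) :
    Measurable (Function.uncurry (tdStep (m := m) α η γ ε s)) :=
  measurable_pi_lambda _ fun i =>
    ((measurable_pi_apply i).comp measurable_fst).add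
      ((h.measurable_tdDir_uncurry i).const_smul (η * ε))

variable [IsProbabilityMeasure μ]

theorem measurable_tdNoise (h : TDModel s μ 𝒟 b₀ b₁ b₂ br) :
    Measurable (Function.uncurry (tdNoise (m := m) α η γ s μ)) := by
  have h1 : ∀ i : Fin m, Measurable fun θ : Fin m → Param D =>
      tdMean α γ s μ (finiteQ α s θ) (θ i) := fun i =>
    (StronglyMeasurable.integral_prod_right (ν := μ)
      (f := fun (θ : Fin m → Param D) z => tdDir α γ s (finiteQ α s θ) z (θ i))
      (h.measurable_tdDir_uncurry i).stronglyMeasurable).measurable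
  have h2 : Measurable fun p : (Fin m → Param D) × (X × (ℝ × X)) => fun i =>
      η • (tdDir α γ s (finiteQ α s p.1) p.2 (p.1 i) -
        tdMean α γ s μ (finiteQ α s p.1) (p.1 i)) :=
    measurable_pi_lambda _ fun i =>
      (((h.measurable_tdDir_uncurry i).sub ((h1 i).comp measurable_fst)).const_smul η)
  exact (MeasurableEquiv.toLp 2 (Fin m → Param D)).measurable.comp h2

theorem norm_tdNoise_le (h : TDModel s μ 𝒟 b₀ b₁ b₂ br) (hm : 0 < m) (hα : 0 < α) (hη : 0 < η)
    (hγ₀ : 0 < γ) (hγ₁ : γ < 1) (θ : Fin m → Param D) :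
    ∀ᵐ z ∂μ, ‖tdNoise α η γ s μ θ z‖ ≤ √m * (2 * (η * (α * (2 * α * b₀ + br) * b₁))) := by
  have hb := h.abs_finiteQ_le hα hm θ
  have h0 := h.pos₀
  have h1 := h.pos₁
  have hr := h.posr
  filter_upwards [h.norm_tdDir_le hα hγ₀ hγ₁ hb] with z hz
  rw [PiLp.norm_eq_of_L2]
  refine Real.sqrt_le_iff.2 ⟨by positivity, ?_⟩
  rw [mul_pow, Real.sq_sqrt (Nat.cast_nonneg m)]
  refine (Finset.sum_le_card_nsmul _ _ ((2 * (η * (α * (2 * α * b₀ + br) * b₁))) ^ 2)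
    fun i _ => ?_).trans (by simp)
  gcongr
  simp only [tdNoise]
  rw [norm_smul, Real.norm_of_nonneg hη.le]
  have e := (norm_sub_le (tdDir α γ s (finiteQ α s θ) z (θ i))
    (tdMean α γ s μ (finiteQ α s θ) (θ i))).trans
      (add_le_add (hz _) (h.norm_tdMean_le hα hγ₀ hγ₁ hb _))
  calc _ ≤ η * _ := mul_le_mul_of_nonneg_left e hη.le
    _ = _ := by ring

theorem integral_tdNoise (h : TDModel s μ 𝒟 b₀ b₁ b₂ br) (hm : 0 < m) (hα : 0 < α)
    (hγ₀ : 0 < γ) (hγ₁ : γ < 1) (θ : Fin m → Param D) :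
    ∫ z, tdNoise α η γ s μ θ z ∂μ = 0 := by
  have hi : ∀ i, Integrable (fun z => tdDir α γ s (finiteQ α s θ) z (θ i)) μ := fun i =>
    h.integrable_tdDir hα hγ₀ hγ₁ (h.measurable_finiteQ α θ) (h.abs_finiteQ_le hα hm θ) (θ i)
  have hN : Integrable (tdNoise α η γ s μ θ) μ := by
    have e : Integrable (fun z i => η • (tdDir α γ s (finiteQ α s θ) z (θ i) -
        tdMean α γ s μ (finiteQ α s θ) (θ i))) μ :=
      Integrable.of_eval fun i => ((hi i).sub (integrable_const _)).smul η
    exact (PiLp.continuousLinearEquiv 2 ℝ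
      fun _ : Fin m => Param D).symm.toContinuousLinearMap.integrable_comp e
  ext1 i
  have e := (PiLp.proj 2 (𝕜 := ℝ) (fun _ : Fin m => Param D) i).integral_comp_comm hN
  change (PiLp.proj 2 (𝕜 := ℝ) (fun _ : Fin m => Param D) i) (∫ z, tdNoise α η γ s μ θ z ∂μ) = _
  rw [← e]
  simp only [tdNoise, PiLp.proj_apply, PiLp.zero_apply]
  rw [integral_smul, integral_sub (hi i) (integrable_const _), integral_const]
  simp [tdMean]

end TDModel

omit [MeasurableSpace X] in
theorem tdIterate_succ_eq_tdStep (ε : ℝ) (θ₀ : Fin m → Param D) (z : ℕ → X × (ℝ × X)) (k : ℕ) :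
    tdIterate α η γ ε s θ₀ z (k + 1) = tdStep α η γ ε s (tdIterate α η γ ε s θ₀ z k) (z k) :=
  funext fun i => tdIterate_succ_eq α η γ ε s θ₀ z k i

/-- With high probability the accumulated noise is of the order of the square root of the number
of steps, at all times simultaneously and in the root mean square over the particles. -/
theorem TDModel.measure_exists_le_norm_sum_tdNoise_le [IsProbabilityMeasure μ]
    (h : TDModel s μ 𝒟 b₀ b₁ b₂ br) (hm : 0 < m) (hα : 0 < α) (hη : 0 < η) (hγ₀ : 0 < γ)
    (hγ₁ : γ < 1) (ε : ℝ) {Ω : Type*} [MeasurableSpace Ω] {P : Measure Ω} [IsProbabilityMeasure P]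
    {θ₀ : Fin m → Ω → Param D} {z : ℕ → Ω → X × (ℝ × X)} (hθ : ∀ i, Measurable (θ₀ i))
    (hz : ∀ k, Measurable (z k)) (hν : ∀ k, P.map (z k) = μ) (hi : iIndepFun z P)
    (hind : IndepFun (fun ω i => θ₀ i ω) (fun ω k => z k ω) P) {N : ℕ} (hN : 0 < N) {r : ℝ}
    (hr : 0 ≤ r) :
    P {ω | ∃ n ≤ N, √m * r ≤ ‖∑ k ∈ Finset.range n, tdNoise α η γ s μ
        (tdIterate α η γ ε s (fun i => θ₀ i ω) (fun j => z j ω) k) (z k ω)‖} ≤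
      ENNReal.ofReal (Real.exp (1 / 2 -
        r ^ 2 / (4 * (2 * (η * (α * (2 * α * b₀ + br) * b₁))) ^ 2 * N))) := by
  have h0 := h.pos₀
  have h1 := h.pos₁
  have hbr := h.posr
  have hm' : (0 : ℝ) < m := by exact_mod_cast hm
  have hN' : (0 : ℝ) < N := by exact_mod_cast hN
  have main := measure_exists_le_norm_sum_le (P := P)
    (Y := fun k ω => tdIterate α η γ ε s (fun i => θ₀ i ω) (fun j => z j ω) k)
    (z := z) (F := tdStep α η γ ε s) hz hi hν (measurable_pi_lambda _ hθ) hind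
    (h.measurable_tdStep ε) (fun n ω => tdIterate_succ_eq_tdStep ε _ _ n)
    (Ξ := tdNoise α η γ s μ) h.measurable_tdNoise
    (C := √m * (2 * (η * (α * (2 * α * b₀ + br) * b₁)))) (by positivity)
    (h.norm_tdNoise_le hm hα hη hγ₀ hγ₁) (h.integral_tdNoise hm hα hγ₀ hγ₁) hN
    (r := √m * r) (by positivity)
  have e : (√m * r) ^ 2 / (4 * (√m * (2 * (η * (α * (2 * α * b₀ + br) * b₁)))) ^ 2 * N) =
      r ^ 2 / (4 * (2 * (η * (α * (2 * α * b₀ + br) * b₁))) ^ 2 * N) := by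
    rw [mul_pow, mul_pow, Real.sq_sqrt hm'.le]
    field_simp
  rwa [e] at main

end Noise

/-! ### Coupling with the characteristics of the mean-field equation -/

/-- The discrete Grönwall inequality. -/
theorem le_mul_exp_of_le_add_sum {a : ℕ → ℝ} {W c : ℝ} (hW : 0 ≤ W) (hc : 0 ≤ c) {N : ℕ}
    (h : ∀ n ≤ N, a n ≤ W + ∑ k ∈ Finset.range n, c * a k) (n : ℕ) (hn : n ≤ N) :
    a n ≤ W * Real.exp (n * c) := by
  have key : ∀ n ≤ N, a n ≤ W * (1 + c) ^ n := by
    intro n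
    induction n using Nat.strong_induction_on with
    | _ n ih =>
      intro hn
      have hgeom : ∀ n : ℕ, W + ∑ k ∈ Finset.range n, c * (W * (1 + c) ^ k) = W * (1 + c) ^ n := by
        intro n
        induction n with
        | zero => simp
        | succ n ih => rw [Finset.sum_range_succ, ← add_assoc, ih]; ring
      rw [← hgeom]
      refine (h n hn).trans (add_le_add le_rfl (Finset.sum_le_sum fun k hk => ?_))
      have hk' := Finset.mem_range.1 hk
      exact mul_le_mul_of_nonneg_left (ih k hk' (by omega)) hc
  refine (key n hn).trans ?_
  rw [Real.exp_nat_mul]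
  gcongr
  linarith [Real.add_one_le_exp c]

/-- The mean of the norms of the blocks is at most the root mean square. -/
theorem sum_norm_le_sqrt_mul_norm {D m : ℕ} (S : PiLp 2 fun _ : Fin m => Param D) :
    ∑ i, ‖S i‖ ≤ √m * ‖S‖ := by
  rw [PiLp.norm_eq_of_L2, ← Real.sqrt_mul (Nat.cast_nonneg m)]
  refine Real.le_sqrt_of_sq_le ?_
  have := sq_sum_le_card_mul_sum_sq (s := (Finset.univ : Finset (Fin m))) (f := fun i => ‖S i‖)
  simpa using this

section Coupling

variable {X : Type*} [MeasurableSpace X] {D m : ℕ} {s : X → Param D → ℝ}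
  {μ : Measure (X × (ℝ × X))} {𝒟 : Measure X} [IsProbabilityMeasure μ] [IsProbabilityMeasure 𝒟]
  {b₀ b₁ b₂ br α η γ T : ℝ}

omit [IsProbabilityMeasure μ] in
/-- The error of the network against the mean-field limit splits into the distance of the
particles from their characteristics `Φ (θ₀ i)`, the deviation of an empirical average from its
mean, and the error `b₁ κ` with which the characteristics transport the initial law. -/
theorem TDModel.integral_abs_finiteQ_sub_le (h : TDModel s μ 𝒟 b₀ b₁ b₂ br) (hm : 0 < m)
    (hα : 0 < α) {ρ₀ ρ : Measure (Param D)} [IsProbabilityMeasure ρ₀] [IsProbabilityMeasure ρ]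
    {Φ : Param D → Param D} (hΦ : Continuous Φ) {κ : ℝ}
    (hκ : ∀ x, |∫ θ, s x θ ∂ρ - ∫ θ, s x (Φ θ) ∂ρ₀| ≤ b₁ * κ) (θ θ₀ : Fin m → Param D) :
    ∫ x, |finiteQ α s θ x - meanFieldQ α s ρ x| ∂𝒟 ≤
      α * (b₁ * ((1 / m : ℝ) * ∑ i, ‖θ i - Φ (θ₀ i)‖) +
        meanDeviation 𝒟 ρ₀ (fun x e => s x (Φ e)) θ₀ + b₁ * κ) := by
  have hm' : (0 : ℝ) < m := by exact_mod_cast hm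
  have hsΦ : Measurable (Function.uncurry fun x e => s x (Φ e)) :=
    h.measurable.comp (measurable_fst.prodMk (hΦ.measurable.comp measurable_snd))
  have hdev := (integrable_deviation (𝒟 := 𝒟) (ρ := ρ₀) hsΦ (fun x e => h.bound x _) θ₀).abs
  have hpt : ∀ x, |finiteQ α s θ x - meanFieldQ α s ρ x| ≤
      α * (b₁ * ((1 / m : ℝ) * ∑ i, ‖θ i - Φ (θ₀ i)‖) +
        |(1 / m : ℝ) * ∑ i, s x (Φ (θ₀ i)) - ∫ e, s x (Φ e) ∂ρ₀| + b₁ * κ) := by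
    intro x
    have e : finiteQ α s θ x - meanFieldQ α s ρ x =
        α * ((1 / m : ℝ) * ∑ i, (s x (θ i) - s x (Φ (θ₀ i))) +
          ((1 / m : ℝ) * ∑ i, s x (Φ (θ₀ i)) - ∫ e, s x (Φ e) ∂ρ₀) -
          (∫ θ, s x θ ∂ρ - ∫ θ, s x (Φ θ) ∂ρ₀)) := by
      rw [finiteQ, meanFieldQ, Finset.sum_sub_distrib]; ring
    rw [e, abs_mul, abs_of_pos hα]
    gcongr
    refine (abs_sub _ _).trans (add_le_add ((abs_add_le _ _).trans (add_le_add ?_ le_rfl)) (hκ x))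
    rw [abs_mul, abs_of_pos (by positivity), ← mul_assoc, mul_comm b₁, mul_assoc]
    gcongr
    refine (Finset.abs_sum_le_sum_abs _ _).trans ?_
    rw [Finset.mul_sum]
    exact Finset.sum_le_sum fun i _ => h.lip x _ _
  have hint : Integrable (fun x => |finiteQ α s θ x - meanFieldQ α s ρ x|) 𝒟 := by
    refine integrable_of_abs_le (c := 2 * (α * b₀)) ((h.measurable_finiteQ α θ).sub
      (h.measurable_meanFieldQ α ρ)).abs.aestronglyMeasurable fun x => ?_
    have h1 := abs_le.1 (h.abs_finiteQ_le hα hm θ x)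
    have h2 := abs_le.1 (h.abs_meanFieldQ_le hα ρ x)
    rw [abs_abs, abs_le]
    constructor <;> linarith
  have i1 : Integrable (fun x => b₁ * ((1 / m : ℝ) * ∑ i, ‖θ i - Φ (θ₀ i)‖) +
      |(1 / m : ℝ) * ∑ i, s x (Φ (θ₀ i)) - ∫ e, s x (Φ e) ∂ρ₀|) 𝒟 :=
    (integrable_const _).add hdev
  have i2 : Integrable (fun x => α * (b₁ * ((1 / m : ℝ) * ∑ i, ‖θ i - Φ (θ₀ i)‖) +
      |(1 / m : ℝ) * ∑ i, s x (Φ (θ₀ i)) - ∫ e, s x (Φ e) ∂ρ₀| + b₁ * κ)) 𝒟 :=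
    (i1.add (integrable_const _)).const_mul α
  refine (integral_mono hint i2 hpt).trans (le_of_eq ?_)
  rw [integral_const_mul]
  congr 1
  rw [integral_add i1 (integrable_const _), integral_add (integrable_const _) hdev]
  simp [meanDeviation]

/-- Propagation of chaos along one realization: if the deviations of the empirical averages along
the characteristics are at most `E` and the accumulated noise is at most `√m R`, the particles
stay close to the characteristics. -/
theorem TDModel.mean_norm_sub_le (h : TDModel s μ 𝒟 b₀ b₁ b₂ br) (hm : 0 < m) (hα : 0 < α)
    (hη : 0 < η) (hγ₀ : 0 < γ) (hγ₁ : γ < 1) {ρ : ℝ → ProbabilityMeasure (Param D)}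
    {ρ₀ : Measure (Param D)} [IsProbabilityMeasure ρ₀] {Φ : ℕ → Param D → Param D} (hΦ0 : Φ 0 = id)
    (hΦ : ∀ k, Continuous (Φ k)) {ε κ c E R : ℝ} (hε : 0 < ε) (hκ0 : 0 ≤ κ) (hc : 0 ≤ c)
    (hE0 : 0 ≤ E) (hR0 : 0 ≤ R) (hT : 0 ≤ T)
    (hstep : ∀ k : ℕ, (k + 1) * ε ≤ T → ∀ x, ‖Φ (k + 1) x - Φ k x -
      ε • (η • tdMean α γ s μ (meanFieldQ α s (ρ (k * ε))) (Φ k x))‖ ≤ ε ^ 2 * c)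
    (hκ : ∀ k : ℕ, k * ε ≤ T → ∀ x,
      |∫ θ, s x θ ∂(ρ (k * ε) : Measure (Param D)) - ∫ θ, s x (Φ k θ) ∂ρ₀| ≤ b₁ * κ)
    (θ₀ : Fin m → Param D) (z : ℕ → X × (ℝ × X)) {N : ℕ} (hN : N * ε ≤ T)
    (hE : ∀ k ≤ N, meanDeviation 𝒟 ρ₀ (fun x e => s x (Φ k e)) θ₀ ≤ E)
    (hR : ∀ n ≤ N, ‖∑ k ∈ Finset.range n, tdNoise α η γ s μ
      (tdIterate α η γ ε s θ₀ z k) (z k)‖ ≤ √m * R) (n : ℕ) (hn : n ≤ N) :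
    (1 / m : ℝ) * ∑ i, ‖tdIterate α η γ ε s θ₀ z n i - Φ n (θ₀ i)‖ ≤
      (T * (2 * η * α ^ 2 * b₁ * (E + b₁ * κ) + ε * c) + ε * R) *
        Real.exp (T * (η * (α * (2 * α * b₀ + br) * b₂ + 2 * α ^ 2 * b₁ ^ 2))) := by
  have hm' : (0 : ℝ) < m := by exact_mod_cast hm
  have h0 := h.pos₀
  have h1 := h.pos₁
  have h2 := h.pos₂
  have hbr := h.posr
  set th : ℕ → Fin m → Param D := tdIterate α η γ ε s θ₀ z with hth
  set K := α * (2 * α * b₀ + br) * b₂ with hK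
  have hK0 : 0 ≤ K := by positivity
  set a : ℕ → ℝ := fun n => (1 / m : ℝ) * ∑ i, ‖th n i - Φ n (θ₀ i)‖ with ha
  set G : ℕ → Fin m → Param D := fun k i =>
    tdMean α γ s μ (finiteQ α s (th k)) (th k i) -
      tdMean α γ s μ (meanFieldQ α s (ρ (k * ε))) (Φ k (θ₀ i)) with hG
  set r : ℕ → Fin m → Param D := fun k i => Φ (k + 1) (θ₀ i) - Φ k (θ₀ i) -
      ε • (η • tdMean α γ s μ (meanFieldQ α s (ρ (k * ε))) (Φ k (θ₀ i))) with hr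
  -- the difference of the two dynamics as accumulated drift difference, noise and Euler error
  have hdecomp : ∀ n i, th n i - Φ n (θ₀ i) = (ε * η) • ∑ k ∈ Finset.range n, G k i +
      ε • (∑ k ∈ Finset.range n, tdNoise α η γ s μ (th k) (z k)) i -
        ∑ k ∈ Finset.range n, r k i := by
    intro n i
    induction n with
    | zero => simp [hth, tdIterate, hΦ0]
    | succ n ih =>
      have e1 : th (n + 1) i = th n i + (η * ε) • tdDir α γ s (finiteQ α s (th n)) (z n) (th n i) :=
        tdIterate_succ_eq α η γ ε s θ₀ z n i
      have e2 : Φ (n + 1) (θ₀ i) = r n i + Φ n (θ₀ i) +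
          ε • (η • tdMean α γ s μ (meanFieldQ α s (ρ (n * ε))) (Φ n (θ₀ i))) := by
        simp only [hr]; abel
      have e3 : tdNoise α η γ s μ (th n) (z n) i =
          η • (tdDir α γ s (finiteQ α s (th n)) (z n) (th n i) -
            tdMean α γ s μ (finiteQ α s (th n)) (th n i)) := rfl
      have e4 : G n i = tdMean α γ s μ (finiteQ α s (th n)) (th n i) -
          tdMean α γ s μ (meanFieldQ α s (ρ (n * ε))) (Φ n (θ₀ i)) := rfl
      rw [Finset.sum_range_succ, Finset.sum_range_succ, Finset.sum_range_succ, PiLp.add_apply,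
        e3, e4, e1, e2]
      have e5 : th n i = (th n i - Φ n (θ₀ i)) + Φ n (θ₀ i) := by abel
      have e6 := ih
      generalize th n i - Φ n (θ₀ i) = δ at e5 e6
      generalize (∑ k ∈ Finset.range n, tdNoise α η γ s μ (th k) (z k)) i = S at e6 ⊢
      generalize tdDir α γ s (finiteQ α s (th n)) (z n) (th n i) = d
      generalize tdMean α γ s μ (finiteQ α s (th n)) (th n i) = u
      rw [e5, e6]
      module
  have hGb : ∀ k ≤ N, ∀ i, ‖G k i‖ ≤ K * ‖th k i - Φ k (θ₀ i)‖ +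
      2 * α * b₁ * (α * (b₁ * a k + E + b₁ * κ)) := by
    intro k hk i
    have hkT : (k : ℝ) * ε ≤ T := le_trans (by gcongr) hN
    have e : G k i = (tdMean α γ s μ (finiteQ α s (th k)) (th k i) -
        tdMean α γ s μ (finiteQ α s (th k)) (Φ k (θ₀ i))) +
        (tdMean α γ s μ (finiteQ α s (th k)) (Φ k (θ₀ i)) -
          tdMean α γ s μ (meanFieldQ α s (ρ (k * ε))) (Φ k (θ₀ i))) := by
      simp only [hG]; abel
    rw [e]
    refine (norm_add_le _ _).trans (add_le_add ?_ ?_)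
    · exact h.norm_tdMean_sub_le hα hγ₀ hγ₁ (h.measurable_finiteQ α _)
        (h.abs_finiteQ_le hα hm _) _ _
    · refine (h.norm_tdMean_sub_le_integral hα hγ₀ hγ₁ (h.measurable_finiteQ α _)
        (h.abs_finiteQ_le hα hm _) (h.measurable_meanFieldQ α _) (h.abs_meanFieldQ_le hα _)
        _).trans ?_
      gcongr
      refine (h.integral_abs_finiteQ_sub_le hm hα (hΦ k) (hκ k hkT) (th k) θ₀).trans ?_
      gcongr
      exact hE k hk
  have hsum : ∀ n ≤ N, a n ≤ (T * (2 * η * α ^ 2 * b₁ * (E + b₁ * κ) + ε * c) + ε * R) +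
      ∑ k ∈ Finset.range n, (ε * (η * (K + 2 * α ^ 2 * b₁ ^ 2))) * a k := by
    intro n hn
    have hnT : (n : ℝ) * ε ≤ T := le_trans (by gcongr) hN
    have hi : ∀ i, ‖th n i - Φ n (θ₀ i)‖ ≤
        (ε * η) * ∑ k ∈ Finset.range n, (K * ‖th k i - Φ k (θ₀ i)‖ +
          2 * α * b₁ * (α * (b₁ * a k + E + b₁ * κ))) +
        ε * ‖(∑ k ∈ Finset.range n, tdNoise α η γ s μ (th k) (z k)) i‖ +
        n * (ε ^ 2 * c) := by
      intro i
      rw [hdecomp n i]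
      refine (norm_sub_le _ _).trans (add_le_add ((norm_add_le _ _).trans (add_le_add ?_ ?_)) ?_)
      · rw [norm_smul, Real.norm_of_nonneg (by positivity)]
        gcongr
        refine (norm_sum_le _ _).trans (Finset.sum_le_sum fun k hk => hGb k ?_ i)
        have := Finset.mem_range.1 hk
        omega
      · rw [norm_smul, Real.norm_of_nonneg hε.le]
      · refine (norm_sum_le _ _).trans ?_
        refine (Finset.sum_le_card_nsmul _ _ (ε ^ 2 * c) fun k hk => ?_).trans (by simp)
        refine hstep k (le_trans ?_ hnT) _
        have : (k : ℝ) + 1 ≤ n := by exact_mod_cast Finset.mem_range.1 hk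
        gcongr
    have hS := (sum_norm_le_sqrt_mul_norm (∑ k ∈ Finset.range n,
      tdNoise α η γ s μ (th k) (z k))).trans
        (mul_le_mul_of_nonneg_left (hR n hn) (Real.sqrt_nonneg m))
    rw [← mul_assoc, Real.mul_self_sqrt hm'.le] at hS
    have hA : a n ≤ (1 / m : ℝ) * ∑ i, ((ε * η) * ∑ k ∈ Finset.range n,
        (K * ‖th k i - Φ k (θ₀ i)‖ + 2 * α * b₁ * (α * (b₁ * a k + E + b₁ * κ))) +
        ε * ‖(∑ k ∈ Finset.range n, tdNoise α η γ s μ (th k) (z k)) i‖ +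
        n * (ε ^ 2 * c)) := by
      simp only [ha]
      gcongr with i
      exact hi i
    have hB : (1 / m : ℝ) * ∑ i, ((ε * η) * ∑ k ∈ Finset.range n,
        (K * ‖th k i - Φ k (θ₀ i)‖ + 2 * α * b₁ * (α * (b₁ * a k + E + b₁ * κ))) +
        ε * ‖(∑ k ∈ Finset.range n, tdNoise α η γ s μ (th k) (z k)) i‖ +
        n * (ε ^ 2 * c)) =
        (ε * η) * ∑ k ∈ Finset.range n, (K * a k + 2 * α * b₁ * (α * (b₁ * a k + E + b₁ * κ))) +
        ε * ((1 / m : ℝ) * ∑ i, ‖(∑ k ∈ Finset.range n, tdNoise α η γ s μ (th k) (z k)) i‖) +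
        n * (ε ^ 2 * c) := by
      have hcst : ∀ t : ℝ, (1 / m : ℝ) * ∑ _i : Fin m, t = t := fun t => by
        rw [Finset.sum_const, Finset.card_univ, Fintype.card_fin, nsmul_eq_mul]; field_simp
      rw [Finset.sum_add_distrib, Finset.sum_add_distrib, mul_add, mul_add, hcst,
        ← Finset.mul_sum, ← Finset.mul_sum, Finset.sum_comm]
      congr 1
      congr 1
      · rw [mul_left_comm, Finset.mul_sum]
        congr 1
        refine Finset.sum_congr rfl fun k _ => ?_
        rw [Finset.sum_add_distrib, mul_add, hcst, ← Finset.mul_sum]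
        simp only [ha]
        ring
      · ring
    have hC : (1 / m : ℝ) * ∑ i, ‖(∑ k ∈ Finset.range n, tdNoise α η γ s μ (th k) (z k)) i‖ ≤ R := by
      rw [div_mul_eq_mul_div, one_mul, div_le_iff₀ hm']
      linarith
    have hD : (ε * η) * ∑ k ∈ Finset.range n,
        (K * a k + 2 * α * b₁ * (α * (b₁ * a k + E + b₁ * κ))) =
        n * ε * (2 * η * α ^ 2 * b₁ * (E + b₁ * κ)) +
          ∑ k ∈ Finset.range n, (ε * (η * (K + 2 * α ^ 2 * b₁ ^ 2))) * a k := by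
      have e : (n : ℝ) * ε * (2 * η * α ^ 2 * b₁ * (E + b₁ * κ)) =
          ∑ _k ∈ Finset.range n, ε * (2 * η * α ^ 2 * b₁ * (E + b₁ * κ)) := by
        rw [Finset.sum_const, Finset.card_range, nsmul_eq_mul, mul_assoc]
      rw [e, ← Finset.sum_add_distrib, Finset.mul_sum]
      exact Finset.sum_congr rfl fun k _ => by ring
    rw [hB, hD] at hA
    have hF : n * ε * (2 * η * α ^ 2 * b₁ * (E + b₁ * κ) + ε * c) ≤
        T * (2 * η * α ^ 2 * b₁ * (E + b₁ * κ) + ε * c) := by gcongr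
    have hH := mul_le_mul_of_nonneg_left hC hε.le
    nlinarith
  have := le_mul_exp_of_le_add_sum (by positivity) (by positivity) hsum n hn
  refine this.trans ?_
  gcongr _ * Real.exp ?_
  rw [← mul_assoc]
  have hnT : (n : ℝ) * ε ≤ T := le_trans (by gcongr) hN
  gcongr

end Coupling

/-- The squared errors of two bounded functions differ by at most a multiple of their
`L¹`-distance. -/
theorem integral_sq_sub_le_add {X : Type*} [MeasurableSpace X] {𝒟 : Measure X}
    [IsProbabilityMeasure 𝒟] {f g q : X → ℝ} (hf : Measurable f) (hg : Measurable g)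
    (hq : Measurable q) {b c : ℝ} (hfb : ∀ x, |f x| ≤ b) (hgb : ∀ x, |g x| ≤ b)
    (hqb : ∀ x, |q x| ≤ c) :
    ∫ x, (f x - q x) ^ 2 ∂𝒟 ≤ ∫ x, (g x - q x) ^ 2 ∂𝒟 + 2 * (b + c) * ∫ x, |f x - g x| ∂𝒟 := by
  have hsq : ∀ {u : X → ℝ}, Measurable u → (∀ x, |u x| ≤ b) →
      Integrable (fun x => (u x - q x) ^ 2) 𝒟 := fun {u} hu hub => by
    refine integrable_of_abs_le (c := (b + c) ^ 2)
      ((hu.sub hq).pow_const 2).aestronglyMeasurable fun x => ?_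
    rw [abs_pow]
    gcongr
    exact (abs_sub _ _).trans (add_le_add (hub x) (hqb x))
  have hab : Integrable (fun x => |f x - g x|) 𝒟 :=
    integrable_of_abs_le (c := b + b) (hf.sub hg).abs.aestronglyMeasurable fun x => by
      rw [abs_abs]; exact (abs_sub _ _).trans (add_le_add (hfb x) (hgb x))
  rw [← integral_const_mul, ← integral_add (hsq hg hgb) (hab.const_mul _)]
  refine integral_mono (hsq hf hfb) ((hsq hg hgb).add (hab.const_mul _)) fun x => ?_
  have e : (f x - q x) ^ 2 = (g x - q x) ^ 2 + (f x + g x - 2 * q x) * (f x - g x) := by ring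
  have h1 : |f x + g x - 2 * q x| ≤ 2 * (b + c) := by
    have := abs_le.1 (hfb x)
    have := abs_le.1 (hgb x)
    have := abs_le.1 (hqb x)
    rw [abs_le]
    constructor <;> linarith
  have h2 : (f x + g x - 2 * q x) * (f x - g x) ≤ 2 * (b + c) * |f x - g x| :=
    (le_abs_self _).trans (by rw [abs_mul]; gcongr)
  change (f x - q x) ^ 2 ≤ (g x - q x) ^ 2 + 2 * (b + c) * |f x - g x|
  linarith

/-! ### The high-probability estimate -/

/-- The condition `2 ≤ m ∨ δ ≤ 1 / 2` keeps `log (m / δ)` away from zero, so that it dominates the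
exponents of the tail bounds. -/
theorem half_le_log_div_and_le {m : ℕ} {δ : ℝ} (hm : 1 ≤ m) (hδ : 0 < δ)
    (hδ1 : δ ≤ 1) (hmδ : 2 ≤ m ∨ δ ≤ 1 / 2) :
    1 / 2 ≤ Real.log (m / δ) ∧ 1 / 2 + Real.log (2 / δ) ≤ 3 * Real.log (m / δ) := by
  have hm0 : (1 : ℝ) ≤ m := by exact_mod_cast hm
  have hl2 : (1 : ℝ) / 2 < Real.log 2 := by linarith [Real.log_two_gt_d9]
  have hlm : 0 ≤ Real.log m := Real.log_nonneg hm0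
  rw [Real.log_div (by positivity) hδ.ne', Real.log_div (by norm_num) hδ.ne']
  rcases hmδ with h | h
  · have h2 : Real.log 2 ≤ Real.log m := Real.log_le_log (by norm_num) (by exact_mod_cast h)
    have := Real.log_nonpos hδ.le hδ1
    constructor <;> linarith
  · have h2 : Real.log δ ≤ -Real.log 2 := by
      rw [← Real.log_inv]
      exact Real.log_le_log hδ (by norm_num; linarith)
    constructor <;> linarith

/-- The error terms of the two tail bounds and of the time discretization, in terms of the rates
of the final estimate. -/
theorem rates_le {m ε T D Λ lam b G : ℝ} {N : ℕ} (hm : 0 < m) (hε : 0 < ε) (hε1 : ε ≤ 1)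
    (hT : 0 ≤ T) (hD : 0 ≤ D) (hΛ : 1 / 2 ≤ Λ) (hlam0 : 0 ≤ lam) (hlamΛ : lam ≤ 3 * Λ)
    (hNT : N * ε ≤ T) (hb0 : 0 < b) (hG0 : 0 < G) :
    4 * b * √(lam / m) ≤ 8 * b * √(Λ / m) ∧ √ε ≤ 2 * √(ε * (D + Λ)) ∧
      ε ≤ 2 * √(ε * (D + Λ)) ∧
      ε * (4 * G * √((N + 1 : ℕ) * lam)) ≤ 8 * G * (1 + T) * √(ε * (D + Λ)) := by
  have hΛ0 : 0 ≤ Λ := by linarith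
  have hκw : √ε ≤ 2 * √(ε * (D + Λ)) := by
    rw [Real.sqrt_le_left (by positivity), mul_pow, Real.sq_sqrt (by positivity)]
    nlinarith
  refine ⟨?_, hκw, le_trans (Real.le_sqrt_of_sq_le (by nlinarith)) hκw, ?_⟩
  · have : √(lam / m) ≤ 2 * √(Λ / m) := by
      rw [Real.sqrt_le_left (by positivity), mul_pow, Real.sq_sqrt (by positivity),
        ← mul_div_assoc]
      gcongr
      linarith
    calc 4 * b * √(lam / m) ≤ 4 * b * (2 * √(Λ / m)) := by gcongr
      _ = _ := by ring
  · have : ε * √((N + 1 : ℕ) * lam) ≤ 2 * (1 + T) * √(ε * (D + Λ)) := by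
      have e : ε * √((N + 1 : ℕ) * lam) = √(ε ^ 2 * ((N + 1 : ℕ) * lam)) := by
        rw [Real.sqrt_mul (sq_nonneg ε), Real.sqrt_sq hε.le]
      rw [e, Real.sqrt_le_left (by positivity), mul_pow, Real.sq_sqrt (by positivity)]
      have f1 : (N + 1 : ℕ) * ε ≤ 1 + T := by push_cast; linarith
      have f2 : 3 * (1 + T) ≤ (2 * (1 + T)) ^ 2 := by nlinarith
      calc ε ^ 2 * ((N + 1 : ℕ) * lam) = ε * (((N + 1 : ℕ) * ε) * lam) := by ring
        _ ≤ ε * ((1 + T) * (3 * (D + Λ))) := by gcongr; linarith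
        _ = (3 * (1 + T)) * (ε * (D + Λ)) := by ring
        _ ≤ (2 * (1 + T)) ^ 2 * (ε * (D + Λ)) := by gcongr
    calc ε * (4 * G * √((N + 1 : ℕ) * lam)) = 4 * G * (ε * √((N + 1 : ℕ) * lam)) := by ring
      _ ≤ 4 * G * (2 * (1 + T) * √(ε * (D + Λ))) := by gcongr
      _ = _ := by ring

/-- Collecting the error terms: all of them are multiples of the rates `u` and `w`, and the
polynomial dependence on the horizon is absorbed in the exponential. -/
theorem collect_errors_le {α b₁ p b c G Γ T u w r₁ ε κ r₂ a e : ℝ} (hα : 0 < α) (h1 : 0 < b₁)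
    (hp0 : 0 < p) (hb0 : 0 < b) (hc0 : 0 < c) (hG0 : 0 < G) (hΓ0 : 0 < Γ) (hT : 0 ≤ T)
    (hu0 : 0 ≤ u) (hw0 : 0 ≤ w) (hr₁u : r₁ ≤ 8 * b * u) (hκw : κ ≤ 2 * w) (hεw : ε ≤ 2 * w)
    (hRw : ε * r₂ ≤ 8 * G * (1 + T) * w)
    (ha : a ≤ (T * (p * ((1 + T) * r₁ + b₁ * κ) + ε * c) + ε * r₂) * Real.exp (T * Γ))
    (he : e ≤ (1 + T) * r₁) :
    α * (b₁ * a + e + b₁ * κ) ≤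
      α * (b₁ * (8 * p * b + 2 * p * b₁ + 2 * c + 8 * G) + 8 * b + 2 * b₁) *
        Real.exp ((Γ + 2) * T) * (u + w) := by
  set S := 1 + T with hS
  have hS1 : 1 ≤ S := by linarith
  have hTS : T ≤ S := by linarith
  have hE1 : 1 ≤ Real.exp (T * Γ) := Real.one_le_exp (by positivity)
  have hSS : S ≤ S ^ 2 := by nlinarith
  have hW : T * (p * (S * r₁ + b₁ * κ) + ε * c) + ε * r₂ ≤
      S ^ 2 * ((8 * p * b + 2 * p * b₁ + 2 * c + 8 * G) * (u + w)) := by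
    have f1 : T * (p * (S * r₁ + b₁ * κ) + ε * c) ≤
        S * (p * (S * (8 * b * u) + b₁ * (2 * w)) + 2 * w * c) := by
      have f2 : p * (S * r₁ + b₁ * κ) + ε * c ≤
          p * (S * (8 * b * u) + b₁ * (2 * w)) + 2 * w * c := by gcongr
      exact (mul_le_mul_of_nonneg_left f2 hT).trans
        (mul_le_mul_of_nonneg_right hTS (by positivity))
    calc T * (p * (S * r₁ + b₁ * κ) + ε * c) + ε * r₂
        ≤ S * (p * (S * (8 * b * u) + b₁ * (2 * w)) + 2 * w * c) + 8 * G * S * w := add_le_add f1 hRw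
      _ = S ^ 2 * (8 * p * b * u) + S * ((2 * p * b₁ + 2 * c + 8 * G) * w) := by ring
      _ ≤ S ^ 2 * (8 * p * b * u) + S ^ 2 * ((2 * p * b₁ + 2 * c + 8 * G) * w) := by gcongr
      _ ≤ S ^ 2 * (8 * p * b * (u + w)) +
          S ^ 2 * ((2 * p * b₁ + 2 * c + 8 * G) * (u + w)) := by gcongr <;> linarith
      _ = _ := by ring
  calc _ ≤ α * (b₁ * (S ^ 2 * ((8 * p * b + 2 * p * b₁ + 2 * c + 8 * G) * (u + w)) *
          Real.exp (T * Γ)) + S * (8 * b * u) + b₁ * (2 * w)) := by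
        gcongr
        · exact ha.trans (by gcongr)
        · exact he.trans (by gcongr)
    _ ≤ α * (b₁ * (S ^ 2 * ((8 * p * b + 2 * p * b₁ + 2 * c + 8 * G) * (u + w)) *
          Real.exp (T * Γ)) + S ^ 2 * (8 * b * (u + w)) * Real.exp (T * Γ) +
            S ^ 2 * (b₁ * (2 * (u + w))) * Real.exp (T * Γ)) := by
        refine mul_le_mul_of_nonneg_left (add_le_add (add_le_add le_rfl ?_) ?_) hα.le
        · calc S * (8 * b * u) ≤ S ^ 2 * (8 * b * (u + w)) := by gcongr; linarith
            _ ≤ _ := le_mul_of_one_le_right (by positivity) hE1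
        · calc b₁ * (2 * w) ≤ 1 * (b₁ * (2 * (u + w))) := by
                rw [one_mul]; gcongr; linarith
            _ ≤ S ^ 2 * (b₁ * (2 * (u + w))) := by gcongr; linarith
            _ ≤ _ := le_mul_of_one_le_right (by positivity) hE1
    _ = α * (b₁ * (8 * p * b + 2 * p * b₁ + 2 * c + 8 * G) + 8 * b + 2 * b₁) *
          (S ^ 2 * Real.exp (T * Γ)) * (u + w) := by ring
    _ ≤ α * (b₁ * (8 * p * b + 2 * p * b₁ + 2 * c + 8 * G) + 8 * b + 2 * b₁) *
          Real.exp ((Γ + 2) * T) * (u + w) := by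
        gcongr
        have e : Real.exp ((Γ + 2) * T) = Real.exp T ^ 2 * Real.exp (T * Γ) := by
          rw [← Real.exp_nat_mul, ← Real.exp_add]; congr 1; push_cast; ring
        rw [e]
        gcongr
        linarith [Real.add_one_le_exp T]

/-- With probability at least `1 - δ` the network stays close to the mean-field limit in `L¹(𝒟)`
at all times of the horizon, with constants that do not depend on the dimension. -/
theorem TDModel.exists_const_measure_le {α η b₀ b₁ b₂ br : ℝ} (hα : 0 < α) (hη : 0 < η)
    (h0 : 0 < b₀) (h1 : 0 < b₁) (h2 : 0 < b₂) (hbr : 0 < br) :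
    ∃ C Γ : ℝ, 0 ≤ C ∧ 0 ≤ Γ ∧
      ∀ {X : Type*} [MeasurableSpace X] {D m : ℕ} {s : X → Param D → ℝ}
        {μ : Measure (X × (ℝ × X))} {𝒟 : Measure X} [IsProbabilityMeasure μ]
        [IsProbabilityMeasure 𝒟] {γ T ε δ : ℝ}, TDModel s μ 𝒟 b₀ b₁ b₂ br → 0 < γ → γ < 1 →
      0 ≤ T → 1 ≤ m → 0 < ε → ε ≤ 1 → 0 < δ → δ < 1 → (2 ≤ m ∨ δ ≤ 1 / 2) →
      ∀ {ρ₀ : ProbabilityMeasure (Param D)} {ρ : ℝ → ProbabilityMeasure (Param D)},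
        IsPDESolution α η γ T s μ ρ₀ ρ →
      ∀ {Ω : Type*} [MeasurableSpace Ω] {P : Measure Ω} [IsProbabilityMeasure P]
        {θ₀ : Fin m → Ω → Param D} {z : ℕ → Ω → X × (ℝ × X)},
        (∀ i, Measurable (θ₀ i)) → (∀ k, Measurable (z k)) →
        (∀ i, P.map (θ₀ i) = ρ₀) → (∀ k, P.map (z k) = μ) →
        iIndepFun θ₀ P → iIndepFun z P →
        IndepFun (fun ω i => θ₀ i ω) (fun ω k => z k ω) P →
      ∃ bad : Set Ω, P bad ≤ ENNReal.ofReal δ ∧ ∀ ω ∉ bad, ∀ k : ℕ, (k : ℝ) ≤ T / ε →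
        ∫ x, |finiteQ α s (tdIterate α η γ ε s (fun i => θ₀ i ω) (fun j => z j ω) k) x -
            meanFieldQ α s (ρ (k * ε)) x| ∂𝒟 ≤
          C * Real.exp (Γ * T) *
            (√(Real.log (m / δ) / m) + √(ε * (D + Real.log (m / δ)))) := by
  -- bounds for the velocity of the particles, for its Lipschitz constants and for the deviations
  set G := η * (α * (2 * α * b₀ + br) * b₁) with hG
  set c := η * (α * (2 * α * b₀ + br) * b₂) * G + η * (2 * α * b₁) * (α * b₁ * G) with hc
  set b := b₀ + b₁ * G with hb
  set p := 2 * η * α ^ 2 * b₁ with hp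
  set Γ := η * (α * (2 * α * b₀ + br) * b₂ + 2 * α ^ 2 * b₁ ^ 2) with hΓ
  have hG0 : 0 < G := by positivity
  have hc0 : 0 < c := by positivity
  have hb0 : 0 < b := by positivity
  have hp0 : 0 < p := by positivity
  have hΓ0 : 0 < Γ := by positivity
  refine ⟨α * (b₁ * (8 * p * b + 2 * p * b₁ + 2 * c + 8 * G) + 8 * b + 2 * b₁), Γ + 2,
    by positivity, by positivity, ?_⟩
  intro X _ D m s μ 𝒟 _ _ γ T ε δ h hγ₀ hγ₁ hT hm hε hε1 hδ hδ1 hmδ ρ₀ ρ hρ Ω _ P _ θ₀ z hθ hz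
    hθlaw hzlaw hθi hzi hind
  have hm' : (0 : ℝ) < m := by exact_mod_cast hm
  obtain ⟨hΛ, hlamΛ⟩ := half_le_log_div_and_le hm hδ hδ1.le hmδ
  have hlam0 : 0 ≤ 1 / 2 + Real.log (2 / δ) := by
    have : 0 ≤ Real.log (2 / δ) := Real.log_nonneg (by rw [le_div_iff₀ hδ]; linarith)
    linarith
  set Λ := Real.log (m / δ) with hΛdef
  set lam := 1 / 2 + Real.log (2 / δ) with hlam
  set N := ⌊T / ε⌋₊ with hN
  have hNT : N * ε ≤ T := by
    have := Nat.floor_le (a := T / ε) (by positivity)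
    rwa [le_div_iff₀ hε] at this
  have htr := h.isTransport hα hη hγ₀ hγ₁ hρ
  obtain ⟨Φ, hΦ0, hΦc, hΦM, hΦs, hΦκ⟩ := htr.exists_flow (by positivity)
    (L' := η * (2 * α * b₁) * (α * b₁ * G)) (by positivity)
    (h.norm_field_sub_le hα hη hγ₀ hγ₁ hρ) hT hε (κ := √ε) (by positivity)
  rw [hρ.initial] at hΦκ
  -- the exponent of both tail bounds is `-log (2 / δ)`
  have hexp : ENNReal.ofReal (Real.exp (1 / 2 - lam)) = ENNReal.ofReal (δ / 2) := by
    rw [hlam, sub_add_cancel_left, ← Real.log_inv, Real.exp_log (by positivity), inv_div]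
  set r₁ := 4 * b * √(lam / m) with hr₁
  set r₂ := 4 * G * √((N + 1 : ℕ) * lam) with hr₂
  have hN1 : (0 : ℝ) < (N + 1 : ℕ) := by positivity
  have hdev := measure_exists_le_meanDeviation_le (𝒟 := 𝒟) (P := P)
    (ρ := (ρ₀ : Measure (Param D))) hm hθ hθlaw hθi (f := fun k x e => s x (Φ k e))
    (fun k => h.measurable.comp (measurable_fst.prodMk ((hΦc k).measurable.comp measurable_snd)))
    hb0 hε (fun x e => (h.bound x _).trans (by rw [hb]; nlinarith [mul_pos h1 hG0]))
    (fun k x e => (h.lip x _ _).trans (by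
      calc b₁ * ‖Φ (k + 1) e - Φ k e‖ ≤ b₁ * (ε * G) := by gcongr; exact hΦM k e
        _ ≤ ε * b := by rw [hb]; nlinarith [mul_pos hε h0])) N (r := r₁) (by positivity)
  have hnoise := h.measure_exists_le_norm_sum_tdNoise_le hm hα hη hγ₀ hγ₁ ε hθ hz hzlaw hzi hind
    (N := N + 1) (by omega) (r := r₂) (by positivity)
  have e1 : m * r₁ ^ 2 / (16 * b ^ 2) = lam := by
    rw [hr₁, mul_pow, Real.sq_sqrt (by positivity)]; field_simp; ring
  have e2 : r₂ ^ 2 / (4 * (2 * G) ^ 2 * (N + 1 : ℕ)) = lam := by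
    rw [hr₂, mul_pow, Real.sq_sqrt (by positivity)]; field_simp; ring
  rw [e1, hexp] at hdev
  rw [e2, hexp] at hnoise
  refine ⟨_, (measure_union_le _ _).trans ((add_le_add hdev hnoise).trans (le_of_eq ?_)), ?_⟩
  · rw [← ENNReal.ofReal_add (by positivity) (by positivity), add_halves]
  intro ω hω k hk
  rw [Set.mem_union, not_or] at hω
  obtain ⟨hω1, hω2⟩ := hω
  simp only [Set.mem_ofPred_eq, not_exists, not_and, not_le] at hω1 hω2
  have hkN : k ≤ N := Nat.le_floor hk
  have hkT : (k : ℝ) * ε ≤ T := by rwa [le_div_iff₀ hε] at hk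
  have hκs : ∀ k : ℕ, k * ε ≤ T → ∀ x, |∫ θ, s x θ ∂(ρ (k * ε) : Measure (Param D)) -
      ∫ θ, s x (Φ k θ) ∂(ρ₀ : Measure (Param D))| ≤ b₁ * √ε := fun k hk x =>
    hΦκ k hk b₁ h1.le (s x) (h.lip x) ⟨b₀, h.bound x⟩
  have hE : ∀ k ≤ N, meanDeviation 𝒟 (ρ₀ : Measure (Param D)) (fun x e => s x (Φ k e))
      (fun i => θ₀ i ω) ≤ (1 + T) * r₁ := fun k hk => (hω1 k hk).le.trans (by gcongr)
  have hmean := h.mean_norm_sub_le hm hα hη hγ₀ hγ₁ (ρ₀ := (ρ₀ : Measure (Param D))) hΦ0 hΦc hε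
    (Real.sqrt_nonneg ε) hc0.le (E := (1 + T) * r₁) (R := r₂) (by positivity) (by positivity) hT
    hΦs hκs (fun i => θ₀ i ω) (fun j => z j ω) hNT hE
    (fun n hn => (hω2 n (by omega)).le) k hkN
  have hL1 := h.integral_abs_finiteQ_sub_le (𝒟 := 𝒟) hm hα (hΦc k) (hκs k hkT)
    (tdIterate α η γ ε s (fun i => θ₀ i ω) (fun j => z j ω) k) (fun i => θ₀ i ω)
  refine hL1.trans ?_
  -- all error terms are multiples of the two rates `u` and `w`
  set u := √(Λ / m) with hu
  set w := √(ε * (D + Λ)) with hw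
  have hu0 : 0 ≤ u := Real.sqrt_nonneg _
  have hw0 : 0 ≤ w := Real.sqrt_nonneg _
  have hD : (0 : ℝ) ≤ D := Nat.cast_nonneg D
  obtain ⟨hr₁u, hκw, hεw, hRw⟩ := rates_le (N := N) hm' hε hε1 hT hD hΛ hlam0 hlamΛ hNT hb0 hG0
  exact collect_errors_le hα h1 hp0 hb0 hc0 hG0 hΓ0 hT hu0 hw0 hr₁u hκw hεw hRw hmean (hE k hkN)

/-! ### The Markov decision process -/

theorem lip_gradient_of_hessianFrobenius_le {D : ℕ} {f : Param D → ℝ} {c : ℝ}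
    (hd : Differentiable ℝ (gradient f)) (h : ∀ θ, hessianFrobenius f θ ≤ c) (θ θ' : Param D) :
    ‖gradient f θ - gradient f θ'‖ ≤ c * ‖θ - θ'‖ := by
  refine Convex.norm_image_sub_le_of_norm_fderiv_le (𝕜 := ℝ) (fun z _ => hd z) (fun z _ => ?_)
    convex_univ (Set.mem_univ θ') (Set.mem_univ θ)
  refine le_trans ?_ (h z)
  -- the operator norm is at most the Frobenius norm, by the Cauchy–Schwarz inequality
  refine ContinuousLinearMap.opNorm_le_bound _ (Real.sqrt_nonneg _) fun u => ?_
  have hu : u = ∑ i, u i • EuclideanSpace.single i (1 : ℝ) := by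
    conv_lhs => rw [← (EuclideanSpace.basisFun (Fin D) ℝ).sum_repr u]
    simp
  conv_lhs => rw [hu, map_sum]
  refine (norm_sum_le _ _).trans ?_
  simp_rw [map_smul, norm_smul]
  rw [hessianFrobenius, EuclideanSpace.norm_eq, mul_comm]
  exact Real.sum_mul_le_sqrt_mul_sqrt _ _ _

section Sample

variable {𝒮 𝒜 : Type*} [MeasurableSpace 𝒮] [MeasurableSpace 𝒜] {P : Kernel (𝒮 × 𝒜) 𝒮}
  {R : Kernel (𝒮 × 𝒜) ℝ} {π : Kernel 𝒮 𝒜} {𝒟 : Measure (𝒮 × 𝒜)} [IsMarkovKernel P]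
  [IsMarkovKernel R] [IsMarkovKernel π] [IsProbabilityMeasure 𝒟]

instance : IsMarkovKernel (pairKernel P π) := by unfold pairKernel; infer_instance

instance : IsMarkovKernel (sampleKernel P R π) := by unfold sampleKernel; infer_instance

instance : IsProbabilityMeasure (sampleLaw P R π 𝒟) := by unfold sampleLaw; infer_instance

theorem map_fst_sampleLaw : (sampleLaw P R π 𝒟).map Prod.fst = 𝒟 :=
  Measure.fst_compProd 𝒟 (sampleKernel P R π)

/-- By stationarity the next state-action pair has the same law as the present one. -/
theorem map_next_sampleLaw (h : Kernel.Invariant (pairKernel P π) 𝒟) :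
    (sampleLaw P R π 𝒟).map (fun z => z.2.2) = 𝒟 := by
  have e1 : (sampleLaw P R π 𝒟).map (fun z => z.2.2) = ((sampleLaw P R π 𝒟).snd).map Prod.snd := by
    rw [Measure.snd, Measure.map_map measurable_snd measurable_snd]; rfl
  have e2 : (sampleKernel P R π).snd = pairKernel P π := Kernel.snd_prod _ _
  rw [e1, sampleLaw, Measure.snd_compProd, Measure.map_comp _ _ measurable_snd, ← Kernel.snd_eq, e2]
  exact h

theorem ae_abs_reward_le {Br : ℝ} (h : ∀ x, ∀ᵐ r ∂(R x), |r| ≤ Br) :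
    ∀ᵐ z ∂(sampleLaw P R π 𝒟), |z.2.1| ≤ Br := by
  have hm : MeasurableSet {z : (𝒮 × 𝒜) × (ℝ × (𝒮 × 𝒜)) | |z.2.1| ≤ Br} :=
    measurableSet_le (by fun_prop) measurable_const
  rw [sampleLaw, Measure.ae_compProd_iff hm]
  refine Filter.Eventually.of_forall fun x => ?_
  rw [sampleKernel, Kernel.prod_apply]
  exact Measure.quasiMeasurePreserving_fst.ae (h x)

end Sample

/-- The assumptions on the Markov decision process and on the activation function give an abstract
model. The constants are enlarged to make them positive. -/
theorem ActivationBounds.tdModel {d₁ d₂ D : ℕ} {S : Set (EuclideanSpace ℝ (Fin d₁))}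
    {A : Set (EuclideanSpace ℝ (Fin d₂))} {P : Kernel (S × A) S} {R : Kernel (S × A) ℝ}
    {π : Kernel S A} {𝒟 : Measure (S × A)} [IsMarkovKernel P] [IsMarkovKernel R]
    [IsMarkovKernel π] [IsProbabilityMeasure 𝒟] (hinv : Kernel.Invariant (pairKernel P π) 𝒟)
    {σ : Ambient d₁ d₂ → Param D → ℝ} (hσ : Measurable (Function.uncurry σ))
    (hx : ∀ x : S × A, ‖pairPoint x‖ ≤ 1) {B₀ B₁ B₂ Br : ℝ} (h : ActivationBounds S A σ B₀ B₁ B₂)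
    (hr : ∀ x : S × A, ∀ᵐ r ∂(R x), |r| ≤ Br) :
    TDModel (fun (x : S × A) θ => σ (pairPoint x) θ) (sampleLaw P R π 𝒟) 𝒟
      (|B₀| + 1) (|B₁| + 1) (|B₂| + 1) (|Br| + 1) where
  measurable := by
    have hp : Measurable (pairPoint : S × A → Ambient d₁ d₂) :=
      (WithLp.measurable_toLp 2 _).comp
        ((measurable_subtype_coe.comp measurable_fst).prodMk
          (measurable_subtype_coe.comp measurable_snd))
    exact hσ.comp ((hp.comp measurable_fst).prodMk measurable_snd)
  differentiable := h.differentiable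
  bound x θ := (h.bound_value x θ).trans (by linarith [le_abs_self B₀])
  bound_gradient x θ := by
    refine (h.bound_gradient x θ).trans ?_
    nlinarith [le_abs_self B₁, abs_nonneg B₁, norm_nonneg (pairPoint x), hx x]
  lip_gradient x θ θ' := by
    refine lip_gradient_of_hessianFrobenius_le (h.differentiable_gradient x) (fun θ => ?_) θ θ'
    refine (h.bound_hessian x θ).trans ?_
    have h1 : ‖pairPoint x‖ ^ 2 ≤ 1 := pow_le_one₀ (norm_nonneg _) (hx x)
    nlinarith [le_abs_self B₂, abs_nonneg B₂, sq_nonneg ‖pairPoint x‖]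
  bound_reward := by
    filter_upwards [ae_abs_reward_le (P := P) (π := π) (𝒟 := 𝒟) hr] with z hz
    linarith [le_abs_self Br]
  map_fst := map_fst_sampleLaw
  map_next := map_next_sampleLaw hinv
  pos₀ := by positivity
  pos₁ := by positivity
  pos₂ := by positivity
  posr := by positivity

theorem mainTheorem6 (α η γ B₀ B₁ B₂ Br : ℝ) (hα : 0 < α) (hη : 0 < η)
    (hγ₀ : 0 < γ) (hγ₁ : γ < 1) :
    ∃ B : ℝ, 0 < B ∧
      ∀ (d₁ d₂ D : ℕ) (S : Set (EuclideanSpace ℝ (Fin d₁)))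
        (A : Set (EuclideanSpace ℝ (Fin d₂)))
        -- the Markov decision process, the policy and its stationary distribution
        (P : Kernel (S × A) S) (R : Kernel (S × A) ℝ) (π : Kernel S A) (𝒟 : Measure (S × A))
        [IsMarkovKernel P] [IsMarkovKernel R] [IsMarkovKernel π] [IsProbabilityMeasure 𝒟],
        Kernel.Invariant (pairKernel P π) 𝒟 →
      ∀ σ : Ambient d₁ d₂ → Param D → ℝ, Measurable (Function.uncurry σ) →
        -- the assumptions on the data, the activation function and the reward
        (∀ x : S × A, ‖pairPoint x‖ ≤ 1) →
        ActivationBounds S A σ B₀ B₁ B₂ →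
        (∀ x : S × A, ∀ᵐ r ∂(R x), |r| ≤ Br) →
      -- the fixed point of the projected Bellman equation
      ∀ Qstar : S × A → ℝ,
        IsProjection 𝒟 (networkClass fun (x : S × A) θ => σ (pairPoint x) θ)
          (bellman P R π γ Qstar) Qstar →
      -- the solution of the PDE
      ∀ (T : ℝ), 0 ≤ T →
      ∀ (ρ₀ : ProbabilityMeasure (Param D)) (ρ : ℝ → ProbabilityMeasure (Param D)),
        IsPDESolution α η γ T (fun (x : S × A) θ => σ (pairPoint x) θ)
          (sampleLaw P R π 𝒟) ρ₀ ρ →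
      ∀ (m : ℕ) (ε δ : ℝ), 1 ≤ m → 0 < ε → 0 < δ → δ < 1 → (2 ≤ m ∨ δ ≤ 1 / 2) →
      -- the random initialization and the i.i.d. transitions
      ∀ (Ω : Type*) [MeasurableSpace Ω] (Pr : Measure Ω) [IsProbabilityMeasure Pr]
        (θ₀ : Fin m → Ω → Param D) (z : ℕ → Ω → (S × A) × (ℝ × (S × A))),
        (∀ i, Measurable (θ₀ i)) → (∀ k, Measurable (z k)) →
        (∀ i, Pr.map (θ₀ i) = ρ₀) → (∀ k, Pr.map (z k) = sampleLaw P R π 𝒟) →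
        iIndepFun θ₀ Pr → iIndepFun z Pr →
        IndepFun (fun ω i => θ₀ i ω) (fun ω k => z k ω) Pr →
      1 - δ ≤ Pr.real {ω | ∀ k : ℕ, (k : ℝ) ≤ T / ε →
        ∫ x, (finiteQ α (fun (x : S × A) θ => σ (pairPoint x) θ)
            (tdIterate α η γ ε (fun (x : S × A) θ => σ (pairPoint x) θ)
              (fun i => θ₀ i ω) (fun j => z j ω) k) x - Qstar x) ^ 2 ∂𝒟
          ≤ ∫ x, (meanFieldQ α (fun (x : S × A) θ => σ (pairPoint x) θ)
              (ρ (k * ε)) x - Qstar x) ^ 2 ∂𝒟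
            + B * Real.exp (B * T) *
              (√(Real.log (m / δ) / m) + √(ε * (D + Real.log (m / δ))))} := by
  obtain ⟨C, Γ, hC, hΓ, main⟩ := TDModel.exists_const_measure_le (b₀ := |B₀| + 1) (b₁ := |B₁| + 1)
    (b₂ := |B₂| + 1) (br := |Br| + 1) hα hη (by positivity) (by positivity) (by positivity)
    (by positivity)
  set b₀ := |B₀| + 1 with hb₀
  have hb₀0 : 0 < b₀ := by positivity
  refine ⟨2 * (α * b₀ + b₀) * C + Γ + 2 * (α * b₀ + b₀) ^ 2, by positivity, ?_⟩
  intro d₁ d₂ D S A P R π 𝒟 _ _ _ _ hinv σ hσ hx hact hr Qstar hQ T hT ρ₀ ρ hρ m ε δ hm hε hδ hδ1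
    hmδ Ω _ Pr _ θ₀ z hθ hz hθlaw hzlaw hθi hzi hind
  have h := hact.tdModel hinv hσ hx hr (P := P) (π := π) (𝒟 := 𝒟)
  set s : S × A → Param D → ℝ := fun x θ => σ (pairPoint x) θ with hs
  have hΛ := (half_le_log_div_and_le hm hδ hδ1.le hmδ).1
  set Λ := Real.log (m / δ) with hΛdef
  set u := √(Λ / m) with hu
  set w := √(ε * (D + Λ)) with hw
  have hu0 : 0 ≤ u := Real.sqrt_nonneg _
  have hw0 : 0 ≤ w := Real.sqrt_nonneg _
  set B := 2 * (α * b₀ + b₀) * C + Γ + 2 * (α * b₀ + b₀) ^ 2 with hB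
  have hpos : 0 ≤ 2 * (α * b₀ + b₀) * C := by positivity
  have hsq : 0 ≤ 2 * (α * b₀ + b₀) ^ 2 := by positivity
  have hB1 : 2 * (α * b₀ + b₀) * C ≤ B := by rw [hB]; linarith
  have hB2 : Γ ≤ B := by rw [hB]; linarith
  have hB3 : 2 * (α * b₀ + b₀) ^ 2 ≤ B := by rw [hB]; linarith
  have hB0 : 0 ≤ B := hΓ.trans hB2
  -- the fixed point is a network average, hence measurable and bounded
  obtain ⟨⟨ρs, hρs, -, hQs⟩, -⟩ := hQ
  have hQm : Measurable Qstar := by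
    rw [hQs]
    exact (StronglyMeasurable.integral_prod_right (f := s)
      h.measurable.stronglyMeasurable).measurable
  have hQb : ∀ x, |Qstar x| ≤ b₀ := fun x => by
    rw [hQs]
    exact abs_integral_le_of_abs_le (Filter.Eventually.of_forall (h.bound x))
  rcases le_or_gt ε 1 with hε1 | hε1
  · obtain ⟨bad, hbad, hgood⟩ := main h hγ₀ hγ₁ hT hm hε hε1 hδ hδ1 hmδ hρ hθ hz hθlaw hzlaw hθi
      hzi hind
    set good := {ω | ∀ k : ℕ, (k : ℝ) ≤ T / ε →
        ∫ x, (finiteQ α s (tdIterate α η γ ε s (fun i => θ₀ i ω) (fun j => z j ω) k) x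
          - Qstar x) ^ 2 ∂𝒟
          ≤ ∫ x, (meanFieldQ α s (ρ (k * ε)) x - Qstar x) ^ 2 ∂𝒟
            + B * Real.exp (B * T) * (u + w)} with hgoodset
    have hcov : Set.univ ⊆ good ∪ bad := by
      intro ω _
      by_cases hω : ω ∈ bad
      · exact Or.inr hω
      · refine Or.inl fun k hk => ?_
        have e1 := integral_sq_sub_le_add (𝒟 := 𝒟)
          (h.measurable_finiteQ α
            (tdIterate α η γ ε s (fun i => θ₀ i ω) (fun j => z j ω) k))
          (h.measurable_meanFieldQ α (ρ (k * ε) : Measure (Param D))) hQm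
          (h.abs_finiteQ_le hα hm _) (h.abs_meanFieldQ_le hα _) hQb
        refine e1.trans (add_le_add le_rfl ?_)
        calc _ ≤ 2 * (α * b₀ + b₀) * (C * Real.exp (Γ * T) * (u + w)) :=
              mul_le_mul_of_nonneg_left (hgood ω hω k hk) (by positivity)
          _ = (2 * (α * b₀ + b₀) * C) * Real.exp (Γ * T) * (u + w) := by ring
          _ ≤ B * Real.exp (B * T) * (u + w) := by gcongr
    have h1 : (1 : ℝ) ≤ Pr.real good + Pr.real bad := by
      rw [← probReal_univ (μ := Pr)]
      exact (measureReal_mono hcov).trans (measureReal_union_le _ _)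
    have h2 : Pr.real bad ≤ δ := ENNReal.toReal_le_of_le_ofReal hδ.le hbad
    linarith
  · -- for a large step the error term exceeds the trivial bound on the left-hand side
    have hall : ∀ ω, ∀ k : ℕ, (k : ℝ) ≤ T / ε →
        ∫ x, (finiteQ α s (tdIterate α η γ ε s (fun i => θ₀ i ω) (fun j => z j ω) k) x
          - Qstar x) ^ 2 ∂𝒟
          ≤ ∫ x, (meanFieldQ α s (ρ (k * ε)) x - Qstar x) ^ 2 ∂𝒟
            + B * Real.exp (B * T) * (u + w) := by
      intro ω k _
      have e1 : ∫ x, (finiteQ α s (tdIterate α η γ ε s (fun i => θ₀ i ω) (fun j => z j ω) k) x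
          - Qstar x) ^ 2 ∂𝒟 ≤ (α * b₀ + b₀) ^ 2 := by
        refine (le_abs_self _).trans (abs_integral_le_of_abs_le
          (Filter.Eventually.of_forall fun x => ?_))
        rw [abs_pow]
        gcongr
        exact (abs_sub _ _).trans (add_le_add (h.abs_finiteQ_le hα hm _ x) (hQb x))
      have e2 : 0 ≤ ∫ x, (meanFieldQ α s (ρ (k * ε)) x - Qstar x) ^ 2 ∂𝒟 :=
        integral_nonneg fun _ => sq_nonneg _
      have hD : (0 : ℝ) ≤ D := Nat.cast_nonneg D
      have e3 : 1 / 2 ≤ u + w := by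
        have : 1 / 2 ≤ w := Real.le_sqrt_of_sq_le (by nlinarith)
        linarith
      have e4 : 1 ≤ Real.exp (B * T) := Real.one_le_exp (by positivity)
      have e5 : 2 * (α * b₀ + b₀) ^ 2 * 1 * (1 / 2) ≤ B * Real.exp (B * T) * (u + w) := by
        gcongr
      linarith
    refine le_trans (by linarith : 1 - δ ≤ 1) ?_
    rw [← probReal_univ (μ := Pr)]
    exact measureReal_mono fun ω _ => hall ω
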